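/- **Setting.** Let $\mathcal S$ be a category of spaces: a full subcategory of topological spaces that has finite products and contains (up to homeomorphism, with the subspace topology) all convex subsets of finite-dimensional real vector spaces, e.g. compactly generated weak Hausdorff spaces. Let $(\mathcal M,\square,\mathbf 1)$ be a closed symmetric monoidal category with countable colimits, enriched over spaces via a strong symmetric monoidal left adjoint functor $L\colon(\mathcal S,\times,*)\to(\mathcal M,\square,\mathbf 1)$. Maps $f_0,f_1\colon X\to Y$ of $\mathcal M$ are *homotopic* if there is a map $X\square L[0,1]\to Y$ that restricts to $f_0$ and $f_1$ at the end points of $[0,1]$. A map $f\colon X\to Y$ is a *homotopy equivalence* if there is $g\colon Y\to X$ with $gf$ homotopic to $\mathrm{id}_X$ and $fg$ homotopic to $\mathrm{id}_Y$. **The operad.** Let $\overline{\mathcal C}_1(m)\subset\mathbb R^{2m}$ be the space of lists $([x_1,y_1],\dots,[x_m,y_m])$ of closed subintervals of $[0,1]$ of positive length, with disjoint interiors and in their natural order. These spaces form a non-symmetric operad whose unit is $[0,1]$ and whose composition $\Gamma$ replaces each interval by a list of intervals, rescaled by the increasing affine map from $[0,1]$ onto that interval. Let $\mathcal O=L\overline{\mathcal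 C}_1$, and let $A$ be an $\mathcal O$-algebra in $\mathcal M$, i.e. an object with an associative and unital action of maps $\mathcal O(m)\square A^{(m)}\to A$, $m\ge0$. Its unit is $1_A\colon\mathbf 1\cong\mathcal O(0)\to A$. **The algebra $\overline UA$.** The non-symmetric enveloping algebra $\overline UA$ is the coequalizer of the two maps $$\coprod_m \mathcal O(m+1)\,\square\,\Big(\coprod_j\mathcal O(j)\square A^{(j)}\Big)^{(m)}\rightrightarrows\coprod_m\mathcal O(m+1)\square A^{(m)}$$ given by the action on $A$, and by the operadic composition with the operad unit in the last, $(m+1)$-st, slot. It is a $\square$-monoid: the multiplication $(\mathcal O(m+1)\square A^{(m)})\square(\mathcal O(n+1)\square A^{(n)})\to\mathcal O(m+n+1)\square A^{(m+n)}$ is induced by composition in the last slot, and the unit is the operad unit in the summand $\mathcal O(1)$. The canonical map $\overline UA\to A$ inserts $1_A$ in the last slot and acts on $A$. **The algebras $MA$ and $NA$.** Let $\overline M=\mathbb R^{\ge0}$, with the product $r\cdot r'=r+r'$ and length $\ell(r)=r$. Let $\overline N=\mathbb R^{\ge0}\times\mathbb R^{>0}\times\mathbb R^{\ge0}$, with the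 product $(r,s,t)(r',s',t')=(r+sr',\,ss',\,st'+t)$, the unit $(0,1,0)$ and the length $\ell(r,s,t)=r$. For $S=\overline M,\overline N$ let $S_+\subset S$ be the subset $\{\ell>0\}$, and let $MA$, respectively $NA$, be the pushout of $$LS\square\mathbf 1\leftarrow LS_+\square\mathbf 1\to LS_+\square A$$ formed with the inclusion $S_+\subset S$ and with $1_A$. Both are $\square$-monoids. The unit is the unit of $S$ in $LS\square \mathbf 1$. The multiplication is induced by the product $(a,b)\mapsto ab$ of $S$ together with the following operations on $A$, where $c=\ell(a)/\ell(ab)$: * the two intervals $([0,c],[c,1])\in\overline{\mathcal C}_1(2)$ on $(LS_+\square A)\square(LS_+\square A)$; * the one interval $[c,1]\in\overline{\mathcal C}_1(1)$ on $(LS\square\mathbf 1)\square(LS_+\square A)$; * the one interval $[0,c]\in\overline{\mathcal C}_1(1)$ on $(LS_+\square A)\square(LS\square\mathbf 1)$; * no operation on $(LS\square\mathbf 1)\square(LS\square\mathbf 1)$. The canonical map $MA\to A$ is the projection $L\overline M_+\square A\to\mathbf 1\square A\cong A$ on one part and $L\overline M\square\mathbf 1\to\mathbf 1\xrightarrow{1_A}A$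 on the other. **Theorem.** The formulas above define $\square$-monoid structures on $\overline UA$, $NA$ and $MA$, natural in $A$, and there is a zigzag of maps of $\square$-monoids, natural in $A$, $$\overline UA\longrightarrow NA\longleftarrow MA$$ whose maps are homotopy equivalences in $\mathcal M$. The first map is given by $[x,y]\mapsto(x,y-x,1-y)$ on $\mathcal O(1)\square\mathbf 1$; on $LD\square A$, where $D=\{[x,y]\in\overline{\mathcal C}_1(1): x>0\}$ and $LD\square A\to\overline UA$ is induced by $[x,y]\mapsto([0,x],[x,y])\in\overline{\mathcal C}_1(2)$, it is given by the same formula on $D$ and the identity of $A$. The second map is induced by $r\mapsto(r,1,0)$ and the identity of $A$. Moreover, the canonical maps $\overline UA\to A$ and $MA\to A$ are homotopy equivalences in $\mathcal M$. -/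

import Mathlib

open CategoryTheory MonoidalCategory CartesianMonoidalCategory Limits

universe w v u

namespace LittleIntervals

noncomputable section

/-! ### Categories of spaces

The category of spaces is a full subcategory `P.FullSubcategory` of topological spaces.  Besides
finite products (the cartesian monoidal structure), the only thing that is asked of it is that it
contains the convex subsets of finite dimensional real vector spaces, with the subspace topology.
Compactly generated weak Hausdorff spaces, compactly generated spaces and Delta-generated spaces
are examples. -/

class ContainsConvex (P : ObjectProperty TopCat.{w}) : Prop where
  convex_mem : ∀ (V : Type) [NormedAddCommGroup V] [NormedSpace ℝ V] [FiniteDimensional ℝ V]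
    (s : Set V), Convex ℝ s → P (TopCat.of (ULift.{w} s))

section Spaces

variable {P : ObjectProperty TopCat.{w}}

/-- A convex set, as an object of the category of spaces. -/
def space (P : ObjectProperty TopCat.{w}) [ContainsConvex P] {V : Type} [NormedAddCommGroup V]
    [NormedSpace ℝ V] [FiniteDimensional ℝ V] (s : Set V) (hs : Convex ℝ s) :
    P.FullSubcategory :=
  ⟨TopCat.of (ULift.{w} s), ContainsConvex.convex_mem V s hs⟩

section

variable [ContainsConvex P] {V : Type} [NormedAddCommGroup V] [NormedSpace ℝ V]
  [FiniteDimensional ℝ V] {s : Set V} {hs : Convex ℝ s}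

/-- The vector underlying a point of `space P s hs`. -/
def val (x : (space P s hs).obj) : V := (show ULift.{w} s from x).down.1

theorem val_mem (x : (space P s hs).obj) : val x ∈ s := (show ULift.{w} s from x).down.2

theorem continuous_val : Continuous (val : (space P s hs).obj → V) :=
  continuous_subtype_val.comp continuous_uliftDown

/-- The map of spaces into a convex set given by a continuous function. -/
def homTo {X : P.FullSubcategory} (hs : Convex ℝ s) (f : X.obj → V) (hf : Continuous f)
    (hfs : ∀ x, f x ∈ s) : X ⟶ space P s hs :=
  ObjectProperty.homMk (TopCat.ofHom
    ⟨fun x => ULift.up ⟨f x, hfs x⟩, continuous_uliftUp.comp (hf.subtype_mk hfs)⟩)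

end

section

variable [CartesianMonoidalCategory P.FullSubcategory] {X Y : P.FullSubcategory}

/-- The two coordinates of a point of a product of spaces. -/
def pr₁ (z : (X ⊗ Y).obj) : X.obj := (fst X Y).hom z

def pr₂ (z : (X ⊗ Y).obj) : Y.obj := (snd X Y).hom z

theorem continuous_pr₁ : Continuous (pr₁ : (X ⊗ Y).obj → X.obj) := (fst X Y).hom.hom.continuous

theorem continuous_pr₂ : Continuous (pr₂ : (X ⊗ Y).obj → Y.obj) := (snd X Y).hom.hom.continuous

end

end Spaces

/-! ### Finite sequences of arities and tensor products indexed by them -/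

/-- A finite sequence `j₁, …, jₘ` of natural numbers. -/
inductive Arities : Type
  | nil : Arities
  | snoc : Arities → ℕ → Arities

namespace Arities

/-- The length `m`. -/
@[reducible] def len : Arities → ℕ
  | nil => 0
  | snoc js _ => len js + 1

/-- The sum `j₁ + ⋯ + jₘ`. -/
@[reducible] def total : Arities → ℕ
  | nil => 0
  | snoc js j => total js + j

def toList : Arities → List ℕ
  | nil => []
  | snoc js j => j :: toList js

theorem toList_injective : Function.Injective toList := by
  intro a
  induction a with
  | nil => intro b h; cases b <;> simp_all [toList]
  | snoc js j ih =>
    intro b h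
    cases b with
    | nil => simp [toList] at h
    | snoc ks k =>
      simp only [toList, List.cons.injEq] at h
      rw [h.1, ih h.2]

instance : Countable Arities := toList_injective.countable

end Arities

section Monoidal

variable {C : Type u} [Category.{v} C] [MonoidalCategory C]

/-- The tensor product `F j₁ ⊗ ⋯ ⊗ F jₘ` (bracketed to the left, starting with the unit). -/
@[reducible] def tensorOver (F : ℕ → C) : Arities → C
  | .nil => 𝟙_ C
  | .snoc js j => tensorOver F js ⊗ F j

/-- The tensor power `X^(m)` (bracketed to the left, starting with the unit). -/
@[reducible] def tpow (X : C) : ℕ → C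
  | 0 => 𝟙_ C
  | m + 1 => tpow X m ⊗ X

/-- Functoriality of tensor powers. -/
def tpowMap {X Y : C} (f : X ⟶ Y) : ∀ m, tpow X m ⟶ tpow Y m
  | 0 => 𝟙 (𝟙_ C)
  | m + 1 => tpowMap f m ⊗ₘ f

/-- The canonical isomorphism `X^(m) ⊗ X^(n) ⟶ X^(m+n)`. -/
def tpowAdd (X : C) (m : ℕ) : ∀ n, tpow X m ⊗ tpow X n ⟶ tpow X (m + n)
  | 0 => (ρ_ (tpow X m)).hom
  | n + 1 => (α_ (tpow X m) (tpow X n) X).inv ≫ tpowAdd X m n ▷ X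

/-- The canonical isomorphism `X^(j₁) ⊗ ⋯ ⊗ X^(jₘ) ⟶ X^(j₁ + ⋯ + jₘ)`. -/
def tpowTotal (X : C) : ∀ js : Arities, tensorOver (tpow X) js ⟶ tpow X js.total
  | .nil => 𝟙 (𝟙_ C)
  | .snoc js j => tpowTotal X js ▷ tpow X j ≫ tpowAdd X js.total j

/-- The map `f j₁ ⊗ ⋯ ⊗ f jₘ : F j₁ ⊗ ⋯ ⊗ F jₘ ⟶ X^(m)` for maps `f j : F j ⟶ X`. -/
def tensorOverTo {F : ℕ → C} {X : C} (f : ∀ j, F j ⟶ X) :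
    ∀ js : Arities, tensorOver F js ⟶ tpow X js.len
  | .nil => 𝟙 (𝟙_ C)
  | .snoc js j => tensorOverTo f js ⊗ₘ f j

/-- The map `f j₁ ⊗ ⋯ ⊗ f jₘ : F j₁ ⊗ ⋯ ⊗ F jₘ ⟶ G j₁ ⊗ ⋯ ⊗ G jₘ`. -/
def tensorOverMap {F G : ℕ → C} (f : ∀ j, F j ⟶ G j) :
    ∀ js : Arities, tensorOver F js ⟶ tensorOver G js
  | .nil => 𝟙 (𝟙_ C)
  | .snoc js j => tensorOverMap f js ⊗ₘ f j

/-- The shuffle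
`(F j₁ ⊗ G j₁) ⊗ ⋯ ⊗ (F jₘ ⊗ G jₘ) ⟶ (F j₁ ⊗ ⋯ ⊗ F jₘ) ⊗ (G j₁ ⊗ ⋯ ⊗ G jₘ)`. -/
def shuffle [BraidedCategory C] (F G : ℕ → C) :
    ∀ js : Arities, tensorOver (fun j => F j ⊗ G j) js ⟶ tensorOver F js ⊗ tensorOver G js
  | .nil => (λ_ (𝟙_ C)).inv
  | .snoc js j => shuffle F G js ▷ (F j ⊗ G j) ≫ tensorμ _ _ _ _

/-- The comparison map `L (F j₁) ⊗ ⋯ ⊗ L (F jₘ) ⟶ L (F j₁ ⊗ ⋯ ⊗ F jₘ)`. -/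
def tensorOverLax {S : Type*} [Category S] [MonoidalCategory S] (L : S ⥤ C) [L.LaxMonoidal]
    (F : ℕ → S) :
    ∀ js : Arities, tensorOver (fun j => L.obj (F j)) js ⟶ L.obj (tensorOver F js)
  | .nil => Functor.LaxMonoidal.ε L
  | .snoc js j =>
      tensorOverLax L F js ▷ L.obj (F j) ≫ Functor.LaxMonoidal.μ L (tensorOver F js) (F j)

theorem tpowMap_id (X : C) (m : ℕ) : tpowMap (𝟙 X) m = 𝟙 (tpow X m) := by
  induction m with
  | zero => rfl
  | succ m ih => simp [tpowMap, ih, tpow]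

theorem tpowMap_comp {X Y Z : C} (f : X ⟶ Y) (g : Y ⟶ Z) (m : ℕ) :
    tpowMap (f ≫ g) m = tpowMap f m ≫ tpowMap g m := by
  induction m with
  | zero => exact (Category.comp_id (𝟙 (𝟙_ C))).symm
  | succ m ih =>
    change tpowMap (f ≫ g) m ⊗ₘ (f ≫ g) = (tpowMap f m ⊗ₘ f) ≫ (tpowMap g m ⊗ₘ g)
    rw [ih, MonoidalCategory.tensorHom_comp_tensorHom]

theorem tpowAdd_natural {X Y : C} (f : X ⟶ Y) (m n : ℕ) :
    tpowAdd X m n ≫ tpowMap f (m + n) = (tpowMap f m ⊗ₘ tpowMap f n) ≫ tpowAdd Y m n := by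
  induction n with
  | zero =>
    change (ρ_ _).hom ≫ tpowMap f m = (tpowMap f m ⊗ₘ 𝟙 (𝟙_ C)) ≫ (ρ_ _).hom
    simp
  | succ n ih =>
    change ((α_ _ _ _).inv ≫ tpowAdd X m n ▷ X) ≫ (tpowMap f (m + n) ⊗ₘ f) =
      (tpowMap f m ⊗ₘ (tpowMap f n ⊗ₘ f)) ≫ (α_ _ _ _).inv ≫ tpowAdd Y m n ▷ Y
    rw [associator_inv_naturality_assoc, Category.assoc, ← tensorHom_id, ← tensorHom_id,
      tensorHom_comp_tensorHom, tensorHom_comp_tensorHom, ih, Category.id_comp, Category.comp_id]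

theorem tpowTotal_natural {X Y : C} (f : X ⟶ Y) (js : Arities) :
    tpowTotal X js ≫ tpowMap f js.total =
      tensorOverMap (fun j => tpowMap f j) js ≫ tpowTotal Y js := by
  induction js with
  | nil => rfl
  | snoc js j ih =>
    change (tpowTotal X js ▷ tpow X j ≫ tpowAdd X js.total j) ≫ tpowMap f (js.total + j) =
      (tensorOverMap (fun j => tpowMap f j) js ⊗ₘ tpowMap f j) ≫
        tpowTotal Y js ▷ tpow Y j ≫ tpowAdd Y js.total j
    rw [Category.assoc, tpowAdd_natural, ← tensorHom_id, ← tensorHom_id,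
      tensorHom_comp_tensorHom_assoc, tensorHom_comp_tensorHom_assoc, ih, Category.id_comp,
      Category.comp_id]

theorem shuffle_natural [BraidedCategory C] (F : ℕ → C) {G G' : ℕ → C} (g : ∀ j, G j ⟶ G' j)
    (js : Arities) :
    tensorOverMap (F := fun j => F j ⊗ G j) (G := fun j => F j ⊗ G' j) (fun j => F j ◁ g j) js ≫
      shuffle F G' js = shuffle F G js ≫ tensorOver F js ◁ tensorOverMap g js := by
  induction js with
  | nil =>
    change 𝟙 (𝟙_ C) ≫ (λ_ (𝟙_ C)).inv = (λ_ (𝟙_ C)).inv ≫ 𝟙_ C ◁ 𝟙 (𝟙_ C)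
    simp
  | snoc js j ih =>
    change (tensorOverMap (F := fun j => F j ⊗ G j) (G := fun j => F j ⊗ G' j)
        (fun j => F j ◁ g j) js ⊗ₘ F j ◁ g j) ≫
        shuffle F G' js ▷ (F j ⊗ G' j) ≫ tensorμ _ _ _ _ =
      (shuffle F G js ▷ (F j ⊗ G j) ≫ tensorμ _ _ _ _) ≫
        (tensorOver F js ⊗ F j) ◁ (tensorOverMap g js ⊗ₘ g j)
    rw [← tensorHom_id, tensorHom_comp_tensorHom_assoc, ih, Category.comp_id, Category.assoc,
      ← id_tensorHom (tensorOver F js ⊗ F j), ← id_tensorHom_id, ← tensorμ_natural,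
      ← tensorHom_id, tensorHom_comp_tensorHom_assoc, id_tensorHom, id_tensorHom,
      Category.id_comp]

theorem tensorOverMap_comp_to {F G : ℕ → C} {X : C} (a : ∀ j, F j ⟶ G j) (b : ∀ j, G j ⟶ X)
    (js : Arities) :
    tensorOverMap a js ≫ tensorOverTo b js = tensorOverTo (fun j => a j ≫ b j) js := by
  induction js with
  | nil => exact Category.comp_id (𝟙 (𝟙_ C))
  | snoc js j ih =>
    change (tensorOverMap a js ⊗ₘ a j) ≫ (tensorOverTo b js ⊗ₘ b j) =
      tensorOverTo (fun j => a j ≫ b j) js ⊗ₘ (a j ≫ b j)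
    rw [tensorHom_comp_tensorHom, ih]

theorem tensorOverTo_comp_tpowMap {F : ℕ → C} {X Y : C} (a : ∀ j, F j ⟶ X) (f : X ⟶ Y)
    (js : Arities) :
    tensorOverTo a js ≫ tpowMap f js.len = tensorOverTo (fun j => a j ≫ f) js := by
  induction js with
  | nil => exact Category.comp_id (𝟙 (𝟙_ C))
  | snoc js j ih =>
    change (tensorOverTo a js ⊗ₘ a j) ≫ (tpowMap f js.len ⊗ₘ f) =
      tensorOverTo (fun j => a j ≫ f) js ⊗ₘ (a j ≫ f)
    rw [tensorHom_comp_tensorHom, ih]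

end Monoidal

/-! ### The non-symmetric operad of little intervals

A closed subinterval `[x, y]` of the line is written as the pair `(x, y)`. -/

/-- The image of the interval `q` under the increasing affine map that takes `[0,1]` to `p`. -/
def rescale (p q : ℝ × ℝ) : ℝ × ℝ := (p.1 + (p.2 - p.1) * q.1, p.1 + (p.2 - p.1) * q.2)

/-- Sequences of `m` subintervals (of positive length) of `[0,1]` with disjoint interiors, listed
in their natural order. -/
def littleSet (m : ℕ) : Set (Fin m → ℝ × ℝ) :=
  {c | (∀ i, 0 ≤ (c i).1 ∧ (c i).1 < (c i).2 ∧ (c i).2 ≤ 1) ∧ ∀ i k, i < k → (c i).2 ≤ (c k).1}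

theorem convex_lt_aux {a b x x' y y' : ℝ} (ha : 0 ≤ a) (hb : 0 ≤ b) (hab : a + b = 1)
    (hx : x < x') (hy : y < y') : a * x + b * y < a * x' + b * y' := by
  rcases ha.eq_or_lt with rfl | ha
  · have : b = 1 := by linarith
    subst this; linarith
  · have h1 := mul_lt_mul_of_pos_left hx ha
    have h2 := mul_le_mul_of_nonneg_left hy.le hb
    linarith

theorem convex_le_aux {a b x x' y y' : ℝ} (ha : 0 ≤ a) (hb : 0 ≤ b)
    (hx : x ≤ x') (hy : y ≤ y') : a * x + b * y ≤ a * x' + b * y' := by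
  have h1 := mul_le_mul_of_nonneg_left hx ha
  have h2 := mul_le_mul_of_nonneg_left hy hb
  linarith

theorem convex_littleSet (m : ℕ) : Convex ℝ (littleSet m) := by
  intro c hc d hd a b ha hb hab
  refine ⟨fun i => ⟨?_, ?_, ?_⟩, fun i k hik => ?_⟩
  · have := convex_le_aux ha hb (hc.1 i).1 (hd.1 i).1
    simpa using this
  · have := convex_lt_aux ha hb hab (hc.1 i).2.1 (hd.1 i).2.1
    simpa using this
  · have := convex_le_aux ha hb (hc.1 i).2.2 (hd.1 i).2.2
    simpa [hab] using this
  · have := convex_le_aux ha hb (hc.2 i k hik) (hd.2 i k hik)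
    simpa using this

theorem rescale_mem {p q : ℝ × ℝ} (hp : p.1 < p.2) (hq : 0 ≤ q.1 ∧ q.1 < q.2 ∧ q.2 ≤ 1) :
    p.1 ≤ (rescale p q).1 ∧ (rescale p q).1 < (rescale p q).2 ∧ (rescale p q).2 ≤ p.2 := by
  have h : 0 < p.2 - p.1 := sub_pos.2 hp
  refine ⟨?_, ?_, ?_⟩
  · have := mul_nonneg h.le hq.1
    simp only [rescale]; linarith
  · have := mul_lt_mul_of_pos_left hq.2.1 h
    simp only [rescale]; linarith
  · have := mul_le_mul_of_nonneg_left hq.2.2 h.le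
    simp only [rescale]; linarith

theorem append_mem {m n : ℕ} {a : Fin m → ℝ × ℝ} {b : Fin n → ℝ × ℝ} (ha : a ∈ littleSet m)
    (hb : b ∈ littleSet n) (h : ∀ i k, (a i).2 ≤ (b k).1) : Fin.append a b ∈ littleSet (m + n) := by
  refine ⟨fun i => ?_, fun i k hik => ?_⟩
  · refine Fin.addCases (fun i => ?_) (fun i => ?_) i
    · simpa only [Fin.append_left] using ha.1 i
    · simpa only [Fin.append_right] using hb.1 i
  · revert hik
    refine Fin.addCases (fun i => ?_) (fun i => ?_) i <;>
      refine Fin.addCases (fun k => ?_) (fun k => ?_) k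
    · intro hik
      simp only [Fin.append_left]
      rw [Fin.lt_def, Fin.val_castAdd, Fin.val_castAdd] at hik
      exact ha.2 i k hik
    · intro _
      simp only [Fin.append_left, Fin.append_right]
      exact h i k
    · intro hik
      simp only [Fin.lt_def, Fin.val_natAdd, Fin.val_castAdd] at hik
      omega
    · intro hik
      simp only [Fin.append_right]
      rw [Fin.lt_def, Fin.val_natAdd, Fin.val_natAdd] at hik
      exact hb.2 i k (Fin.lt_def.2 (by omega))

theorem rescale_comp_mem {n : ℕ} {p : ℝ × ℝ} {b : Fin n → ℝ × ℝ}
    (hp : 0 ≤ p.1 ∧ p.1 < p.2 ∧ p.2 ≤ 1) (hb : b ∈ littleSet n) :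
    (fun i => rescale p (b i)) ∈ littleSet n := by
  refine ⟨fun i => ?_, fun i k hik => ?_⟩
  · obtain ⟨h1, h2, h3⟩ := rescale_mem hp.2.1 (hb.1 i)
    exact ⟨hp.1.trans h1, h2, h3.trans hp.2.2⟩
  · have := mul_le_mul_of_nonneg_left (hb.2 i k hik) (sub_pos.2 hp.2.1).le
    simp only [rescale]
    linarith

section Operad

variable (P : ObjectProperty TopCat.{w}) [ContainsConvex P]

/-- The space of `m` little intervals. -/
def little (m : ℕ) : P.FullSubcategory := space P (littleSet m) (convex_littleSet m)

variable [CartesianMonoidalCategory P.FullSubcategory]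

/-- The identity operation `[0,1]`. -/
def littleOne : 𝟙_ P.FullSubcategory ⟶ little P 1 :=
  homTo (convex_littleSet 1) (fun _ _ => (0, 1)) continuous_const (fun _ =>
    ⟨fun _ => by norm_num, fun i k h => absurd h (by omega)⟩)

/-- The unique operation of arity zero. -/
def littleZero : 𝟙_ P.FullSubcategory ⟶ little P 0 :=
  homTo (convex_littleSet 0) (fun _ => Fin.elim0) continuous_const (fun _ =>
    ⟨fun i => i.elim0, fun i => i.elim0⟩)

/-- The list of intervals obtained by putting the intervals of the `i`-th entry of `z`, rescaled,
in place of the `i`-th interval of `c`. -/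
def compFun : ∀ js : Arities, (Fin js.len → ℝ × ℝ) → (tensorOver (little P) js).obj →
    Fin js.total → ℝ × ℝ
  | .nil, _, _ => Fin.elim0
  | .snoc js j, c, z =>
      let z₁ : (tensorOver (little P) js).obj := pr₁ (Y := little P j) z
      let z₂ : (little P j).obj := pr₂ (X := tensorOver (little P) js) z
      Fin.append (compFun js (fun i => c i.castSucc) z₁)
        (fun i => rescale (c (Fin.last js.len)) (val z₂ i))

theorem continuous_compFun (js : Arities) :
    Continuous (fun p : (Fin js.len → ℝ × ℝ) × (tensorOver (little P) js).obj =>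
      compFun P js p.1 p.2) := by
  induction js with
  | nil => exact continuous_pi fun i => Fin.elim0 i
  | snoc js j ih =>
    refine continuous_pi fun i => ?_
    refine Fin.addCases (fun i => ?_) (fun i => ?_) i
    · simp only [compFun, Fin.append_left]
      have h : Continuous (fun p : (Fin (js.len + 1) → ℝ × ℝ) ×
          (tensorOver (little P) js ⊗ little P j : P.FullSubcategory).obj =>
          ((fun i : Fin js.len => p.1 i.castSucc), pr₁ p.2)) :=
        (continuous_pi fun i => (continuous_apply _).comp continuous_fst).prodMk
          (continuous_pr₁.comp continuous_snd)
      exact (continuous_apply i).comp (ih.comp h)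
    · simp only [compFun, Fin.append_right]
      have h : Continuous (fun p : (Fin (js.len + 1) → ℝ × ℝ) ×
          (tensorOver (little P) js ⊗ little P j : P.FullSubcategory).obj =>
          (p.1 (Fin.last js.len), val (pr₂ p.2) i)) :=
        ((continuous_apply _).comp continuous_fst).prodMk
          ((continuous_apply i).comp (continuous_val.comp (continuous_pr₂.comp continuous_snd)))
      have h' : Continuous (fun q : (ℝ × ℝ) × (ℝ × ℝ) => rescale q.1 q.2) := by
        unfold rescale; fun_prop
      exact h'.comp h

theorem compFun_mem (js : Arities) (c : Fin js.len → ℝ × ℝ) (hc : c ∈ littleSet js.len)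
    (z : (tensorOver (little P) js).obj) : compFun P js c z ∈ littleSet js.total ∧
      ∀ b, (∀ i, (c i).2 ≤ b) → ∀ k, (compFun P js c z k).2 ≤ b := by
  induction js with
  | nil => exact ⟨⟨fun i => Fin.elim0 i, fun i => Fin.elim0 i⟩, fun _ _ k => Fin.elim0 k⟩
  | snoc js j ih =>
    have hc' : (fun i : Fin js.len => c i.castSucc) ∈ littleSet js.len :=
      ⟨fun i => hc.1 i.castSucc, fun i k h => hc.2 _ _ (Fin.castSucc_lt_castSucc_iff.2 h)⟩
    obtain ⟨h1, h2⟩ := ih (fun i => c i.castSucc) hc' (pr₁ (Y := little P j) z)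
    have hz := val_mem (pr₂ (X := tensorOver (little P) js) (Y := little P j) z)
    have hl := hc.1 (Fin.last js.len)
    have hr := fun i => rescale_mem hl.2.1 (hz.1 i)
    have hcross := h2 (c (Fin.last js.len)).1
      (fun i => hc.2 i.castSucc (Fin.last js.len) (Fin.castSucc_lt_last i))
    refine ⟨append_mem h1 (rescale_comp_mem hl hz) (fun i k => (hcross i).trans (hr k).1),
      fun b hb k => ?_⟩
    change (Fin.append (compFun P js (fun i => c i.castSucc) (pr₁ (Y := little P j) z))
      (fun i => rescale (c (Fin.last js.len))
        (val (pr₂ (X := tensorOver (little P) js) (Y := little P j) z) i)) k).2 ≤ b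
    refine Fin.addCases (fun k => ?_) (fun k => ?_) k
    · rw [Fin.append_left]
      exact h2 b (fun i => hb i.castSucc) k
    · rw [Fin.append_right]
      exact (hr k).2.2.trans (hb (Fin.last js.len))

/-- The operadic composition `Γ` of little intervals. -/
def littleComp (js : Arities) :
    little P js.len ⊗ tensorOver (little P) js ⟶ little P js.total :=
  homTo (convex_littleSet _)
    (fun z => compFun P js (val (pr₁ (X := little P js.len) z)) (pr₂ (X := little P js.len) z))
    ((continuous_compFun P js).comp
      ((continuous_val.comp (continuous_pr₁ (X := little P js.len))).prodMk continuous_pr₂))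
    (fun z => (compFun_mem P js _ (val_mem (pr₁ (X := little P js.len) z)) _).1)

/-- The operation `∘` that composes in the last slot: the last interval of the first sequence is
replaced by the rescaled second sequence. -/
def littleCompLast (m n : ℕ) : little P (m + 1) ⊗ little P (n + 1) ⟶ little P (m + n + 1) :=
  homTo (convex_littleSet (m + (n + 1)))
    (fun z => Fin.append
      (fun i : Fin m => val (pr₁ (X := little P (m + 1)) z) i.castSucc)
      (fun i : Fin (n + 1) => rescale (val (pr₁ (X := little P (m + 1)) z) (Fin.last m))
        (val (pr₂ (Y := little P (n + 1)) z) i)))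
    (by
      have h₁ : Continuous fun z : (little P (m + 1) ⊗ little P (n + 1)).obj =>
        val (pr₁ (X := little P (m + 1)) z) := continuous_val.comp continuous_pr₁
      have h₂ : Continuous fun z : (little P (m + 1) ⊗ little P (n + 1)).obj =>
        val (pr₂ (Y := little P (n + 1)) z) := continuous_val.comp continuous_pr₂
      refine continuous_pi fun i => ?_
      refine Fin.addCases (fun i => ?_) (fun i => ?_) i
      · simp only [Fin.append_left]
        exact (continuous_apply _).comp h₁
      · simp only [Fin.append_right]
        have h : Continuous (fun q : (ℝ × ℝ) × (ℝ × ℝ) => rescale q.1 q.2) := by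
          unfold rescale; fun_prop
        exact h.comp (((continuous_apply _).comp h₁).prodMk ((continuous_apply _).comp h₂)))
    (fun z => by
      have hc := val_mem (pr₁ (X := little P (m + 1)) (Y := little P (n + 1)) z)
      have hd := val_mem (pr₂ (X := little P (m + 1)) (Y := little P (n + 1)) z)
      have hl := hc.1 (Fin.last m)
      refine append_mem ⟨fun i => hc.1 i.castSucc,
        fun i k h => hc.2 _ _ (Fin.castSucc_lt_castSucc_iff.2 h)⟩ (rescale_comp_mem hl hd)
        (fun i k => (hc.2 i.castSucc (Fin.last m) (Fin.castSucc_lt_last i)).trans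
          (rescale_mem hl.2.1 (hd.1 k)).1))

end Operad

section Algebra

variable {P : ObjectProperty TopCat.{w}} [ContainsConvex P]
  [CartesianMonoidalCategory P.FullSubcategory] [BraidedCategory P.FullSubcategory]
  {C : Type u} [Category.{v} C] [MonoidalCategory C] [SymmetricCategory C]
  (L : P.FullSubcategory ⥤ C) [L.Braided]

/-! ### The operad `L C₁` and its algebras -/

/-- The objects of the operad `L C₁`. -/
abbrev op (m : ℕ) : C := L.obj (little P m)

/-- The unit of the operad `L C₁`. -/
def opOne : 𝟙_ C ⟶ op L 1 := Functor.LaxMonoidal.ε L ≫ L.map (littleOne P)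

/-- The composition of the operad `L C₁`. -/
def opComp (js : Arities) : op L js.len ⊗ tensorOver (op L) js ⟶ op L js.total :=
  op L js.len ◁ tensorOverLax L (little P) js ≫ Functor.LaxMonoidal.μ L _ _ ≫
    L.map (littleComp P js)

/-- The composition in the last slot of the operad `L C₁`. -/
def opCompLast (m n : ℕ) : op L (m + 1) ⊗ op L (n + 1) ⟶ op L (m + n + 1) :=
  Functor.LaxMonoidal.μ L _ _ ≫ L.map (littleCompLast P m n)

/-- The shuffle
`(O(j₁) ⊗ X^(j₁)) ⊗ ⋯ ⊗ (O(jₘ) ⊗ X^(jₘ)) ⟶ (O(j₁) ⊗ ⋯ ⊗ O(jₘ)) ⊗ X^(j₁ + ⋯ + jₘ)`. -/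
def opShuffle (X : C) (js : Arities) :
    tensorOver (fun j => op L j ⊗ tpow X j) js ⟶ tensorOver (op L) js ⊗ tpow X js.total :=
  shuffle (op L) (tpow X) js ≫ tensorOver (op L) js ◁ tpowTotal X js

/-- Algebras over the non-symmetric operad `L C₁`. -/
structure Alg where
  X : C
  act : ∀ m : ℕ, op L m ⊗ tpow X m ⟶ X
  assoc : ∀ js : Arities,
    op L js.len ◁ tensorOverTo act js ≫ act js.len =
      op L js.len ◁ opShuffle L X js ≫ (α_ _ _ _).inv ≫
        opComp L js ▷ tpow X js.total ≫ act js.total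
  unit : (opOne L ⊗ₘ (λ_ X).inv) ≫ act 1 = (λ_ X).hom

variable {L}

namespace Alg

@[ext]
structure Hom (A B : Alg L) where
  hom : A.X ⟶ B.X
  act_hom : ∀ m, A.act m ≫ hom = op L m ◁ tpowMap hom m ≫ B.act m

instance : Category (Alg L) where
  Hom A B := Hom A B
  id A := ⟨𝟙 _, fun m => by simp [tpowMap_id]⟩
  comp f g := ⟨f.hom ≫ g.hom, fun m => by
    rw [← Category.assoc, f.act_hom, Category.assoc, g.act_hom, tpowMap_comp,
      MonoidalCategory.whiskerLeft_comp, Category.assoc]⟩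
  id_comp f := Hom.ext (Category.id_comp _)
  comp_id f := Hom.ext (Category.comp_id _)
  assoc f g h := Hom.ext (Category.assoc _ _ _)

/-- The unit `𝟙 ≅ L C₁(0) ⟶ A`. -/
def one (A : Alg L) : 𝟙_ C ⟶ A.X :=
  Functor.LaxMonoidal.ε L ≫ L.map (littleZero P) ≫ (ρ_ (op L 0)).inv ≫ A.act 0

theorem one_hom {A B : Alg L} (φ : A ⟶ B) : A.one ≫ φ.hom = B.one := by
  have h : A.act 0 ≫ φ.hom = B.act 0 :=
    (φ.act_hom 0).trans ((congrArg (· ≫ B.act 0)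
      (MonoidalCategory.whiskerLeft_id (op L 0) (𝟙_ C))).trans (Category.id_comp _))
  simp only [one, Category.assoc, h]

end Alg

/-- The map `L S ⟶ L * ≅ 𝟙`. -/
def collapse (L : P.FullSubcategory ⥤ C) [L.Braided] (S : P.FullSubcategory) : L.obj S ⟶ 𝟙_ C :=
  L.map (toUnit S) ≫ Functor.OplaxMonoidal.η L

theorem map_collapse {S T : P.FullSubcategory} (f : S ⟶ T) :
    L.map f ≫ collapse L T = collapse L S := by
  rw [collapse, collapse, ← Category.assoc, ← L.map_comp]
  exact congrArg (fun t => L.map t ≫ _) (toUnit_unique _ _)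

/-! ### Homotopies -/

variable (L)

/-- The unit interval. -/
def interval (P : ObjectProperty TopCat.{w}) [ContainsConvex P] : P.FullSubcategory :=
  space P (Set.Icc (0 : ℝ) 1) (convex_Icc 0 1)

/-- The point `t` of the unit interval. -/
def intervalPoint (t : ℝ) (ht : t ∈ Set.Icc (0 : ℝ) 1) : 𝟙_ P.FullSubcategory ⟶ interval P :=
  homTo (convex_Icc 0 1) (fun _ => t) continuous_const (fun _ => ht)

/-- The inclusion `X ⟶ X ⊗ L[0,1]` at the point `t`. -/
def cylinderAt (X : C) (t : ℝ) (ht : t ∈ Set.Icc (0 : ℝ) 1) : X ⟶ X ⊗ L.obj (interval P) :=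
  (ρ_ X).inv ≫ X ◁ (Functor.LaxMonoidal.ε L ≫ L.map (intervalPoint t ht))

def Homotopic {X Y : C} (f g : X ⟶ Y) : Prop :=
  ∃ H : X ⊗ L.obj (interval P) ⟶ Y,
    cylinderAt L X 0 (by norm_num) ≫ H = f ∧ cylinderAt L X 1 (by norm_num) ≫ H = g

def IsHomotopyEquivalence {X Y : C} (f : X ⟶ Y) : Prop :=
  ∃ g : Y ⟶ X, Homotopic L (f ≫ g) (𝟙 X) ∧ Homotopic L (g ≫ f) (𝟙 Y)

variable {L}

/-! ### The non-symmetric enveloping algebra -/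

namespace Alg

theorem opShuffle_natural (L : P.FullSubcategory ⥤ C) [L.Braided] {X Y : C} (f : X ⟶ Y)
    (js : Arities) :
    opShuffle L X js ≫ tensorOver (op L) js ◁ tpowMap f js.total =
      tensorOverMap (F := fun j => op L j ⊗ tpow X j) (G := fun j => op L j ⊗ tpow Y j)
        (fun j => op L j ◁ tpowMap f j) js ≫ opShuffle L Y js := by
  rw [opShuffle, opShuffle, Category.assoc, ← MonoidalCategory.whiskerLeft_comp,
    tpowTotal_natural, MonoidalCategory.whiskerLeft_comp, ← Category.assoc, ← Category.assoc,
    shuffle_natural]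

theorem tensorμ_unit {X₁ X₂ Y₁ Y₂ : C} (y₁ : 𝟙_ C ⟶ Y₁) (y₂ : 𝟙_ C ⟶ Y₂) :
    ((ρ_ (X₁ ⊗ X₂)).inv ≫ (X₁ ⊗ X₂) ◁ ((λ_ (𝟙_ C)).inv ≫ (y₁ ⊗ₘ y₂))) ≫ tensorμ X₁ X₂ Y₁ Y₂ =
      ((ρ_ X₁).inv ≫ X₁ ◁ y₁) ⊗ₘ ((ρ_ X₂).inv ≫ X₂ ◁ y₂) := by
  have h := tensorμ_natural (𝟙 X₁) (𝟙 X₂) y₁ y₂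
  have h' := tensor_right_unitality X₁ X₂
  rw [id_tensorHom_id, id_tensorHom, id_tensorHom, id_tensorHom] at h
  have h'' : (ρ_ (X₁ ⊗ X₂)).inv ≫ (X₁ ⊗ X₂) ◁ (λ_ (𝟙_ C)).inv ≫ tensorμ X₁ X₂ (𝟙_ C) (𝟙_ C) =
      (ρ_ X₁).inv ⊗ₘ (ρ_ X₂).inv := by
    rw [← cancel_mono ((ρ_ X₁).hom ⊗ₘ (ρ_ X₂).hom), Category.assoc, Category.assoc, ← h',
      Iso.inv_hom_id, tensorHom_comp_tensorHom, Iso.inv_hom_id, Iso.inv_hom_id, id_tensorHom_id]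
  rw [MonoidalCategory.whiskerLeft_comp, Category.assoc, Category.assoc, h,
    ← tensorHom_comp_tensorHom, ← h'', Category.assoc, Category.assoc]

/-- The summand of `envMul` at `j₁, …, jₘ`, given by the operadic composition for
`j₁, …, jₘ, 1` and the unit of the operad in the last slot. -/
def envMulSummand (A : Alg L) (js : Arities) :
    op L (js.len + 1) ⊗ tensorOver (fun j => op L j ⊗ tpow A.X j) js ⟶
      op L (js.total + 1) ⊗ tpow A.X js.total :=
  op L (js.len + 1) ◁ opShuffle L A.X js ≫ (α_ _ _ _).inv ≫
    (op L (js.len + 1) ◁ ((ρ_ _).inv ≫ tensorOver (op L) js ◁ opOne L) ≫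
      opComp L (js.snoc 1)) ▷ tpow A.X js.total

theorem envMulSummand_natural {A B : Alg L} (φ : A ⟶ B) (js : Arities) :
    A.envMulSummand js ≫ op L (js.total + 1) ◁ tpowMap φ.hom js.total =
      op L (js.len + 1) ◁ tensorOverMap (F := fun j => op L j ⊗ tpow A.X j)
        (G := fun j => op L j ⊗ tpow B.X j) (fun j => op L j ◁ tpowMap φ.hom j) js ≫
          B.envMulSummand js := by
  have h : ∀ {Z : C} (G : op L (js.len + 1) ⊗ tensorOver (op L) js ⟶ Z),
      (op L (js.len + 1) ◁ opShuffle L A.X js ≫ (α_ _ _ _).inv ≫ G ▷ tpow A.X js.total) ≫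
        Z ◁ tpowMap φ.hom js.total =
      op L (js.len + 1) ◁ tensorOverMap (F := fun j => op L j ⊗ tpow A.X j)
        (G := fun j => op L j ⊗ tpow B.X j) (fun j => op L j ◁ tpowMap φ.hom j) js ≫
        op L (js.len + 1) ◁ opShuffle L B.X js ≫ (α_ _ _ _).inv ≫ G ▷ tpow B.X js.total := by
    intro Z G
    rw [Category.assoc, Category.assoc, ← whisker_exchange,
      ← MonoidalCategory.whiskerLeft_comp_assoc, ← opShuffle_natural,
      MonoidalCategory.whiskerLeft_comp_assoc, associator_inv_naturality_right_assoc]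
  exact h _

/-- The summand `O(m+1) ⊗ A^(m) ≅ O(m+1) ⊗ (A^(m) ⊗ 𝟙) ⟶ O(m+1) ⊗ A^(m+1) ⟶ A` of the canonical
map from the enveloping algebra to `A`. -/
def envToAlgSummand (A : Alg L) (m : ℕ) : op L (m + 1) ⊗ tpow A.X m ⟶ A.X :=
  op L (m + 1) ◁ ((ρ_ (tpow A.X m)).inv ≫ tpow A.X m ◁ A.one) ≫ A.act (m + 1)

theorem envToAlg_aux (A : Alg L) (js : Arities) :
    op L (js.len + 1) ◁ tensorOverTo A.act js ≫ A.envToAlgSummand js.len =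
      A.envMulSummand js ≫ A.envToAlgSummand js.total := by
  have hassoc := A.assoc (js.snoc 1)
  let T := tensorOver (fun j => op L j ⊗ tpow A.X j) js
  let k : 𝟙_ C ⟶ op L 1 ⊗ tpow A.X 1 :=
    (λ_ (𝟙_ C)).inv ≫ (opOne L ⊗ₘ (A.one ≫ (λ_ A.X).inv))
  have hk : k ≫ A.act 1 = A.one := by
    have h : k = (λ_ (𝟙_ C)).inv ≫ (𝟙_ C ◁ A.one) ≫ (opOne L ⊗ₘ (λ_ A.X).inv) := by
      simp only [k, ← id_tensorHom, tensorHom_comp_tensorHom, Category.id_comp]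
    rw [h, Category.assoc, Category.assoc, A.unit, leftUnitor_naturality, Iso.inv_hom_id_assoc]
  let e : T ⟶ T ⊗ (op L 1 ⊗ tpow A.X 1) := (ρ_ T).inv ≫ T ◁ k
  have h₁ : e ≫ (tensorOverTo A.act js ⊗ₘ A.act 1) =
      tensorOverTo A.act js ≫ (ρ_ _).inv ≫ tpow A.X js.len ◁ A.one := by
    simp only [e, Category.assoc]
    rw [← id_tensorHom, tensorHom_comp_tensorHom, hk, Category.id_comp, tensorHom_def',
      whisker_exchange, ← rightUnitor_inv_naturality_assoc]
  let a : tensorOver (op L) js ⟶ tensorOver (op L) js ⊗ op L 1 := (ρ_ _).inv ≫ _ ◁ opOne L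
  let b : tpow A.X js.total ⟶ tpow A.X js.total ⊗ A.X := (ρ_ _).inv ≫ _ ◁ A.one
  have h₂ : e ≫ opShuffle L A.X (js.snoc 1) = opShuffle L A.X js ≫ (a ⊗ₘ b) := by
    have h := tensorμ_unit (X₁ := tensorOver (op L) js) (X₂ := tensorOver (tpow A.X) js)
      (opOne L) (A.one ≫ (λ_ A.X).inv)
    have hA : tpowAdd A.X js.total 1 = tpow A.X js.total ◁ (λ_ A.X).hom := by
      change (α_ _ _ _).inv ≫ (ρ_ (tpow A.X js.total)).hom ▷ A.X = _
      rw [← MonoidalCategory.triangle, Iso.inv_hom_id_assoc]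
    change e ≫ (shuffle (op L) (tpow A.X) js ▷ (op L 1 ⊗ tpow A.X 1) ≫ tensorμ _ _ _ _) ≫
      (tensorOver (op L) js ⊗ op L 1) ◁
        (tpowTotal A.X js ▷ tpow A.X 1 ≫ tpowAdd A.X js.total 1) = _
    have he : e ≫ shuffle (op L) (tpow A.X) js ▷ (op L 1 ⊗ tpow A.X 1) =
        shuffle (op L) (tpow A.X) js ≫ (ρ_ _).inv ≫ _ ◁ k := by
      simp only [e, Category.assoc]
      rw [whisker_exchange, ← rightUnitor_inv_naturality_assoc]
    have hb : ((ρ_ (tensorOver (tpow A.X) js)).inv ≫ tensorOver (tpow A.X) js ◁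
        (A.one ≫ (λ_ A.X).inv)) ≫ tpowTotal A.X js ▷ (𝟙_ C ⊗ A.X) ≫
          tpow A.X js.total ◁ (λ_ A.X).hom = tpowTotal A.X js ≫ b := by
      rw [Category.assoc, whisker_exchange_assoc, ← MonoidalCategory.whiskerLeft_comp,
        Category.assoc, Iso.inv_hom_id, Category.comp_id, ← rightUnitor_inv_naturality_assoc]
    rw [hA]
    calc _ = (e ≫ shuffle (op L) (tpow A.X) js ▷ (op L 1 ⊗ tpow A.X 1)) ≫
          (tensorμ (tensorOver (op L) js) (tensorOver (tpow A.X) js) (op L 1) (tpow A.X 1) ≫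
            (tensorOver (op L) js ⊗ op L 1) ◁
              (tpowTotal A.X js ▷ tpow A.X 1 ≫ tpow A.X js.total ◁ (λ_ A.X).hom)) := by
            simp only [Category.assoc]
      _ = (shuffle (op L) (tpow A.X) js ≫ (ρ_ _).inv ≫ _ ◁ k) ≫
          (tensorμ (tensorOver (op L) js) (tensorOver (tpow A.X) js) (op L 1) (tpow A.X 1) ≫
            (tensorOver (op L) js ⊗ op L 1) ◁
              (tpowTotal A.X js ▷ tpow A.X 1 ≫ tpow A.X js.total ◁ (λ_ A.X).hom)) :=
            congrArg (· ≫ _) he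
      _ = shuffle (op L) (tpow A.X) js ≫
          ((((ρ_ (tensorOver (op L) js ⊗ tensorOver (tpow A.X) js)).inv ≫ _ ◁ k) ≫
            tensorμ _ _ _ _) ≫ (tensorOver (op L) js ⊗ op L 1) ◁
              (tpowTotal A.X js ▷ (𝟙_ C ⊗ A.X) ≫ tpow A.X js.total ◁ (λ_ A.X).hom)) := by
            simp only [Category.assoc]
      _ = shuffle (op L) (tpow A.X) js ≫ ((a ⊗ₘ ((ρ_ _).inv ≫ _ ◁ (A.one ≫ (λ_ A.X).inv))) ≫
            (tensorOver (op L) js ⊗ op L 1) ◁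
              (tpowTotal A.X js ▷ (𝟙_ C ⊗ A.X) ≫ tpow A.X js.total ◁ (λ_ A.X).hom)) :=
            congrArg (fun t => shuffle (op L) (tpow A.X) js ≫ (t ≫ _)) h
      _ = opShuffle L A.X js ≫ (a ⊗ₘ b) := by
            rw [← id_tensorHom (tensorOver (op L) js ⊗ op L 1), tensorHom_comp_tensorHom, hb,
              Category.comp_id, opShuffle,
              Category.assoc, ← id_tensorHom, tensorHom_comp_tensorHom, Category.id_comp]
  have h₃ : op L (js.len + 1) ◁ e ≫ op L (js.len + 1) ◁ (tensorOverTo A.act js ⊗ₘ A.act 1) ≫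
      A.act (js.len + 1) = op L (js.len + 1) ◁ e ≫ op L (js.len + 1) ◁
        opShuffle L A.X (js.snoc 1) ≫ (α_ _ _ _).inv ≫ opComp L (js.snoc 1) ▷
          tpow A.X (js.total + 1) ≫ A.act (js.total + 1) :=
    congrArg (fun t => op L (js.len + 1) ◁ e ≫ t) hassoc
  rw [← MonoidalCategory.whiskerLeft_comp_assoc, ← MonoidalCategory.whiskerLeft_comp_assoc, h₁,
    h₂] at h₃
  rw [envToAlgSummand, ← MonoidalCategory.whiskerLeft_comp_assoc, h₃, envMulSummand,
    envToAlgSummand]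
  have h₄ : ∀ {Z : C} (G : op L (js.len + 1) ⊗ (tensorOver (op L) js ⊗ op L 1) ⟶ Z),
      op L (js.len + 1) ◁ (opShuffle L A.X js ≫ (a ⊗ₘ b)) ≫ (α_ _ _ _).inv ≫
        G ▷ (tpow A.X js.total ⊗ A.X) =
      (op L (js.len + 1) ◁ opShuffle L A.X js ≫ (α_ _ _ _).inv ≫
        (op L (js.len + 1) ◁ a ≫ G) ▷ tpow A.X js.total) ≫ Z ◁ b := by
    intro Z G
    rw [MonoidalCategory.whiskerLeft_comp, Category.assoc, Category.assoc, Category.assoc,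
      MonoidalCategory.tensorHom_def, MonoidalCategory.whiskerLeft_comp, Category.assoc,
      associator_inv_naturality_right_assoc, associator_inv_naturality_middle_assoc,
      whisker_exchange, comp_whiskerRight, Category.assoc]
  have h₅ := h₄ (opComp L (js.snoc 1)) =≫ A.act (js.total + 1)
  simp only [Category.assoc] at h₅ ⊢
  exact h₅

variable [HasCountableColimits C]

/-- The source of the two maps that define the enveloping algebra.  Since `⊗` preserves coproducts
in each variable, the coproduct over `m` of `O(m+1) ⊗ (∐ⱼ O(j) ⊗ A^(j))^(m)` is the coproduct of
`O(m+1) ⊗ (O(j₁) ⊗ A^(j₁)) ⊗ ⋯ ⊗ (O(jₘ) ⊗ A^(jₘ))` over all finite sequences `j₁, …, jₘ`. -/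
abbrev envRel (A : Alg L) : C :=
  ∐ fun js : Arities => op L (js.len + 1) ⊗ tensorOver (fun j => op L j ⊗ tpow A.X j) js

abbrev envGen (A : Alg L) : C := ∐ fun m : ℕ => op L (m + 1) ⊗ tpow A.X m

/-- The map given by the action of the operad on `A`. -/
def envAct (A : Alg L) : A.envRel ⟶ A.envGen :=
  Sigma.desc fun js => op L (js.len + 1) ◁ tensorOverTo A.act js ≫
    Sigma.ι (fun m : ℕ => op L (m + 1) ⊗ tpow A.X m) js.len

/-- The map given by the composition of the operad. -/
def envMul (A : Alg L) : A.envRel ⟶ A.envGen :=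
  Sigma.desc fun js => A.envMulSummand js ≫
    Sigma.ι (fun m : ℕ => op L (m + 1) ⊗ tpow A.X m) js.total

/-- The underlying object of the non-symmetric enveloping algebra of `A`. -/
abbrev env (A : Alg L) : C := coequalizer A.envAct A.envMul

/-- The map to the enveloping algebra from its `m`-th summand. -/
def envι (A : Alg L) (m : ℕ) : op L (m + 1) ⊗ tpow A.X m ⟶ A.env :=
  Sigma.ι (fun m : ℕ => op L (m + 1) ⊗ tpow A.X m) m ≫ coequalizer.π A.envAct A.envMul

theorem envι_aux_act (A : Alg L) (js : Arities) :
    Sigma.ι (fun js : Arities => op L (js.len + 1) ⊗ tensorOver (fun j => op L j ⊗ tpow A.X j) js)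
      js ≫ A.envAct = op L (js.len + 1) ◁ tensorOverTo A.act js ≫
        Sigma.ι (fun m : ℕ => op L (m + 1) ⊗ tpow A.X m) js.len :=
  Sigma.ι_desc _ _

theorem envι_aux_mul (A : Alg L) (js : Arities) :
    Sigma.ι (fun js : Arities => op L (js.len + 1) ⊗ tensorOver (fun j => op L j ⊗ tpow A.X j) js)
      js ≫ A.envMul = A.envMulSummand js ≫
        Sigma.ι (fun m : ℕ => op L (m + 1) ⊗ tpow A.X m) js.total :=
  Sigma.ι_desc _ _

theorem envι_rel (A : Alg L) (js : Arities) :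
    op L (js.len + 1) ◁ tensorOverTo A.act js ≫ A.envι js.len =
      A.envMulSummand js ≫ A.envι js.total := by
  have h₁ := A.envι_aux_act js =≫ coequalizer.π A.envAct A.envMul
  have h₂ := A.envι_aux_mul js =≫ coequalizer.π A.envAct A.envMul
  rw [Category.assoc, Category.assoc] at h₁ h₂
  rw [envι, envι, ← h₁, ← h₂, coequalizer.condition]

/-- Maps out of the enveloping algebra. -/
def envDesc (A : Alg L) {Y : C} (f : ∀ m, op L (m + 1) ⊗ tpow A.X m ⟶ Y)
    (hf : ∀ js : Arities, op L (js.len + 1) ◁ tensorOverTo A.act js ≫ f js.len =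
      A.envMulSummand js ≫ f js.total) : A.env ⟶ Y :=
  coequalizer.desc (Sigma.desc f) (by
    refine Sigma.hom_ext _ _ fun js => ?_
    have h₁ := A.envι_aux_act js =≫ Sigma.desc f
    have h₂ := A.envι_aux_mul js =≫ Sigma.desc f
    rw [Category.assoc, Category.assoc, Sigma.ι_desc] at h₁ h₂
    rw [h₁, h₂, hf])

theorem envι_desc (A : Alg L) {Y : C} (f : ∀ m, op L (m + 1) ⊗ tpow A.X m ⟶ Y)
    (hf : ∀ js : Arities, op L (js.len + 1) ◁ tensorOverTo A.act js ≫ f js.len =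
      A.envMulSummand js ≫ f js.total) (m : ℕ) : A.envι m ≫ A.envDesc f hf = f m := by
  rw [envι, envDesc, Category.assoc, coequalizer.π_desc]
  exact Sigma.ι_desc _ _

theorem env_hom_ext (A : Alg L) {Y : C} {f g : A.env ⟶ Y}
    (h : ∀ m, A.envι m ≫ f = A.envι m ≫ g) : f = g := by
  refine coequalizer.hom_ext (Sigma.hom_ext _ _ fun m => ?_)
  have h' := h m
  rw [envι, Category.assoc, Category.assoc] at h'
  exact h'

/-- Functoriality of the enveloping algebra. -/
def envMap {A B : Alg L} (φ : A ⟶ B) : A.env ⟶ B.env :=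
  A.envDesc (fun m => op L (m + 1) ◁ tpowMap φ.hom m ≫ B.envι m) (fun js => by
    rw [← Category.assoc, ← MonoidalCategory.whiskerLeft_comp, tensorOverTo_comp_tpowMap,
      ← Category.assoc, envMulSummand_natural, Category.assoc, ← envι_rel, ← Category.assoc,
      ← MonoidalCategory.whiskerLeft_comp, tensorOverMap_comp_to]
    simp only [φ.act_hom])

/-- The underlying object of the enveloping algebra, as a functor. -/
def envFunctor (L : P.FullSubcategory ⥤ C) [L.Braided] : Alg L ⥤ C where
  obj A := A.env
  map φ := envMap φ
  map_id A := A.env_hom_ext fun m => by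
    have h : tpowMap (Hom.hom (𝟙 A)) m = 𝟙 (tpow A.X m) := tpowMap_id _ _
    rw [envMap, envι_desc, h, MonoidalCategory.whiskerLeft_id, Category.id_comp, Category.comp_id]
  map_comp {A B D} φ ψ := A.env_hom_ext fun m => by
    have h : tpowMap (Hom.hom (φ ≫ ψ)) m = tpowMap φ.hom m ≫ tpowMap ψ.hom m :=
      tpowMap_comp _ _ _
    rw [← Category.assoc, envMap, envMap, envMap, envι_desc, envι_desc, Category.assoc,
      envι_desc, h, MonoidalCategory.whiskerLeft_comp, Category.assoc]

/-- The canonical map from the enveloping algebra to `A`. -/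
def envToAlg (A : Alg L) : A.env ⟶ A.X := A.envDesc A.envToAlgSummand A.envToAlg_aux

/-- The multiplication of the enveloping algebra is induced by `∘` in the last slot, and its unit is
the unit of the operad in the summand `O(1) ⊗ A^(0)`. -/
structure IsEnvelopingMonoid (A : Alg L) (mon : MonObj A.env) : Prop where
  one_eq : mon.one = opOne L ≫ (ρ_ (op L 1)).inv ≫ A.envι 0
  mul_eq : ∀ m n : ℕ, (A.envι m ⊗ₘ A.envι n) ≫ mon.mul =
    tensorμ _ _ _ _ ≫ (opCompLast L m n ⊗ₘ tpowAdd A.X m n) ≫ A.envι (m + n)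

end Alg

end Algebra

/-! ### Moore algebras

Both the Moore algebra `M A` and the algebra `N A` consist of a part `L S` and a part `L S₊ ⊗ A`,
where `S` is a convex monoid with a length function `len`, and `S₊` is the subset of the elements
of positive length. -/

/-- A convex set with a continuous multiplication `mul`, a unit and a length function `len`, where
the length of `a b` is the length of `a` plus that of `b` stretched by a factor `scale a`. -/
structure LengthMonoid (V : Type) [NormedAddCommGroup V] [NormedSpace ℝ V]
    [FiniteDimensional ℝ V] where
  carrier : Set V
  convex : Convex ℝ carrier
  one : V
  one_mem : one ∈ carrier
  mul : V → V → V
  continuous_mul : Continuous fun p : V × V => mul p.1 p.2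
  mul_mem : ∀ {a b}, a ∈ carrier → b ∈ carrier → mul a b ∈ carrier
  mul_assoc : ∀ a b c, mul (mul a b) c = mul a (mul b c)
  one_mul : ∀ a, mul one a = a
  mul_one : ∀ a, mul a one = a
  len : V →ₗ[ℝ] ℝ
  len_nonneg : ∀ {a}, a ∈ carrier → 0 ≤ len a
  scale : V → ℝ
  scale_pos : ∀ {a}, a ∈ carrier → 0 < scale a
  len_mul : ∀ a b, len (mul a b) = len a + scale a * len b

/-- Moore lengths: the additive monoid `ℝ≥0`. -/
def moore : LengthMonoid ℝ where
  carrier := Set.Ici 0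
  convex := convex_Ici 0
  one := 0
  one_mem := le_refl (0 : ℝ)
  mul r s := r + s
  continuous_mul := by fun_prop
  mul_mem ha hb := add_nonneg (Set.mem_Ici.1 ha) (Set.mem_Ici.1 hb)
  mul_assoc := add_assoc
  one_mul := zero_add
  mul_one := add_zero
  len := LinearMap.id
  len_nonneg ha := ha
  scale _ := 1
  scale_pos _ := one_pos
  len_mul a b := by simp

/-- The monoid `ℝ≥0 × ℝ>0 × ℝ≥0` with
`(r, s, t) (r', s', t') = (r + s r', s s', s t' + t)` and length `r`. -/
def nn : LengthMonoid (ℝ × ℝ × ℝ) where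
  carrier := {a | 0 ≤ a.1 ∧ 0 < a.2.1 ∧ 0 ≤ a.2.2}
  convex := by
    intro x hx y hy a b ha hb hab
    refine ⟨?_, ?_, ?_⟩
    · simpa using convex_le_aux ha hb hx.1 hy.1
    · simpa using convex_lt_aux ha hb hab hx.2.1 hy.2.1
    · simpa using convex_le_aux ha hb hx.2.2 hy.2.2
  one := (0, 1, 0)
  one_mem := by norm_num
  mul a b := (a.1 + a.2.1 * b.1, a.2.1 * b.2.1, a.2.1 * b.2.2 + a.2.2)
  continuous_mul := by fun_prop
  mul_mem {a b} ha hb :=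
    ⟨add_nonneg ha.1 (mul_nonneg ha.2.1.le hb.1), mul_pos ha.2.1 hb.2.1,
      add_nonneg (mul_nonneg ha.2.1.le hb.2.2) ha.2.2⟩
  mul_assoc a b c := by ext <;> dsimp only <;> ring
  one_mul a := by ext <;> simp
  mul_one a := by ext <;> simp
  len := LinearMap.fst ℝ ℝ (ℝ × ℝ)
  len_nonneg ha := ha.1
  scale a := a.2.1
  scale_pos ha := ha.2.1
  len_mul a b := rfl

namespace LengthMonoid

variable {V : Type} [NormedAddCommGroup V] [NormedSpace ℝ V] [FiniteDimensional ℝ V]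
  (Q : LengthMonoid V)

/-- The elements of positive length. -/
def posCarrier : Set V := {a | a ∈ Q.carrier ∧ 0 < Q.len a}

theorem convex_posCarrier : Convex ℝ Q.posCarrier := fun x hx y hy a b ha hb hab =>
  ⟨Q.convex hx.1 hy.1 ha hb hab, by
    have := convex_lt_aux ha hb hab hx.2 hy.2
    simpa using this⟩

theorem len_mul_pos {a b : V} (ha : a ∈ Q.carrier) (hb : b ∈ Q.carrier)
    (h : 0 < Q.len a ∨ 0 < Q.len b) : 0 < Q.len (Q.mul a b) := by
  have h₁ := Q.len_nonneg ha
  have h₂ := mul_nonneg (Q.scale_pos ha).le (Q.len_nonneg hb)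
  rw [Q.len_mul]
  rcases h with h | h
  · linarith
  · have := mul_pos (Q.scale_pos ha) h
    linarith

/-- The point at which a product `a b` is cut, after rescaling to length one. -/
def cutPoint (a b : V) : ℝ := Q.len a / Q.len (Q.mul a b)

theorem cutPoint_nonneg {a b : V} (ha : a ∈ Q.carrier) (hb : b ∈ Q.carrier) :
    0 ≤ Q.cutPoint a b :=
  div_nonneg (Q.len_nonneg ha) (Q.len_nonneg (Q.mul_mem ha hb))

theorem cutPoint_le_one {a b : V} (ha : a ∈ Q.carrier) (hb : b ∈ Q.carrier) :
    Q.cutPoint a b ≤ 1 := by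
  refine div_le_one_of_le₀ ?_ (Q.len_nonneg (Q.mul_mem ha hb))
  rw [Q.len_mul]
  have := mul_nonneg (Q.scale_pos ha).le (Q.len_nonneg hb)
  linarith

theorem cutPoint_pos {a b : V} (ha : a ∈ Q.carrier) (hb : b ∈ Q.carrier) (h : 0 < Q.len a) :
    0 < Q.cutPoint a b := div_pos h (Q.len_mul_pos ha hb (.inl h))

theorem cutPoint_lt_one {a b : V} (ha : a ∈ Q.carrier) (hb : b ∈ Q.carrier) (h : 0 < Q.len b) :
    Q.cutPoint a b < 1 := by
  rw [cutPoint, div_lt_one (Q.len_mul_pos ha hb (.inr h)), Q.len_mul]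
  have := mul_pos (Q.scale_pos ha) h
  linarith

theorem continuousOn_cutPoint {s : Set (V × V)}
    (hs : ∀ p ∈ s, 0 < Q.len (Q.mul p.1 p.2)) :
    ContinuousOn (fun p : V × V => Q.cutPoint p.1 p.2) s := by
  have hl : Continuous Q.len := Q.len.continuous_of_finiteDimensional
  exact ContinuousOn.div (hl.comp continuous_fst).continuousOn
    (hl.comp Q.continuous_mul).continuousOn (fun p hp => (hs p hp).ne')

end LengthMonoid

section MooreSpaces

variable {P : ObjectProperty TopCat.{w}} [ContainsConvex P]
  {V W U : Type} [NormedAddCommGroup V] [NormedSpace ℝ V] [FiniteDimensional ℝ V]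
  [NormedAddCommGroup W] [NormedSpace ℝ W] [FiniteDimensional ℝ W]
  [NormedAddCommGroup U] [NormedSpace ℝ U] [FiniteDimensional ℝ U]

/-- A continuous map between convex sets. -/
def map₁ {s : Set V} (hs : Convex ℝ s) {u : Set U} (hu : Convex ℝ u) (f : V → U)
    (hf : ContinuousOn f s) (hfm : ∀ x ∈ s, f x ∈ u) : space P s hs ⟶ space P u hu :=
  homTo hu (fun x => f (val x)) (hf.comp_continuous continuous_val fun x => val_mem x)
    (fun x => hfm _ (val_mem x))

variable [CartesianMonoidalCategory P.FullSubcategory]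

/-- A continuous map of two variables between convex sets. -/
def map₂ {s : Set V} (hs : Convex ℝ s) {t : Set W} (ht : Convex ℝ t) {u : Set U}
    (hu : Convex ℝ u) (f : V → W → U)
    (hf : ContinuousOn (fun p : V × W => f p.1 p.2) (s ×ˢ t))
    (hfm : ∀ x ∈ s, ∀ y ∈ t, f x y ∈ u) : space P s hs ⊗ space P t ht ⟶ space P u hu :=
  homTo hu (fun z => f (val (pr₁ (X := space P s hs) z)) (val (pr₂ (Y := space P t ht) z)))
    (hf.comp_continuous
      ((continuous_val.comp (continuous_pr₁ (X := space P s hs))).prodMk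
        (continuous_val.comp (continuous_pr₂ (Y := space P t ht))))
      fun z => ⟨val_mem (pr₁ (X := space P s hs) z), val_mem (pr₂ (Y := space P t ht) z)⟩)
    (fun z => hfm _ (val_mem (pr₁ (X := space P s hs) z)) _ (val_mem (pr₂ (Y := space P t ht) z)))

/-- The one-element sequence consisting of the interval `[x, y]`. -/
theorem single_mem {x y : ℝ} (h0 : 0 ≤ x) (h : x < y) (h1 : y ≤ 1) :
    (fun _ => (x, y)) ∈ littleSet 1 :=
  ⟨fun _ => ⟨h0, h, h1⟩, fun i k hik => absurd hik (by omega)⟩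

/-- Two intervals `[0, x]` and `[x, y]`. -/
theorem pair_mem {x y : ℝ} (h0 : 0 < x) (h : x < y) (h1 : y ≤ 1) :
    ![(0, x), (x, y)] ∈ littleSet 2 := by
  refine ⟨fun i => ?_, fun i k hik => ?_⟩
  · fin_cases i
    · exact ⟨le_rfl, h0, h.le.trans h1⟩
    · exact ⟨h0.le, h, h1⟩
  · fin_cases i <;> fin_cases k
    · exact absurd hik (by decide)
    · exact le_refl x
    · exact absurd hik (by decide)
    · exact absurd hik (by decide)

theorem continuous_pair : Continuous fun p : ℝ × ℝ =>
    (![(0, p.1), (p.1, p.2)] : Fin 2 → ℝ × ℝ) :=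
  continuous_pi fun i => by
    fin_cases i
    · exact continuous_const.prodMk continuous_fst
    · exact continuous_fst.prodMk continuous_snd

namespace LengthMonoid

variable (P) (Q : LengthMonoid V)

/-- The space of all elements. -/
def full : P.FullSubcategory := space P Q.carrier Q.convex

/-- The space of elements of positive length. -/
def pos : P.FullSubcategory := space P Q.posCarrier Q.convex_posCarrier

/-- The unit. -/
def onePt : 𝟙_ P.FullSubcategory ⟶ Q.full P :=
  homTo Q.convex (fun _ => Q.one) continuous_const (fun _ => Q.one_mem)

def incl : Q.pos P ⟶ Q.full P :=
  map₁ Q.convex_posCarrier Q.convex id continuousOn_id fun _ h => h.1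

/-- The multiplication on all elements, and its restrictions with values in the elements of positive
length. -/
def mulFF : Q.full P ⊗ Q.full P ⟶ Q.full P :=
  map₂ Q.convex Q.convex Q.convex Q.mul Q.continuous_mul.continuousOn
    fun _ ha _ hb => Q.mul_mem ha hb

def mulFP : Q.full P ⊗ Q.pos P ⟶ Q.pos P :=
  map₂ Q.convex Q.convex_posCarrier Q.convex_posCarrier Q.mul Q.continuous_mul.continuousOn
    fun _ ha _ hb => ⟨Q.mul_mem ha hb.1, Q.len_mul_pos ha hb.1 (.inr hb.2)⟩

def mulPF : Q.pos P ⊗ Q.full P ⟶ Q.pos P :=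
  map₂ Q.convex_posCarrier Q.convex Q.convex_posCarrier Q.mul Q.continuous_mul.continuousOn
    fun _ ha _ hb => ⟨Q.mul_mem ha.1 hb, Q.len_mul_pos ha.1 hb (.inl ha.2)⟩

def mulPP : Q.pos P ⊗ Q.pos P ⟶ Q.pos P :=
  map₂ Q.convex_posCarrier Q.convex_posCarrier Q.convex_posCarrier Q.mul
    Q.continuous_mul.continuousOn
    fun _ ha _ hb => ⟨Q.mul_mem ha.1 hb.1, Q.len_mul_pos ha.1 hb.1 (.inl ha.2)⟩

/-- The pair of intervals `[0, c]`, `[c, 1]` at the cut point `c` of `a b`. -/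
def cutPP : Q.pos P ⊗ Q.pos P ⟶ little P 2 :=
  map₂ Q.convex_posCarrier Q.convex_posCarrier (convex_littleSet 2)
    (fun a b => ![(0, Q.cutPoint a b), (Q.cutPoint a b, 1)])
    (continuous_pair.comp_continuousOn ((Q.continuousOn_cutPoint fun _ hp =>
      Q.len_mul_pos hp.1.1 hp.2.1 (.inl hp.1.2)).prodMk continuousOn_const))
    fun _ ha _ hb => pair_mem (Q.cutPoint_pos ha.1 hb.1 ha.2) (Q.cutPoint_lt_one ha.1 hb.1 hb.2)
      le_rfl

/-- The interval `[c, 1]` at the cut point `c` of `a b`. -/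
def cutFP : Q.full P ⊗ Q.pos P ⟶ little P 1 :=
  map₂ Q.convex Q.convex_posCarrier (convex_littleSet 1) (fun a b _ => (Q.cutPoint a b, 1))
    (continuousOn_pi.2 fun _ => (Q.continuousOn_cutPoint fun _ hp =>
      Q.len_mul_pos hp.1 hp.2.1 (.inr hp.2.2)).prodMk continuousOn_const)
    fun _ ha _ hb => single_mem (Q.cutPoint_nonneg ha hb.1) (Q.cutPoint_lt_one ha hb.1 hb.2) le_rfl

/-- The interval `[0, c]` at the cut point `c` of `a b`. -/
def cutPF : Q.pos P ⊗ Q.full P ⟶ little P 1 :=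
  map₂ Q.convex_posCarrier Q.convex (convex_littleSet 1) (fun a b _ => (0, Q.cutPoint a b))
    (continuousOn_pi.2 fun _ => continuousOn_const.prodMk (Q.continuousOn_cutPoint fun _ hp =>
      Q.len_mul_pos hp.1.1 hp.2 (.inl hp.1.2)))
    fun _ ha _ hb => single_mem le_rfl (Q.cutPoint_pos ha.1 hb ha.2) (Q.cutPoint_le_one ha.1 hb)

end LengthMonoid

variable (P)

/-- The map `r ↦ (r, 1, 0)`. -/
def mooreToN : moore.full P ⟶ nn.full P :=
  map₁ moore.convex nn.convex (fun r => (r, 1, 0)) (by fun_prop) fun _ h => ⟨h, one_pos, le_rfl⟩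

/-- The map `r ↦ (r, 1, 0)` on positive elements. -/
def mooreToNPos : moore.pos P ⟶ nn.pos P :=
  map₁ moore.convex_posCarrier nn.convex_posCarrier (fun r => (r, 1, 0)) (by fun_prop)
    fun _ h => ⟨⟨h.1, one_pos, le_rfl⟩, h.2⟩

/-- The map that takes a little interval `[x, y]` to `(x, y - x, 1 - y)`. -/
def littleToN : little P 1 ⟶ nn.full P :=
  map₁ (convex_littleSet 1) nn.convex
    (fun c => ((c 0).1, (c 0).2 - (c 0).1, 1 - (c 0).2)) (by fun_prop)
    fun _ h => ⟨(h.1 0).1, sub_pos.2 (h.1 0).2.1, sub_nonneg.2 (h.1 0).2.2⟩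

/-- The little intervals `[x, y]` with `0 < x`. -/
def innerSet : Set (ℝ × ℝ) := {p | 0 < p.1 ∧ p.1 < p.2 ∧ p.2 ≤ 1}

theorem convex_innerSet : Convex ℝ innerSet := by
  intro p hp q hq a b ha hb hab
  refine ⟨?_, ?_, ?_⟩
  · simpa using convex_lt_aux ha hb hab hp.1 hq.1
  · simpa using convex_lt_aux ha hb hab hp.2.1 hq.2.1
  · simpa [hab] using convex_le_aux ha hb hp.2.2 hq.2.2

def innerSpace : P.FullSubcategory := space P innerSet convex_innerSet

/-- The map that takes `[x, y]` with `0 < x` to `([0, x], [x, y])`. -/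
def innerToPair : innerSpace P ⟶ little P 2 :=
  map₁ convex_innerSet (convex_littleSet 2) (fun p => ![(0, p.1), (p.1, p.2)])
    continuous_pair.continuousOn fun _ h => pair_mem h.1 h.2.1 h.2.2

/-- The map that takes `[x, y]` with `0 < x` to `(x, y - x, 1 - y)`. -/
def innerToN : innerSpace P ⟶ nn.pos P :=
  map₁ convex_innerSet nn.convex_posCarrier (fun p => (p.1, p.2 - p.1, 1 - p.2)) (by fun_prop)
    fun _ h => ⟨⟨h.1.le, sub_pos.2 h.2.1, sub_nonneg.2 h.2.2⟩, h.1⟩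

end MooreSpaces

section Pad

variable {P : ObjectProperty TopCat.{w}} [ContainsConvex P]
  [CartesianMonoidalCategory P.FullSubcategory] [BraidedCategory P.FullSubcategory]
  {C : Type u} [Category.{v} C] [MonoidalCategory C] [SymmetricCategory C]
  {L : P.FullSubcategory ⥤ C} [L.Braided] [HasCountableColimits C]
  {V : Type} [NormedAddCommGroup V] [NormedSpace ℝ V] [FiniteDimensional ℝ V]
  (Q : LengthMonoid V)

namespace Alg

/-- The pushout of `L S ⊗ 𝟙` and `L S₊ ⊗ A` along `L S₊ ⊗ 𝟙`. -/
abbrev pad (A : Alg L) : C :=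
  pushout (L.map (Q.incl P) ▷ 𝟙_ C) (L.obj (Q.pos P) ◁ A.one)

def padInl (A : Alg L) : L.obj (Q.full P) ⊗ 𝟙_ C ⟶ A.pad Q :=
  pushout.inl (L.map (Q.incl P) ▷ 𝟙_ C) (L.obj (Q.pos P) ◁ A.one)

def padInr (A : Alg L) : L.obj (Q.pos P) ⊗ A.X ⟶ A.pad Q :=
  pushout.inr (L.map (Q.incl P) ▷ 𝟙_ C) (L.obj (Q.pos P) ◁ A.one)

theorem pad_condition (A : Alg L) :
    L.map (Q.incl P) ▷ 𝟙_ C ≫ A.padInl Q = L.obj (Q.pos P) ◁ A.one ≫ A.padInr Q :=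
  pushout.condition

theorem pad_hom_ext (A : Alg L) {Y : C} {f g : A.pad Q ⟶ Y}
    (h₁ : A.padInl Q ≫ f = A.padInl Q ≫ g) (h₂ : A.padInr Q ≫ f = A.padInr Q ≫ g) : f = g :=
  pushout.hom_ext h₁ h₂

def padMap {A B : Alg L} (φ : A ⟶ B) : A.pad Q ⟶ B.pad Q :=
  pushout.desc (B.padInl Q) (L.obj (Q.pos P) ◁ φ.hom ≫ B.padInr Q) (by
    rw [pad_condition, ← Category.assoc, ← MonoidalCategory.whiskerLeft_comp, one_hom])

theorem padInl_map {A B : Alg L} (φ : A ⟶ B) : A.padInl Q ≫ padMap Q φ = B.padInl Q :=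
  pushout.inl_desc _ _ _

theorem padInr_map {A B : Alg L} (φ : A ⟶ B) :
    A.padInr Q ≫ padMap Q φ = L.obj (Q.pos P) ◁ φ.hom ≫ B.padInr Q :=
  pushout.inr_desc _ _ _

/-- The underlying object of `M A` and of `N A`, as a functor of `A`. -/
def padFunctor (L : P.FullSubcategory ⥤ C) [L.Braided] : Alg L ⥤ C where
  obj A := A.pad Q
  map φ := padMap Q φ
  map_id A := by
    refine A.pad_hom_ext Q ?_ ?_
    · rw [padInl_map, Category.comp_id]
    · have h : Hom.hom (𝟙 A) = 𝟙 A.X := rfl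
      rw [padInr_map, h, MonoidalCategory.whiskerLeft_id, Category.id_comp, Category.comp_id]
  map_comp {A B D} φ ψ := by
    refine A.pad_hom_ext Q ?_ ?_
    · rw [padInl_map, ← Category.assoc, padInl_map, padInl_map]
    · have h : Hom.hom (φ ≫ ψ) = φ.hom ≫ ψ.hom := rfl
      rw [padInr_map, ← Category.assoc, padInr_map, Category.assoc, padInr_map, h,
        MonoidalCategory.whiskerLeft_comp, Category.assoc]

/-- The canonical map to `A`, which forgets the elements of `S`. -/
def padToAlg (A : Alg L) : A.pad Q ⟶ A.X :=
  pushout.desc ((collapse L (Q.full P) ⊗ₘ A.one) ≫ (λ_ A.X).hom)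
    (collapse L (Q.pos P) ▷ A.X ≫ (λ_ A.X).hom) (by
      rw [← Category.assoc, ← Category.assoc, ← tensorHom_id, ← tensorHom_id, ← id_tensorHom,
        tensorHom_comp_tensorHom, tensorHom_comp_tensorHom, map_collapse, Category.id_comp,
        Category.id_comp, Category.comp_id])

/-- The map `(L X ⊗ U) ⊗ (L Y ⊗ W) ⟶ L S₊ ⊗ A` that combines a multiplication `mul : X ⊗ Y ⟶ S₊`
with the operation on `A` given by `cut : X ⊗ Y ⟶ O(m)`, where `U ⊗ W` is identified with
`A^(m)` by `e`. -/
def mulCut (A : Alg L) {X Y : P.FullSubcategory} {m : ℕ} (mul : X ⊗ Y ⟶ Q.pos P)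
    (cut : X ⊗ Y ⟶ little P m) {U W : C} (e : U ⊗ W ⟶ tpow A.X m) :
    (L.obj X ⊗ U) ⊗ (L.obj Y ⊗ W) ⟶ L.obj (Q.pos P) ⊗ A.X :=
  tensorμ _ _ _ _ ≫
    ((Functor.LaxMonoidal.μ L X Y ≫ L.map (lift mul cut) ≫ Functor.OplaxMonoidal.δ L _ _) ⊗ₘ e) ≫
      (α_ _ _ _).hom ≫ L.obj (Q.pos P) ◁ A.act m

/-- The multiplication and the unit are induced by those of the monoid `S` and by the operations on
`A` that cut `[0,1]` into two pieces, in proportion to the lengths of the factors. -/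
structure IsPadMonoid (A : Alg L) (mon : MonObj (A.pad Q)) : Prop where
  one_eq : mon.one = Functor.LaxMonoidal.ε L ≫ L.map (Q.onePt P) ≫ (ρ_ _).inv ≫ A.padInl Q
  mul_FF : (A.padInl Q ⊗ₘ A.padInl Q) ≫ mon.mul =
    tensorμ _ _ _ _ ≫
      ((Functor.LaxMonoidal.μ L _ _ ≫ L.map (Q.mulFF P)) ⊗ₘ (λ_ (𝟙_ C)).hom) ≫ A.padInl Q
  mul_FP : (A.padInl Q ⊗ₘ A.padInr Q) ≫ mon.mul =
    A.mulCut Q (Q.mulFP P) (Q.cutFP P) (𝟙 (𝟙_ C ⊗ A.X)) ≫ A.padInr Q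
  mul_PF : (A.padInr Q ⊗ₘ A.padInl Q) ≫ mon.mul =
    A.mulCut Q (Q.mulPF P) (Q.cutPF P) ((ρ_ A.X).hom ≫ (λ_ A.X).inv) ≫ A.padInr Q
  mul_PP : (A.padInr Q ⊗ₘ A.padInr Q) ≫ mon.mul =
    A.mulCut Q (Q.mulPP P) (Q.cutPP P) ((λ_ A.X).inv ▷ A.X) ≫ A.padInr Q

/-- The map `L C₁(1) ⊗ 𝟙 ⟶ U A`. -/
def envInl (A : Alg L) : op L 1 ⊗ 𝟙_ C ⟶ A.env := A.envι 0

/-- The map `L D ⊗ A ⟶ U A`, where `D` is the space of little intervals `[x, y]` with `0 < x`, given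
by the operations `([0, x], [x, y])`. -/
def envInr (A : Alg L) : L.obj (innerSpace P) ⊗ A.X ⟶ A.env :=
  (L.map (innerToPair P) ⊗ₘ (λ_ A.X).inv) ≫ A.envι 1

end Alg

/-- A natural monoid structure on the values of a functor, i.e. a lift of the functor to
monoids. -/
structure MonoidLift (F : Alg L ⥤ C) where
  mon : ∀ A, MonObj (F.obj A)
  map_hom : ∀ {A B : Alg L} (φ : A ⟶ B),
    letI := mon A; letI := mon B; IsMonHom (F.map φ)

/-- The functor to monoids. -/
def MonoidLift.functor {F : Alg L ⥤ C} (N : MonoidLift F) : Alg L ⥤ Mon C where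
  obj A := letI := N.mon A; Mon.mk (F.obj A)
  map {A B} φ := letI := N.mon A; letI := N.mon B; letI := N.map_hom φ; Mon.Hom.mk (F.map φ)
  map_id A := by ext; exact F.map_id A
  map_comp φ ψ := by ext; exact F.map_comp φ ψ

end Pad

end

end LittleIntervals

/-! The proof rests on three observations.

Equations can be checked at points. Since `L` is a left adjoint, maps `L X ⟶ Z` correspond to maps
from the space `X` to the value of the right adjoint at `Z`. They are therefore determined by their
composites with the points `𝟙 ⟶ L X`. Since `⊗` is closed, this remains true after tensoring
(`jointlyEpi_lpt`, `jointlyEpi_ins`, `jointlyEpi_insAll`). Equations in `C` thus become equations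
between operations on `A` given by explicit lists of intervals. These follow from the algebra axioms
evaluated at points (`Alg.opAtAll_opAt`, `Alg.opAt₁_eq_id`).

The pushout `A.pad Q` works uniformly for every length monoid `Q`. It is covered by one copy of `𝟙`
for each element of length zero and one copy of `A` for each element of positive length
(`Alg.jointlyEpi_padPt`). Associativity of its multiplication says that the two ways of cutting
`[0,1]` in proportion to three lengths give the same three pieces
(`LengthMonoid.cutPoint_mul_cutPoint`, `LengthMonoid.cutPoint_add_mul_cutPoint`). Homomorphisms that
preserve lengths induce homomorphisms of pushouts. For homotopy much less is needed: `S` and `S₊`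
are convex, so any two continuous maps `S → S'` taking `S₊` to `S'₊` are joined by a straight line
and induce homotopic maps (`Alg.padChange_homotopic`). Hence such a map induces a homotopy
equivalence as soon as there is some such map backwards, multiplicative or not. A constant map of
positive length gives `A.pad Q ≃ A`.

The enveloping algebra is itself such a pushout, for the monoid `intervals` of single little
intervals under composition, where `[x, y]` has length `x` (`Alg.padIsoEnv`). If the last interval
of a list starts at `x > 0`, the others lie in `[0, x]`. The coequalizer relation then lets them act
on `A` first, after division by `x`, and leaves the pair `([0, x], [x, y])`. If `x = 0`, there are
no other intervals. The zigzag comes from the homomorphisms `[x, y] ↦ (x, y - x, 1 - y)` and `r ↦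
(r, 1, 0)`.

One map falls outside this scheme: `UA ⟶ A` acts by `[0, x]`, not by the identity, on the copy of
`A` at `[x, y]`. It gets its own linear homotopy, through pairs of intervals that need not touch
(`Alg.padToEnv_homotopic`). -/

namespace LittleIntervals

noncomputable section

/-! ### Jointly epimorphic families and pushouts in a closed symmetric monoidal category -/

section JointlyEpi

variable {C : Type u} [Category.{v} C]

/-- A family of morphisms with a common target, which are jointly epimorphic. -/
def JointlyEpi {ι : Sort*} {W : ι → C} {T : C} (f : ∀ i, W i ⟶ T) : Prop :=
  ∀ ⦃Z : C⦄ (a b : T ⟶ Z), (∀ i, f i ≫ a = f i ≫ b) → a = b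

variable [MonoidalCategory C] [SymmetricCategory C] [MonoidalClosed C]

/-- Currying turns precomposition with `V ◁ f i` into precomposition with `f i`; this is where
closedness enters. -/
theorem JointlyEpi.whiskerLeft {ι : Sort*} {W : ι → C} {T : C} {f : ∀ i, W i ⟶ T}
    (hf : JointlyEpi f) (V : C) : JointlyEpi fun i => V ◁ f i := by
  intro Z a b h
  refine MonoidalClosed.curry_injective (hf _ _ fun i => ?_)
  rw [← MonoidalClosed.curry_natural_left, ← MonoidalClosed.curry_natural_left, h]

theorem JointlyEpi.whiskerRight {ι : Sort*} {W : ι → C} {T : C} {f : ∀ i, W i ⟶ T}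
    (hf : JointlyEpi f) (V : C) : JointlyEpi fun i => f i ▷ V := by
  intro Z a b h
  rw [← cancel_epi (β_ V T).hom]
  refine hf.whiskerLeft V _ _ fun i => ?_
  rw [BraidedCategory.braiding_naturality_right_assoc,
    BraidedCategory.braiding_naturality_right_assoc, h]

theorem JointlyEpi.tensor {ι κ : Sort*} {W : ι → C} {T : C} {f : ∀ i, W i ⟶ T}
    (hf : JointlyEpi f) {V : κ → C} {T' : C} {g : ∀ k, V k ⟶ T'} (hg : JointlyEpi g)
    {Z : C} {a b : T ⊗ T' ⟶ Z} (h : ∀ i k, (f i ⊗ₘ g k) ≫ a = (f i ⊗ₘ g k) ≫ b) : a = b := by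
  refine hf.whiskerRight T' _ _ fun i => hg.whiskerLeft (W i) _ _ fun k => ?_
  have := h i k
  rw [tensorHom_def'] at this
  simpa only [Category.assoc] using this

theorem isPushout_whiskerRight {X Y Z T : C} {f : X ⟶ Y} {g : X ⟶ Z} {i : Y ⟶ T} {j : Z ⟶ T}
    (h : IsPushout f g i j) (W : C) : IsPushout (f ▷ W) (g ▷ W) (i ▷ W) (j ▷ W) :=
  h.map (tensorRight W)

theorem isPushout_whiskerLeft {X Y Z T : C} {f : X ⟶ Y} {g : X ⟶ Z} {i : Y ⟶ T} {j : Z ⟶ T}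
    (h : IsPushout f g i j) (W : C) : IsPushout (W ◁ f) (W ◁ g) (W ◁ i) (W ◁ j) :=
  h.map (tensorLeft W)

end JointlyEpi

/-! ### Points of spaces -/

section Points

variable {P : ObjectProperty TopCat.{w}}

section

variable [ContainsConvex P] {V : Type} [NormedAddCommGroup V]
    [NormedSpace ℝ V] [FiniteDimensional ℝ V] {s : Set V}

/-- The point of `space P s hs` given by an element of `s`. -/
def ofMem (hs : Convex ℝ s) {x : V} (hx : x ∈ s) : (space P s hs).obj :=
  (ULift.up ⟨x, hx⟩ : ULift.{w} s)

theorem val_injective {hs : Convex ℝ s} :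
    Function.Injective (val : (space P s hs).obj → V) := fun x y h => by
  have : (show ULift.{w} s from x).down = (show ULift.{w} s from y).down := Subtype.ext h
  exact congrArg ULift.up this

theorem val_homTo {X : P.FullSubcategory} (hs : Convex ℝ s) (f : X.obj → V) (hf : Continuous f)
    (hfs : ∀ x, f x ∈ s) (x : X.obj) : val ((homTo hs f hf hfs).hom x) = f x := rfl

end

/-- The map from the terminal space with image `x`. -/
def pt [CartesianMonoidalCategory P.FullSubcategory] {X : P.FullSubcategory} (x : X.obj) :
    𝟙_ P.FullSubcategory ⟶ X :=
  ObjectProperty.homMk (TopCat.ofHom (ContinuousMap.const _ x))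

variable [CartesianMonoidalCategory P.FullSubcategory]

theorem pt_comp {X Y : P.FullSubcategory} (x : X.obj) (f : X ⟶ Y) :
    pt x ≫ f = pt (f.hom x) := rfl

variable (P) in
/-- The point of the terminal space. -/
def star [ContainsConvex P] : (𝟙_ P.FullSubcategory).obj :=
  -- The terminal space has a point because the nonempty convex set `ℝ` maps to it.
  (toUnit (space P (Set.univ : Set ℝ) convex_univ)).hom (ofMem convex_univ (Set.mem_univ 0))

variable [ContainsConvex P]

theorem pt_apply {X : P.FullSubcategory} (x : X.obj) (z : (𝟙_ P.FullSubcategory).obj) :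
    (pt x).hom z = x := rfl

/-- The constant self-maps of the terminal space with values `z` and `star P` agree by terminality.
-/
theorem eq_star (z : (𝟙_ P.FullSubcategory).obj) : z = star P := by
  have h := toUnit_unique (pt z) (pt (star P))
  rw [← pt_apply z (star P), h]
  rfl

theorem eq_pt {X : P.FullSubcategory} (f : 𝟙_ P.FullSubcategory ⟶ X) : f = pt (f.hom (star P)) := by
  ext z
  rw [eq_star z]
  rfl

theorem hom_ext_pt {X Y : P.FullSubcategory} {f g : X ⟶ Y} (h : ∀ x : X.obj, f.hom x = g.hom x) :
    f = g := by
  ext z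
  exact h z

/-- The point of a product of two spaces with the given coordinates. -/
def pair {X Y : P.FullSubcategory} (x : X.obj) (y : Y.obj) : (X ⊗ Y).obj :=
  (lift (pt x) (pt y)).hom (star P)

theorem pt_pair {X Y : P.FullSubcategory} (x : X.obj) (y : Y.obj) :
    pt (pair x y) = lift (pt x) (pt y) := (eq_pt _).symm

theorem pr₁_pair {X Y : P.FullSubcategory} (x : X.obj) (y : Y.obj) : pr₁ (pair x y) = x := by
  have h := congrArg (fun f => f.hom (star P)) (lift_fst (pt x) (pt y))
  exact h

theorem pr₂_pair {X Y : P.FullSubcategory} (x : X.obj) (y : Y.obj) : pr₂ (pair x y) = y := by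
  have h := congrArg (fun f => f.hom (star P)) (lift_snd (pt x) (pt y))
  exact h

/-- Points are maps from the terminal space, so the universal property of the product suffices; its
topology is never described. -/
theorem pair_pr {X Y : P.FullSubcategory} (z : (X ⊗ Y).obj) : pair (pr₁ z) (pr₂ z) = z := by
  have h : pt (pair (pr₁ z) (pr₂ z)) = pt z := by
    rw [pt_pair]
    refine CartesianMonoidalCategory.hom_ext _ _ ?_ ?_
    · rw [lift_fst, pt_comp]; rfl
    · rw [lift_snd, pt_comp]; rfl
  exact congrArg (fun f => f.hom (star P)) h

theorem lift_apply {X Y Z : P.FullSubcategory} (f : X ⟶ Y) (g : X ⟶ Z) (x : X.obj) :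
    (lift f g).hom x = pair (f.hom x) (g.hom x) := by
  have h : pt ((lift f g).hom x) = pt (pair (f.hom x) (g.hom x)) := by
    rw [pt_pair, ← pt_comp, comp_lift, pt_comp, pt_comp]
  exact congrArg (fun f => f.hom (star P)) h

end Points

/-! ### Points of `L X` and insertion of a tensor factor at a point -/

section LPoints

variable {P : ObjectProperty TopCat.{w}}
  [CartesianMonoidalCategory P.FullSubcategory]
  {C : Type u} [Category.{v} C] [MonoidalCategory C]

/-- The inclusion of `W` into `X ⊗ W` at a point of `X`. -/
def ins {X : C} (p : 𝟙_ C ⟶ X) (W : C) : W ⟶ X ⊗ W := (λ_ W).inv ≫ p ▷ W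

theorem ins_whiskerLeft {X : C} (p : 𝟙_ C ⟶ X) {V W : C} (f : V ⟶ W) :
    ins p V ≫ X ◁ f = f ≫ ins p W := by
  rw [ins, ins, Category.assoc, ← whisker_exchange, leftUnitor_inv_naturality_assoc]

theorem ins_whiskerRight {X Y : C} (p : 𝟙_ C ⟶ X) (f : X ⟶ Y) (W : C) :
    ins p W ≫ f ▷ W = ins (p ≫ f) W := by
  simp [ins]

theorem ins_tensorHom {X Y : C} (p : 𝟙_ C ⟶ X) (f : X ⟶ Y) {V W : C} (g : V ⟶ W) :
    ins p V ≫ (f ⊗ₘ g) = g ≫ ins (p ≫ f) W := by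
  rw [MonoidalCategory.tensorHom_def, ← Category.assoc, ins_whiskerRight, ins_whiskerLeft]

theorem ins_id (W : C) : ins (𝟙 (𝟙_ C)) W = (λ_ W).inv := by simp [ins]

theorem ins_unit {X : C} (p : 𝟙_ C ⟶ X) : ins p (𝟙_ C) = p ≫ (ρ_ X).inv := by
  rw [ins, unitors_inv_equal, rightUnitor_inv_naturality]

theorem ins_associator {X Y : C} (p : 𝟙_ C ⟶ X) (q : 𝟙_ C ⟶ Y) (W : C) :
    ins ((λ_ (𝟙_ C)).inv ≫ (p ⊗ₘ q)) W ≫ (α_ X Y W).hom = ins q W ≫ ins p (Y ⊗ W) := by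
  simp only [ins, comp_whiskerRight, tensorHom_def', Category.assoc, associator_naturality_left,
    associator_naturality_middle_assoc, leftUnitor_inv_whiskerRight, Iso.inv_hom_id_assoc,
    MonoidalCategory.whiskerLeft_comp,
    leftUnitor_inv_naturality_assoc]

theorem ins_associator_inv {X Y : C} (p : 𝟙_ C ⟶ X) (q : 𝟙_ C ⟶ Y) (W : C) :
    ins q W ≫ ins p (Y ⊗ W) ≫ (α_ X Y W).inv = ins ((λ_ (𝟙_ C)).inv ≫ (p ⊗ₘ q)) W := by
  rw [← Category.assoc, ← ins_associator, Category.assoc, Iso.hom_inv_id, Category.comp_id]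

/-- A point has source `𝟙`, and moving `𝟙` past `V` is invisible. This removes all braidings from
computations at points. -/
theorem ins_tensorμ [BraidedCategory C] {X Y : C} (p : 𝟙_ C ⟶ X) (q : 𝟙_ C ⟶ Y) (V W : C) :
    (ins p V ⊗ₘ ins q W) ≫ tensorμ X V Y W = ins ((λ_ (𝟙_ C)).inv ≫ (p ⊗ₘ q)) (V ⊗ W) := by
  have h := leftUnitor_monoidal V W
  have h' : ((λ_ V).inv ⊗ₘ (λ_ W).inv) ≫ tensorμ (𝟙_ C) V (𝟙_ C) W =
      (λ_ (V ⊗ W)).inv ≫ (λ_ (𝟙_ C)).inv ▷ (V ⊗ W) := by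
    rw [← cancel_mono ((λ_ (𝟙_ C)).hom ▷ (V ⊗ W)), ← cancel_mono (λ_ (V ⊗ W)).hom]
    simp only [Category.assoc]
    rw [← h]
    simp [tensorHom_comp_tensorHom]
  have h'' := tensorμ_natural p (𝟙 V) q (𝟙 W)
  rw [id_tensorHom_id, tensorHom_id, tensorHom_id, tensorHom_id] at h''
  rw [ins, ins, ← tensorHom_comp_tensorHom, Category.assoc, h'', ← Category.assoc, h', ins,
    comp_whiskerRight, Category.assoc]

variable (L : P.FullSubcategory ⥤ C)

/-- The point of `L X` given by a point of `X`. -/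
def lpt [L.LaxMonoidal] {X : P.FullSubcategory} (x : X.obj) : 𝟙_ C ⟶ L.obj X :=
  Functor.LaxMonoidal.ε L ≫ L.map (pt x)

theorem lpt_map [L.LaxMonoidal] {X Y : P.FullSubcategory} (x : X.obj) (f : X ⟶ Y) :
    lpt L x ≫ L.map f = lpt L (f.hom x) := by
  rw [lpt, Category.assoc, ← L.map_comp, pt_comp, lpt]

variable [ContainsConvex P]

/-- Under the adjunction, a map out of `L X` becomes a map of spaces, and maps of spaces are
determined by their values. -/
theorem jointlyEpi_lpt [L.Monoidal] [L.IsLeftAdjoint] (X : P.FullSubcategory) :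
    JointlyEpi fun x : X.obj => lpt L x := by
  intro Z a b h
  refine ((Adjunction.ofIsLeftAdjoint L).homEquiv _ _).injective (hom_ext_pt fun x => ?_)
  have h' := h x
  dsimp only at h'
  rw [lpt, Category.assoc, Category.assoc, cancel_epi] at h'
  have h'' := congrArg ((Adjunction.ofIsLeftAdjoint L).homEquiv _ _) h'
  rw [Adjunction.homEquiv_naturality_left, Adjunction.homEquiv_naturality_left] at h''
  exact congrArg (fun f => f.hom (star P)) h''

variable [L.Monoidal]

/-- With this, a map of the form `μ ≫ L.map f` is evaluated by evaluating `f` at pairs of points. -/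
theorem lpt_μ {X Y : P.FullSubcategory} (x : X.obj) (y : Y.obj) :
    (λ_ (𝟙_ C)).inv ≫ (lpt L x ⊗ₘ lpt L y) ≫ Functor.LaxMonoidal.μ L X Y = lpt L (pair x y) := by
  have h : pt (pair x y) = (λ_ (𝟙_ P.FullSubcategory)).inv ≫ (pt x ⊗ₘ pt y) := by
    rw [pt_pair]
    refine CartesianMonoidalCategory.hom_ext _ _ ?_ ?_
    · rw [lift_fst, Category.assoc, tensorHom_fst, ← Category.assoc,
        toUnit_unique ((λ_ (𝟙_ P.FullSubcategory)).inv ≫ fst _ _) (𝟙 _), Category.id_comp]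
    · rw [lift_snd, Category.assoc, tensorHom_snd, ← Category.assoc,
        toUnit_unique ((λ_ (𝟙_ P.FullSubcategory)).inv ≫ snd _ _) (𝟙 _), Category.id_comp]
  have hl := Functor.LaxMonoidal.left_unitality_inv L (𝟙_ P.FullSubcategory)
  rw [lpt, lpt, lpt, h, L.map_comp, ← hl, ← tensorHom_comp_tensorHom, Category.assoc,
    Functor.LaxMonoidal.μ_natural, tensorHom_def']
  simp only [Category.assoc]
  rw [leftUnitor_inv_naturality_assoc]

theorem lpt_pair_δ {X Y : P.FullSubcategory} (x : X.obj) (y : Y.obj) :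
    lpt L (pair x y) ≫ Functor.OplaxMonoidal.δ L X Y =
      (λ_ (𝟙_ C)).inv ≫ (lpt L x ⊗ₘ lpt L y) := by
  rw [← lpt_μ, Category.assoc, Category.assoc, Functor.Monoidal.μ_δ, Category.comp_id]

theorem lpt_toUnit {X : P.FullSubcategory} (x : X.obj) :
    lpt L x ≫ L.map (toUnit X) ≫ Functor.OplaxMonoidal.η L = 𝟙 (𝟙_ C) := by
  rw [lpt, Category.assoc, ← L.map_comp_assoc, toUnit_unique (pt x ≫ toUnit X) (𝟙 _), L.map_id,
    Category.id_comp, Functor.Monoidal.ε_η]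

theorem jointlyEpi_ins [SymmetricCategory C] [MonoidalClosed C] [L.IsLeftAdjoint]
    (X : P.FullSubcategory) (W : C) : JointlyEpi fun x : X.obj => ins (lpt L x) W := by
  intro Z a b h
  refine (jointlyEpi_lpt L X).whiskerRight W _ _ fun x => ?_
  have := h x
  dsimp only at this
  rw [ins, Category.assoc, Category.assoc, cancel_epi] at this
  exact this

end LPoints

/-! ### The operations of an algebra at points of the operad -/

section TensorPowers

variable {C : Type u} [Category.{v} C] [MonoidalCategory C] (X : C)

/-- Addition recurs on the second argument, so `0 + m` is not `m` by definition and an `eqToHom`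
remains. The total of the one-element list of arities `m` is exactly this sum. -/
theorem tpowAdd_zero_left (m : ℕ) :
    tpowAdd X 0 m = (λ_ (tpow X m)).hom ≫ eqToHom (congrArg (tpow X) (Nat.zero_add m).symm) := by
  induction m with
  | zero =>
    change (ρ_ (𝟙_ C)).hom = (λ_ (𝟙_ C)).hom ≫ 𝟙 _
    rw [Category.comp_id, unitors_equal]
  | succ m ih =>
    have h : ∀ {k l : ℕ} (h : k = l), eqToHom (congrArg (tpow X) h) ▷ X =
        eqToHom (congrArg (tpow X) (congrArg (· + 1) h)) := by
      rintro k _ rfl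
      exact id_whiskerRight _ _
    change (α_ (𝟙_ C) (tpow X m) X).inv ≫ tpowAdd X 0 m ▷ X = _
    rw [ih, comp_whiskerRight, h (Nat.zero_add m).symm, leftUnitor_tensor_hom, Category.assoc]

theorem eqToHom_whiskerRight_tpowAdd {k l : ℕ} (h : k = l) (n : ℕ) :
    eqToHom (congrArg (tpow X) h) ▷ tpow X n ≫ tpowAdd X l n =
      tpowAdd X k n ≫ eqToHom (congrArg (fun i => tpow X (i + n)) h) := by
  subst h
  simp

theorem tpowTotal_one (m : ℕ) :
    tpowTotal X (Arities.nil.snoc m) =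
      (λ_ (tpow X m)).hom ≫ eqToHom (congrArg (tpow X) (Nat.zero_add m).symm) := by
  change 𝟙 (𝟙_ C) ▷ tpow X m ≫ tpowAdd X 0 m = _
  rw [id_whiskerRight, tpowAdd_zero_left, Category.id_comp]

theorem tpowTotal_two (m n : ℕ) :
    tpowTotal X ((Arities.nil.snoc m).snoc n) =
      (λ_ (tpow X m)).hom ▷ tpow X n ≫ tpowAdd X m n ≫
        eqToHom (congrArg (fun i => tpow X (i + n)) (Nat.zero_add m).symm) := by
  change tpowTotal X (Arities.nil.snoc m) ▷ tpow X n ≫ tpowAdd X (0 + m) n = _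
  rw [tpowTotal_one, comp_whiskerRight, Category.assoc,
    eqToHom_whiskerRight_tpowAdd X (Nat.zero_add m).symm]

end TensorPowers

section

variable {P : ObjectProperty TopCat.{w}} [ContainsConvex P]
  [CartesianMonoidalCategory P.FullSubcategory]

theorem compFun_pair (js : Arities) (j : ℕ) (c : Fin (js.len + 1) → ℝ × ℝ)
    (d : (tensorOver (little P) js).obj) (x : (little P j).obj) :
    compFun P (js.snoc j) c (pair d x) =
      Fin.append (compFun P js (fun i => c i.castSucc) d)
        (fun i => rescale (c (Fin.last js.len)) (val x i)) := by
  exact congrArg₂ (fun (a : (tensorOver (little P) js).obj) (b : (little P j).obj) =>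
    Fin.append (compFun P js (fun i => c i.castSucc) a)
      (fun i => rescale (c (Fin.last js.len)) (val b i))) (pr₁_pair d x) (pr₂_pair d x)

end

section

variable {P : ObjectProperty TopCat.{w}} [ContainsConvex P]
  [CartesianMonoidalCategory P.FullSubcategory]
  {C : Type u} [Category.{v} C] [MonoidalCategory C] [BraidedCategory C]
  (L : P.FullSubcategory ⥤ C) [L.Monoidal]

/-- The point of `L (F j₁) ⊗ ⋯ ⊗ L (F jₘ)` given by a point of `F j₁ × ⋯ × F jₘ`. -/
def lptAll (F : ℕ → P.FullSubcategory) :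
    ∀ js : Arities, (tensorOver F js).obj → (𝟙_ C ⟶ tensorOver (fun j => L.obj (F j)) js)
  | .nil, _ => 𝟙 _
  | .snoc js j, d => (λ_ (𝟙_ C)).inv ≫
      (lptAll F js (pr₁ (Y := F j) d) ⊗ₘ lpt L (pr₂ (X := tensorOver F js) d))

/-- The inclusion of `G j₁ ⊗ ⋯ ⊗ G jₘ` into `(L (F j₁) ⊗ G j₁) ⊗ ⋯ ⊗ (L (F jₘ) ⊗ G jₘ)` at a point
of `F j₁ × ⋯ × F jₘ`. -/
def insAll (F : ℕ → P.FullSubcategory) (G : ℕ → C) :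
    ∀ js : Arities, (tensorOver F js).obj →
      (tensorOver G js ⟶ tensorOver (fun j => L.obj (F j) ⊗ G j) js)
  | .nil, _ => 𝟙 _
  | .snoc js j, d => insAll F G js (pr₁ (Y := F j) d) ⊗ₘ
      ins (lpt L (pr₂ (X := tensorOver F js) d)) (G j)

variable {L} in
omit [BraidedCategory C] in
theorem insAll_snoc (F : ℕ → P.FullSubcategory) (G : ℕ → C) (js : Arities) (j : ℕ)
    (d : (tensorOver F js).obj) (x : (F j).obj) :
    insAll L F G (js.snoc j) (pair d x) = insAll L F G js d ⊗ₘ ins (lpt L x) (G j) := by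
  change insAll L F G js (pr₁ (pair d x)) ⊗ₘ ins (lpt L (pr₂ (pair d x))) (G j) = _
  rw [pr₁_pair, pr₂_pair]

omit [BraidedCategory C] in
theorem lptAll_lax (F : ℕ → P.FullSubcategory) (js : Arities) (d : (tensorOver F js).obj) :
    lptAll L F js d ≫ tensorOverLax L F js = lpt L d := by
  induction js with
  | nil =>
    change 𝟙 _ ≫ Functor.LaxMonoidal.ε L = Functor.LaxMonoidal.ε L ≫ L.map (pt d)
    rw [toUnit_unique (pt d) (𝟙 _), L.map_id, Category.id_comp, Category.comp_id]
  | snoc js j ih =>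
    change ((λ_ (𝟙_ C)).inv ≫
      (lptAll L F js (pr₁ (Y := F j) d) ⊗ₘ lpt L (pr₂ (X := tensorOver F js) d))) ≫
      tensorOverLax L F js ▷ L.obj (F j) ≫ Functor.LaxMonoidal.μ L (tensorOver F js) (F j) = _
    rw [Category.assoc, ← tensorHom_id, tensorHom_comp_tensorHom_assoc, ih, Category.comp_id,
      lpt_μ, pair_pr]

theorem insAll_shuffle (F : ℕ → P.FullSubcategory) (G : ℕ → C) (js : Arities)
    (d : (tensorOver F js).obj) :
    insAll L F G js d ≫ shuffle (fun j => L.obj (F j)) G js =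
      ins (lptAll L F js d) (tensorOver G js) := by
  induction js with
  | nil =>
    change 𝟙 _ ≫ (λ_ (𝟙_ C)).inv = ins (𝟙 _) (𝟙_ C)
    rw [ins_id, Category.id_comp]
  | snoc js j ih =>
    change (insAll L F G js (pr₁ (Y := F j) d) ⊗ₘ
      ins (lpt L (pr₂ (X := tensorOver F js) d)) (G j)) ≫
      shuffle (fun j => L.obj (F j)) G js ▷ (L.obj (F j) ⊗ G j) ≫ tensorμ _ _ _ _ = _
    rw [← tensorHom_id, tensorHom_comp_tensorHom_assoc, ih, Category.comp_id, ins_tensorμ]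
    rfl

theorem jointlyEpi_insAll {C : Type u} [Category.{v} C] [MonoidalCategory C] [SymmetricCategory C]
    [MonoidalClosed C] (L : P.FullSubcategory ⥤ C) [L.Monoidal] [L.IsLeftAdjoint]
    (F : ℕ → P.FullSubcategory) (G : ℕ → C) (js : Arities) :
    JointlyEpi fun d : (tensorOver F js).obj => insAll L F G js d := by
  induction js with
  | nil =>
    intro Z a b h
    have h' := h (star P)
    change 𝟙 _ ≫ a = 𝟙 _ ≫ b at h'
    rwa [Category.id_comp, Category.id_comp] at h'
  | snoc js j ih =>
    intro Z a b h
    refine ih.tensor (jointlyEpi_ins L (F j) (G j)) fun d x => ?_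
    rw [← insAll_snoc]
    exact h _

end

section Algebra

variable {P : ObjectProperty TopCat.{w}} [ContainsConvex P]
  [CartesianMonoidalCategory P.FullSubcategory] [BraidedCategory P.FullSubcategory]
  {C : Type u} [Category.{v} C] [MonoidalCategory C] [SymmetricCategory C]
  {L : P.FullSubcategory ⥤ C} [L.Braided]

variable (P) in
/-- The point of `little P m` given by a sequence of little intervals. -/
def littlePt {m : ℕ} {c : Fin m → ℝ × ℝ} (hc : c ∈ littleSet m) : (little P m).obj :=
  ofMem (convex_littleSet m) hc

theorem val_littlePt {m : ℕ} {c : Fin m → ℝ × ℝ} (hc : c ∈ littleSet m) :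
    val (littlePt P hc) = c := rfl

variable (L) in
/-- The point of the operad given by a sequence of little intervals. -/
def opPt {m : ℕ} {c : Fin m → ℝ × ℝ} (hc : c ∈ littleSet m) : 𝟙_ C ⟶ op L m :=
  lpt L (littlePt P hc)

theorem opPt_congr {m : ℕ} {c d : Fin m → ℝ × ℝ} (hc : c ∈ littleSet m) (hd : d ∈ littleSet m)
    (h : ∀ i, c i = d i) : opPt L hc = opPt L hd := by
  obtain rfl : c = d := funext h
  rfl

theorem lpt_eq_opPt {m : ℕ} (x : (little P m).obj) {c : Fin m → ℝ × ℝ} (hc : c ∈ littleSet m)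
    (h : ∀ i, val x i = c i) : lpt L x = opPt L hc :=
  congrArg (lpt L) (val_injective (funext h))

theorem opOne_eq : opOne L = opPt L (single_mem le_rfl one_pos le_rfl) := by
  rw [opOne, eq_pt (littleOne P)]
  exact lpt_eq_opPt _ _ fun _ => rfl

theorem insAll_opShuffle (X : C) (js : Arities) (d : (tensorOver (little P) js).obj) :
    insAll L (little P) (tpow X) js d ≫ opShuffle L X js =
      tpowTotal X js ≫ ins (lptAll L (little P) js d) (tpow X js.total) := by
  rw [opShuffle, ← Category.assoc, insAll_shuffle, ins_whiskerLeft]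

/-- The composed list `e` is a parameter tied to `compFun` by `h`, so that an explicit formula can
be used for it. -/
theorem opPt_opComp (js : Arities) {c : Fin js.len → ℝ × ℝ} (hc : c ∈ littleSet js.len)
    (d : (tensorOver (little P) js).obj) {e : Fin js.total → ℝ × ℝ} (he : e ∈ littleSet js.total)
    (h : ∀ i, e i = compFun P js c d i) :
    (λ_ (𝟙_ C)).inv ≫ (opPt L hc ⊗ₘ lptAll L (little P) js d) ≫ opComp L js = opPt L he := by
  rw [opComp, ← id_tensorHom, tensorHom_comp_tensorHom_assoc, lptAll_lax, Category.comp_id]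
  have h' := lpt_μ L (littlePt P hc) d =≫
    L.map (littleComp P js)
  simp only [Category.assoc] at h'
  refine h'.trans ?_
  rw [lpt_map]
  refine lpt_eq_opPt _ _ fun i => ?_
  exact (congrFun (congrArg₂ (fun (a : (little P js.len).obj)
    (b : (tensorOver (little P) js).obj) => compFun P js (val a) b)
    (pr₁_pair (littlePt P hc) d) (pr₂_pair (littlePt P hc) d)) i).trans (h i).symm

namespace Alg

variable (A : Alg L)

/-- The operation given by a sequence of little intervals. -/
def opAt {m : ℕ} {c : Fin m → ℝ × ℝ} (hc : c ∈ littleSet m) : tpow A.X m ⟶ A.X :=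
  ins (opPt L hc) (tpow A.X m) ≫ A.act m

theorem opAt_congr {m : ℕ} {c d : Fin m → ℝ × ℝ} (hc : c ∈ littleSet m) (hd : d ∈ littleSet m)
    (h : ∀ i, c i = d i) : A.opAt hc = A.opAt hd := by
  rw [opAt, opAt, opPt_congr hc hd h]

theorem eqToHom_opAt {m n : ℕ} (h : m = n) {c : Fin m → ℝ × ℝ} (hc : c ∈ littleSet m)
    {d : Fin n → ℝ × ℝ} (hd : d ∈ littleSet n) (h' : ∀ i, c i = d (Fin.cast h i)) :
    eqToHom (congrArg (tpow A.X) h) ≫ A.opAt hd = A.opAt hc := by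
  subst h
  rw [eqToHom_refl, Category.id_comp]
  exact (A.opAt_congr _ _ h').symm

/-- The unary operation given by a little interval. -/
def opAt₁ {c : Fin 1 → ℝ × ℝ} (hc : c ∈ littleSet 1) : A.X ⟶ A.X := (λ_ A.X).inv ≫ A.opAt hc

/-- The binary operation given by two little intervals. -/
def opAt₂ {c : Fin 2 → ℝ × ℝ} (hc : c ∈ littleSet 2) : A.X ⊗ A.X ⟶ A.X :=
  (λ_ A.X).inv ▷ A.X ≫ A.opAt hc

theorem opAt_hom {A B : Alg L} (φ : A ⟶ B) {m : ℕ} {c : Fin m → ℝ × ℝ} (hc : c ∈ littleSet m) :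
    A.opAt hc ≫ φ.hom = tpowMap φ.hom m ≫ B.opAt hc := by
  rw [opAt, opAt, Category.assoc, φ.act_hom, ← Category.assoc, ins_whiskerLeft, Category.assoc]

theorem opAt₂_hom {A B : Alg L} (φ : A ⟶ B) {c : Fin 2 → ℝ × ℝ} (hc : c ∈ littleSet 2) :
    A.opAt₂ hc ≫ φ.hom = (φ.hom ⊗ₘ φ.hom) ≫ B.opAt₂ hc := by
  have h : tpowMap φ.hom 2 = (𝟙 (𝟙_ C) ⊗ₘ φ.hom) ⊗ₘ φ.hom := rfl
  rw [opAt₂, opAt₂, Category.assoc, opAt_hom, h, ← tensorHom_id, ← tensorHom_id,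
    tensorHom_comp_tensorHom_assoc, tensorHom_comp_tensorHom_assoc, id_tensorHom,
    leftUnitor_inv_naturality, Category.id_comp, Category.comp_id]

theorem one_eq_opAt {c : Fin 0 → ℝ × ℝ} (hc : c ∈ littleSet 0) : A.one = A.opAt hc := by
  rw [opAt]
  have h : Functor.LaxMonoidal.ε L ≫ L.map (littleZero P) = opPt L hc := by
    rw [eq_pt (littleZero P)]
    exact lpt_eq_opPt _ _ fun i => i.elim0
  have h' := ins_unit (opPt L hc)
  rw [one, ← Category.assoc, h]
  exact ((congrArg (· ≫ A.act 0) h').trans (Category.assoc _ _ _)).symm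

/-- The unit axiom at a point. It makes the unary cuts vanish when one factor has length zero. -/
theorem opAt₁_eq_id {c : Fin 1 → ℝ × ℝ} (hc : c ∈ littleSet 1) (h : c 0 = (0, 1)) :
    A.opAt₁ hc = 𝟙 A.X := by
  have h' : opPt L hc = opOne L := by
    rw [opOne_eq]
    refine opPt_congr _ _ fun i => ?_
    rw [Subsingleton.elim i 0, h]
  have h'' := A.unit
  rw [opAt₁, opAt, h', ← cancel_epi (λ_ A.X).hom, Category.comp_id, Iso.hom_inv_id_assoc, ← h'',
    MonoidalCategory.tensorHom_def', Category.assoc, ins, Category.assoc]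
  have h₃ := leftUnitor_inv_naturality (λ_ A.X).inv
  rw [← cancel_epi (λ_ A.X).inv]
  simp only [← Category.assoc]
  rw [← h₃]

/-- The tensor product of operations given by a sequence of sequences of little intervals. -/
def opAtAll :
    ∀ js : Arities, (tensorOver (little P) js).obj → (tensorOver (tpow A.X) js ⟶ tpow A.X js.len)
  | .nil, _ => 𝟙 _
  | .snoc js j, d => opAtAll js (pr₁ (Y := little P j) d) ⊗ₘ
      A.opAt (val_mem (pr₂ (X := tensorOver (little P) js) (Y := little P j) d))

theorem opAtAll_snoc (js : Arities) {j : ℕ} (d : (tensorOver (little P) js).obj)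
    {c : Fin j → ℝ × ℝ} (hc : c ∈ littleSet j) :
    A.opAtAll (js.snoc j) (pair d (littlePt P hc)) =
      A.opAtAll js d ⊗ₘ A.opAt hc := by
  exact congrArg₂ (fun (a : (tensorOver (little P) js).obj) (b : (little P j).obj) =>
    A.opAtAll js a ⊗ₘ A.opAt (val_mem b)) (pr₁_pair d (littlePt P hc))
      (pr₂_pair d (littlePt P hc))

theorem insAll_act (js : Arities) (d : (tensorOver (little P) js).obj) :
    insAll L (little P) (tpow A.X) js d ≫ tensorOverTo A.act js = A.opAtAll js d := by
  induction js with
  | nil => exact Category.comp_id (𝟙 (𝟙_ C))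
  | snoc js j ih =>
    change (insAll L (little P) (tpow A.X) js (pr₁ (Y := little P j) d) ⊗ₘ
      ins (lpt L (pr₂ (X := tensorOver (little P) js) d)) (tpow A.X j)) ≫
      (tensorOverTo A.act js ⊗ₘ A.act j) = _
    rw [tensorHom_comp_tensorHom, ih]
    rfl

/-- The associativity axiom at a point of each operad factor. Together with the unit axiom it is the
source of all relations between operations on `A` used below. -/
theorem opAtAll_opAt (js : Arities) {c : Fin js.len → ℝ × ℝ} (hc : c ∈ littleSet js.len)
    (d : (tensorOver (little P) js).obj) {e : Fin js.total → ℝ × ℝ} (he : e ∈ littleSet js.total)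
    (h : ∀ i, e i = compFun P js c d i) :
    A.opAtAll js d ≫ A.opAt hc = tpowTotal A.X js ≫ A.opAt he := by
  -- Both sides of the axiom are precomposed with insertion of the points `d` of the inner factors
  -- and then of `c`.
  have h₁ := (insAll L (little P) (tpow A.X) js d ≫ ins (opPt L hc) _) ≫= A.assoc js
  rw [Category.assoc, Category.assoc, ← Category.assoc (ins _ _), ← Category.assoc (ins _ _),
    ins_whiskerLeft, ins_whiskerLeft, Category.assoc, Category.assoc, ← Category.assoc,
    ← Category.assoc (insAll L (little P) (tpow A.X) js d), insAll_act, insAll_opShuffle] at h₁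
  rw [opAt, h₁, Category.assoc]
  congr 1
  have h₂ := ins_associator_inv (opPt L hc) (lptAll L (little P) js d) (tpow A.X js.total)
  rw [← Category.assoc (ins (opPt L hc) _), ← Category.assoc, h₂, ← Category.assoc,
    ins_whiskerRight, Category.assoc, opPt_opComp js hc d he h, opAt]

/-- `opAtAll_opAt` for the one-element list of arities `m`, without the leading unit factor and the
sum `0 + m`. -/
theorem opAt_opAt₁ {m : ℕ} {d : Fin m → ℝ × ℝ} (hd : d ∈ littleSet m) {c : Fin 1 → ℝ × ℝ}
    (hc : c ∈ littleSet 1) {e : Fin m → ℝ × ℝ} (he : e ∈ littleSet m)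
    (h : ∀ i, e i = rescale (c 0) (d i)) : A.opAt hd ≫ A.opAt₁ hc = A.opAt he := by
  let x : (tensorOver (little P) (Arities.nil.snoc m)).obj :=
    pair (star P) (littlePt P hd)
  have hx : compFun P (Arities.nil.snoc m) c x =
      Fin.append (Fin.elim0 : Fin 0 → ℝ × ℝ) (fun i => rescale (c 0) (d i)) :=
    compFun_pair Arities.nil m c (star P) (littlePt P hd)
  have h₁ := A.opAtAll_opAt (Arities.nil.snoc m) hc x (compFun_mem P _ c hc x).1 (fun _ => rfl)
  rw [opAtAll_snoc, tpowTotal_one, Category.assoc, A.eqToHom_opAt (Nat.zero_add m).symm he] at h₁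
  · rw [opAt₁, leftUnitor_inv_naturality_assoc, ← id_tensorHom]
    exact ((λ_ _).inv ≫= h₁).trans (Iso.inv_hom_id_assoc _ _)
  · intro i
    rw [hx, h i, Fin.elim0_append]
    rfl

/-- `opAtAll_opAt` for the list of arities `m, n`, again freed from unit factors and from `0 + m`.
-/
theorem opAt_opAt₂ {m n : ℕ} {d : Fin m → ℝ × ℝ} (hd : d ∈ littleSet m) {e : Fin n → ℝ × ℝ}
    (he : e ∈ littleSet n) {c : Fin 2 → ℝ × ℝ} (hc : c ∈ littleSet 2)
    {f : Fin (m + n) → ℝ × ℝ} (hf : f ∈ littleSet (m + n))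
    (h : f = Fin.append (fun i => rescale (c 0) (d i)) (fun i => rescale (c 1) (e i))) :
    (A.opAt hd ⊗ₘ A.opAt he) ≫ A.opAt₂ hc = tpowAdd A.X m n ≫ A.opAt hf := by
  let x : (tensorOver (little P) (Arities.nil.snoc m)).obj := pair (star P) (littlePt P hd)
  let y : (tensorOver (little P) ((Arities.nil.snoc m).snoc n)).obj := pair x (littlePt P he)
  have hx : compFun P (Arities.nil.snoc m) (fun i => c i.castSucc) x =
      Fin.append (Fin.elim0 : Fin 0 → ℝ × ℝ) (fun i => rescale (c 0) (d i)) :=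
    compFun_pair Arities.nil m (fun i => c i.castSucc) (star P) (littlePt P hd)
  have hy : compFun P ((Arities.nil.snoc m).snoc n) c y =
      Fin.append (compFun P (Arities.nil.snoc m) (fun i => c i.castSucc) x)
        (fun i => rescale (c 1) (e i)) :=
    compFun_pair (Arities.nil.snoc m) n c x (littlePt P he)
  have h₁ := A.opAtAll_opAt ((Arities.nil.snoc m).snoc n) hc y (compFun_mem P _ c hc y).1
    (fun _ => rfl)
  rw [opAtAll_snoc, opAtAll_snoc, tpowTotal_two, Category.assoc, Category.assoc,
    A.eqToHom_opAt (congrArg (· + n) (Nat.zero_add m).symm) hf] at h₁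
  · rw [opAt₂, ← tensorHom_id, tensorHom_comp_tensorHom_assoc, leftUnitor_inv_naturality,
      Category.comp_id]
    have h₂ := (λ_ (tpow A.X m)).inv ▷ tpow A.X n ≫= h₁
    rw [inv_hom_whiskerRight_assoc] at h₂
    rw [← h₂, ← tensorHom_id, tensorHom_comp_tensorHom_assoc, Category.id_comp, ← id_tensorHom]
    rfl
  · intro i
    rw [h, hy, hx, Fin.elim0_append]
    refine Fin.addCases (fun i => ?_) (fun i => ?_) i
    · rw [Fin.append_left]
      have : Fin.cast (congrArg (· + n) (Nat.zero_add m).symm) (Fin.castAdd n i) =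
        Fin.castAdd n (Fin.cast (Nat.zero_add m).symm i) := rfl
      rw [this, Fin.append_left]
      rfl
    · rw [Fin.append_right]
      have : Fin.cast (congrArg (· + n) (Nat.zero_add m).symm) (Fin.natAdd m i) =
        Fin.natAdd (0 + m) i := by ext; simp
      rw [this, Fin.append_right]

end Alg

end Algebra

/-! ### The monoid structure on `pad` -/

section Maps

variable {P : ObjectProperty TopCat.{w}} [ContainsConvex P]
  {V W U : Type} [NormedAddCommGroup V] [NormedSpace ℝ V] [FiniteDimensional ℝ V]
  [NormedAddCommGroup W] [NormedSpace ℝ W] [FiniteDimensional ℝ W]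
  [NormedAddCommGroup U] [NormedSpace ℝ U] [FiniteDimensional ℝ U]

variable [CartesianMonoidalCategory P.FullSubcategory]

theorem map₂_pair {s : Set V} (hs : Convex ℝ s) {t : Set W} (ht : Convex ℝ t) {u : Set U}
    (hu : Convex ℝ u) (f : V → W → U)
    (hf : ContinuousOn (fun p : V × W => f p.1 p.2) (s ×ˢ t))
    (hfm : ∀ x ∈ s, ∀ y ∈ t, f x y ∈ u) {x : V} (hx : x ∈ s) {y : W} (hy : y ∈ t) :
    (map₂ (P := P) hs ht hu f hf hfm).hom (pair (ofMem hs hx) (ofMem ht hy)) =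
      ofMem hu (hfm x hx y hy) := by
  refine val_injective ?_
  rw [map₂, val_homTo, pr₁_pair, pr₂_pair]
  rfl

end Maps

namespace Alg

section

variable {P : ObjectProperty TopCat.{w}} [ContainsConvex P]
  [CartesianMonoidalCategory P.FullSubcategory] [BraidedCategory P.FullSubcategory]
  {C : Type u} [Category.{v} C] [MonoidalCategory C] [SymmetricCategory C]
  {L : P.FullSubcategory ⥤ C} [L.Braided] (A : Alg L)

theorem opAt_single {c : Fin 1 → ℝ × ℝ} (hc : c ∈ littleSet 1) :
    A.opAt hc = (λ_ A.X).hom ≫ A.opAt₁ hc := (Iso.hom_inv_id_assoc _ _).symm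

/-- The empty list stays empty when it is substituted into an interval. -/
theorem one_opAt₁ {c : Fin 1 → ℝ × ℝ} (hc : c ∈ littleSet 1) : A.one ≫ A.opAt₁ hc = A.one := by
  have h : (Fin.elim0 : Fin 0 → ℝ × ℝ) ∈ littleSet 0 := ⟨fun i => i.elim0, fun i => i.elim0⟩
  rw [A.one_eq_opAt h]
  exact A.opAt_opAt₁ h hc h fun i => i.elim0

/-- Substituting the empty list for an interval deletes it. This and `opAt₂_one` make the binary cut
compatible with the unary cuts along the pushout. -/
theorem one_opAt₂ {c : Fin 2 → ℝ × ℝ} (hc : c ∈ littleSet 2) {d : Fin 1 → ℝ × ℝ}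
    (hd : d ∈ littleSet 1) (h : d 0 = c 1) :
    A.one ▷ A.X ≫ A.opAt₂ hc = (λ_ A.X).hom ≫ A.opAt₁ hd := by
  have h₀ : (Fin.elim0 : Fin 0 → ℝ × ℝ) ∈ littleSet 0 := ⟨fun i => i.elim0, fun i => i.elim0⟩
  have h₁ := single_mem le_rfl one_pos le_rfl
  have h₂ := A.opAt_opAt₂ h₀ h₁ hc (f := d) hd (by
    funext i
    refine Eq.trans ?_ (b := rescale (c 1) (0, 1)) ?_
    · rw [Subsingleton.elim i (0 : Fin 1), h]
      simp [rescale]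
    · rw [Subsingleton.elim i (0 : Fin 1)]
      rfl)
  have h₃ : tpowAdd A.X 0 1 = (λ_ (𝟙_ C ⊗ A.X)).hom := by
    rw [tpowAdd_zero_left]
    exact Category.comp_id _
  rw [← A.one_eq_opAt, h₃, opAt_single, A.opAt₁_eq_id h₁ rfl, Category.comp_id,
    MonoidalCategory.tensorHom_def'] at h₂
  have h₄ := 𝟙_ C ◁ (λ_ A.X).inv ≫= h₂
  rw [Category.assoc, whiskerLeft_inv_hom_assoc] at h₄
  refine h₄.trans ?_
  rw [← Category.assoc]
  refine (leftUnitor_naturality (λ_ A.X).inv =≫ A.opAt hd).trans ?_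
  rw [opAt₁, Category.assoc]

theorem opAt₂_one {c : Fin 2 → ℝ × ℝ} (hc : c ∈ littleSet 2) {d : Fin 1 → ℝ × ℝ}
    (hd : d ∈ littleSet 1) (h : d 0 = c 0) :
    A.X ◁ A.one ≫ A.opAt₂ hc = (ρ_ A.X).hom ≫ A.opAt₁ hd := by
  have h₀ : (Fin.elim0 : Fin 0 → ℝ × ℝ) ∈ littleSet 0 := ⟨fun i => i.elim0, fun i => i.elim0⟩
  have h₁ := single_mem le_rfl one_pos le_rfl
  have h₂ := A.opAt_opAt₂ h₁ h₀ hc (f := d) hd (by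
    funext i
    refine Eq.trans ?_ (b := rescale (c 0) (0, 1)) ?_
    · rw [Subsingleton.elim i (0 : Fin 1), h]
      simp [rescale]
    · rw [Subsingleton.elim i (0 : Fin 1)]
      rfl)
  have h₃ : tpowAdd A.X 1 0 = (ρ_ (𝟙_ C ⊗ A.X)).hom := rfl
  rw [← A.one_eq_opAt, h₃, opAt_single, A.opAt₁_eq_id h₁ rfl, Category.comp_id,
    MonoidalCategory.tensorHom_def] at h₂
  have h₄ := (λ_ A.X).inv ▷ 𝟙_ C ≫= h₂
  rw [Category.assoc, inv_hom_whiskerRight_assoc] at h₄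
  refine h₄.trans ?_
  rw [← Category.assoc]
  refine (rightUnitor_naturality (λ_ A.X).inv =≫ A.opAt hd).trans ?_
  rw [opAt₁, Category.assoc]

/-- Both sides are the ternary operation given by one list `g` of three intervals, and the
hypotheses compare the two descriptions of `g` entry by entry. -/
theorem opAt₂_assoc {c d e f : Fin 2 → ℝ × ℝ} (hc : c ∈ littleSet 2) (hd : d ∈ littleSet 2)
    (he : e ∈ littleSet 2) (hf : f ∈ littleSet 2)
    (h₀ : rescale (c 0) (d 0) = e 0) (h₁ : rescale (c 0) (d 1) = rescale (e 1) (f 0))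
    (h₂ : c 1 = rescale (e 1) (f 1)) :
    A.opAt₂ hd ▷ A.X ≫ A.opAt₂ hc =
      (α_ A.X A.X A.X).hom ≫ A.X ◁ A.opAt₂ hf ≫ A.opAt₂ he := by
  have hu := single_mem le_rfl one_pos le_rfl
  let g : Fin 3 → ℝ × ℝ := ![rescale (c 0) (d 0), rescale (c 0) (d 1), c 1]
  have hg₁ : g = Fin.append (fun i => rescale (c 0) (d i))
      (fun i : Fin 1 => rescale (c 1) ((fun _ => (0, 1) : Fin 1 → ℝ × ℝ) i)) := by
    funext i
    fin_cases i
    · rfl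
    · rfl
    · change c 1 = rescale (c 1) (0, 1)
      simp [rescale]
  have hg₂ : g = Fin.append (fun i : Fin 1 => rescale (e 0) ((fun _ => (0, 1) : Fin 1 → ℝ × ℝ) i))
      (fun i => rescale (e 1) (f i)) := by
    funext i
    fin_cases i
    · change rescale (c 0) (d 0) = rescale (e 0) (0, 1)
      simp [rescale, ← h₀]
    · exact h₁
    · exact h₂
  have hg : g ∈ littleSet 3 := by
    rw [hg₁]
    refine append_mem (rescale_comp_mem (hc.1 0) hd) (rescale_comp_mem (hc.1 1) hu) fun i k => ?_
    exact ((rescale_mem (hc.1 0).2.1 (hd.1 i)).2.2.trans (hc.2 0 1 (by decide))).trans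
      (rescale_mem (hc.1 1).2.1 (hu.1 k)).1
  have hl := A.opAt_opAt₂ hd hu hc hg hg₁
  have hr := A.opAt_opAt₂ hu hf he hg hg₂
  rw [opAt_single A hu, A.opAt₁_eq_id hu rfl, Category.comp_id] at hl hr
  have hl' : (((λ_ A.X).inv ▷ A.X) ⊗ₘ (λ_ A.X).inv) ≫ (A.opAt hd ⊗ₘ (λ_ A.X).hom) =
      A.opAt₂ hd ▷ A.X := by
    rw [tensorHom_comp_tensorHom, Iso.inv_hom_id, tensorHom_id]
    rfl
  have hr' : ((λ_ A.X).inv ⊗ₘ ((λ_ A.X).inv ▷ A.X)) ≫ ((λ_ A.X).hom ⊗ₘ A.opAt hf) =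
      A.X ◁ A.opAt₂ hf := by
    rw [tensorHom_comp_tensorHom, Iso.inv_hom_id, id_tensorHom]
    rfl
  rw [← hl', ← hr', Category.assoc, Category.assoc, hl, hr]
  have h21 : tpowAdd A.X 2 1 = (α_ _ _ _).inv ≫ (ρ_ ((𝟙_ C ⊗ A.X) ⊗ A.X)).hom ▷ A.X := rfl
  have h12 : tpowAdd A.X 1 2 = (α_ _ _ _).inv ≫
      ((α_ _ _ _).inv ≫ (ρ_ (𝟙_ C ⊗ A.X)).hom ▷ A.X) ▷ A.X := rfl
  rw [← Category.assoc, ← Category.assoc, ← Category.assoc]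
  congr 1
  rw [h21, h12]
  monoidal

end

end Alg

/-! ### Products and cuts of elements of a length monoid -/

section PadPoints

variable {P : ObjectProperty TopCat.{w}} [ContainsConvex P]
  [CartesianMonoidalCategory P.FullSubcategory]
  {V : Type} [NormedAddCommGroup V] [NormedSpace ℝ V] [FiniteDimensional ℝ V]
  (Q : LengthMonoid V)

namespace LengthMonoid

/-- The point of `Q.full P` given by an element of the monoid. -/
def fullPt (P : ObjectProperty TopCat.{w}) [ContainsConvex P] {a : V} (ha : a ∈ Q.carrier) :
    (Q.full P).obj := ofMem Q.convex ha

/-- The point of `Q.pos P` given by an element of positive length. -/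
def posPt (P : ObjectProperty TopCat.{w}) [ContainsConvex P] {a : V} (ha : a ∈ Q.posCarrier) :
    (Q.pos P).obj := ofMem Q.convex_posCarrier ha

variable {Q} {a b : V}

theorem mulFF_pair (ha : a ∈ Q.carrier) (hb : b ∈ Q.carrier) :
    (Q.mulFF P).hom (pair (Q.fullPt P ha) (Q.fullPt P hb)) = Q.fullPt P (Q.mul_mem ha hb) :=
  map₂_pair _ _ _ _ _ _ ha hb

theorem mulFP_pair (ha : a ∈ Q.carrier) (hb : b ∈ Q.posCarrier)
    (hab : Q.mul a b ∈ Q.posCarrier) :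
    (Q.mulFP P).hom (pair (Q.fullPt P ha) (Q.posPt P hb)) = Q.posPt P hab :=
  map₂_pair _ _ _ _ _ _ ha hb

theorem mulPF_pair (ha : a ∈ Q.posCarrier) (hb : b ∈ Q.carrier)
    (hab : Q.mul a b ∈ Q.posCarrier) :
    (Q.mulPF P).hom (pair (Q.posPt P ha) (Q.fullPt P hb)) = Q.posPt P hab :=
  map₂_pair _ _ _ _ _ _ ha hb

theorem mulPP_pair (ha : a ∈ Q.posCarrier) (hb : b ∈ Q.posCarrier)
    (hab : Q.mul a b ∈ Q.posCarrier) :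
    (Q.mulPP P).hom (pair (Q.posPt P ha) (Q.posPt P hb)) = Q.posPt P hab :=
  map₂_pair _ _ _ _ _ _ ha hb

theorem cutFP_pair (ha : a ∈ Q.carrier) (hb : b ∈ Q.posCarrier)
    (h : (fun _ => (Q.cutPoint a b, 1)) ∈ littleSet 1) :
    (Q.cutFP P).hom (pair (Q.fullPt P ha) (Q.posPt P hb)) = littlePt P h :=
  map₂_pair _ _ _ _ _ _ ha hb

theorem cutPF_pair (ha : a ∈ Q.posCarrier) (hb : b ∈ Q.carrier)
    (h : (fun _ => (0, Q.cutPoint a b)) ∈ littleSet 1) :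
    (Q.cutPF P).hom (pair (Q.posPt P ha) (Q.fullPt P hb)) = littlePt P h :=
  map₂_pair _ _ _ _ _ _ ha hb

theorem cutPP_pair (ha : a ∈ Q.posCarrier) (hb : b ∈ Q.posCarrier)
    (h : ![(0, Q.cutPoint a b), (Q.cutPoint a b, 1)] ∈ littleSet 2) :
    (Q.cutPP P).hom (pair (Q.posPt P ha) (Q.posPt P hb)) = littlePt P h :=
  map₂_pair _ _ _ _ _ _ ha hb

theorem incl_posPt (ha : a ∈ Q.posCarrier) :
    (Q.incl P).hom (Q.posPt P ha) = Q.fullPt P ha.1 := rfl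

theorem mul_mem_pos_left (ha : a ∈ Q.posCarrier) (hb : b ∈ Q.carrier) :
    Q.mul a b ∈ Q.posCarrier := ⟨Q.mul_mem ha.1 hb, Q.len_mul_pos ha.1 hb (.inl ha.2)⟩

theorem mul_mem_pos_right (ha : a ∈ Q.carrier) (hb : b ∈ Q.posCarrier) :
    Q.mul a b ∈ Q.posCarrier := ⟨Q.mul_mem ha hb.1, Q.len_mul_pos ha hb.1 (.inr hb.2)⟩

theorem cut_right_mem (ha : a ∈ Q.carrier) (hb : b ∈ Q.posCarrier) :
    (fun _ => (Q.cutPoint a b, 1)) ∈ littleSet 1 :=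
  single_mem (Q.cutPoint_nonneg ha hb.1) (Q.cutPoint_lt_one ha hb.1 hb.2) le_rfl

theorem cut_left_mem (ha : a ∈ Q.posCarrier) (hb : b ∈ Q.carrier) :
    (fun _ => (0, Q.cutPoint a b)) ∈ littleSet 1 :=
  single_mem le_rfl (Q.cutPoint_pos ha.1 hb ha.2) (Q.cutPoint_le_one ha.1 hb)

theorem cut_mem (ha : a ∈ Q.posCarrier) (hb : b ∈ Q.posCarrier) :
    ![(0, Q.cutPoint a b), (Q.cutPoint a b, 1)] ∈ littleSet 2 :=
  pair_mem (Q.cutPoint_pos ha.1 hb.1 ha.2) (Q.cutPoint_lt_one ha.1 hb.1 hb.2) le_rfl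

/-- A factor of length zero takes no part of `[0,1]`: here, and in `cutPoint_eq_one`, the other
factor keeps the whole interval. -/
theorem cutPoint_eq_zero (h : Q.len a = 0) : Q.cutPoint a b = 0 := by
  rw [cutPoint, h, zero_div]

theorem cutPoint_eq_one (ha : 0 < Q.len a) (h : Q.len b = 0) : Q.cutPoint a b = 1 := by
  rw [cutPoint, Q.len_mul, h, mul_zero, add_zero, div_self ha.ne']

end LengthMonoid

end PadPoints

namespace Alg

section

variable {P : ObjectProperty TopCat.{w}} [ContainsConvex P]
  [CartesianMonoidalCategory P.FullSubcategory] [BraidedCategory P.FullSubcategory]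
  {C : Type u} [Category.{v} C] [MonoidalCategory C] [SymmetricCategory C]
  {L : P.FullSubcategory ⥤ C} [L.Braided] (A : Alg L)
  {V : Type} [NormedAddCommGroup V] [NormedSpace ℝ V] [FiniteDimensional ℝ V]
  (Q : LengthMonoid V)

/-- At a point, `lift mul cut` followed by `δ` separates into the product of the two elements and
the list of intervals, so no structure morphism survives. -/
theorem ins_mulCut {X Y : P.FullSubcategory} (x : X.obj) (y : Y.obj) {m : ℕ}
    (mul : X ⊗ Y ⟶ Q.pos P) (cut : X ⊗ Y ⟶ little P m) {U W : C} (e : U ⊗ W ⟶ tpow A.X m)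
    {a : V} (ha : a ∈ Q.posCarrier) (hm : mul.hom (pair x y) = Q.posPt P ha)
    {c : Fin m → ℝ × ℝ} (hc : c ∈ littleSet m) (hcut : cut.hom (pair x y) = littlePt P hc) :
    (ins (lpt L x) U ⊗ₘ ins (lpt L y) W) ≫ A.mulCut Q mul cut e =
      e ≫ A.opAt hc ≫ ins (lpt L (Q.posPt P ha)) A.X := by
  have h : ((λ_ (𝟙_ C)).inv ≫ (lpt L x ⊗ₘ lpt L y)) ≫ Functor.LaxMonoidal.μ L X Y ≫
      L.map (lift mul cut) ≫ Functor.OplaxMonoidal.δ L (Q.pos P) (little P m) =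
      (λ_ (𝟙_ C)).inv ≫ (lpt L (Q.posPt P ha) ⊗ₘ opPt L hc) := by
    have h' := lpt_μ L x y =≫ (L.map (lift mul cut) ≫ Functor.OplaxMonoidal.δ L _ _)
    simp only [Category.assoc] at h' ⊢
    rw [h', ← Category.assoc, lpt_map, lift_apply, hm, hcut, lpt_pair_δ, opPt]
  rw [mulCut, ← Category.assoc, ins_tensorμ, ← Category.assoc, ins_tensorHom, h,
    Category.assoc, ← Category.assoc (ins _ _), ins_associator, Category.assoc, ins_whiskerLeft,
    opAt, Category.assoc]

variable [HasCountableColimits C]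

/-- The map from the unit to `A.pad Q` at an element of the monoid. -/
def padOne {a : V} (ha : a ∈ Q.carrier) : 𝟙_ C ⟶ A.pad Q :=
  ins (lpt L (Q.fullPt P ha)) (𝟙_ C) ≫ A.padInl Q

/-- The map from `A` to `A.pad Q` at an element of positive length. -/
def padAt {a : V} (ha : a ∈ Q.posCarrier) : A.X ⟶ A.pad Q :=
  ins (lpt L (Q.posPt P ha)) A.X ≫ A.padInr Q

/-- The pushout square at a point. -/
theorem padOne_eq {a : V} (ha : a ∈ Q.posCarrier) :
    A.padOne Q ha.1 = A.one ≫ A.padAt Q ha := by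
  rw [padAt, ← Category.assoc, ← ins_whiskerLeft, Category.assoc, ← pad_condition,
    ← Category.assoc, ins_whiskerRight, lpt_map, LengthMonoid.incl_posPt, padOne]

theorem padOne_congr {a b : V} (ha : a ∈ Q.carrier) (hb : b ∈ Q.carrier) (h : a = b) :
    A.padOne Q ha = A.padOne Q hb := by
  subst h; rfl

theorem padAt_congr {a b : V} (ha : a ∈ Q.posCarrier) (hb : b ∈ Q.posCarrier) (h : a = b) :
    A.padAt Q ha = A.padAt Q hb := by
  subst h; rfl

theorem isPushout_pad : IsPushout (L.map (Q.incl P) ▷ 𝟙_ C) (L.obj (Q.pos P) ◁ A.one)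
    (A.padInl Q) (A.padInr Q) := IsPushout.of_hasPushout _ _

/-- The sources of the maps to `A.pad Q` at points: the unit at elements of length zero, and `A` at
elements of positive length. -/
def padDom : {a // a ∈ Q.carrier ∧ Q.len a = 0} ⊕ {a // a ∈ Q.posCarrier} → C
  | .inl _ => 𝟙_ C
  | .inr _ => A.X

/-- The maps to `A.pad Q` at points. -/
def padPt : ∀ i : {a // a ∈ Q.carrier ∧ Q.len a = 0} ⊕ {a // a ∈ Q.posCarrier},
    A.padDom Q i ⟶ A.pad Q
  | .inl a => A.padOne Q a.2.1
  | .inr a => A.padAt Q a.2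

variable [MonoidalClosed C] [L.IsLeftAdjoint]

/-- At positive length the unit part factors through the part with `A`, by `padOne_eq`. Hence the
unit part matters only at length zero, where cuts are trivial, and the later case distinctions never
meet a proper unary cut. -/
theorem pad_hom_ext_pt {Z : C} {f g : A.pad Q ⟶ Z}
    (h₁ : ∀ a (ha : a ∈ Q.carrier), Q.len a = 0 → A.padOne Q ha ≫ f = A.padOne Q ha ≫ g)
    (h₂ : ∀ a (ha : a ∈ Q.posCarrier), A.padAt Q ha ≫ f = A.padAt Q ha ≫ g) : f = g := by
  refine A.pad_hom_ext Q (jointlyEpi_ins L (Q.full P) (𝟙_ C) _ _ fun x => ?_)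
    (jointlyEpi_ins L (Q.pos P) A.X _ _ fun x => ?_)
  · have h : A.padOne Q (val_mem x) ≫ f = A.padOne Q (val_mem x) ≫ g := by
      rcases (Q.len_nonneg (val_mem x)).eq_or_lt with h | h
      · exact h₁ _ _ h.symm
      · have := h₂ _ ⟨val_mem x, h⟩
        rw [A.padOne_eq Q ⟨val_mem x, h⟩, Category.assoc, this, Category.assoc]
    rw [padOne, Category.assoc, Category.assoc] at h
    exact h
  · have h := h₂ _ (val_mem x)
    rw [padAt, Category.assoc, Category.assoc] at h
    exact h

theorem jointlyEpi_padPt : JointlyEpi (A.padPt Q) := fun _ _ _ h =>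
  A.pad_hom_ext_pt Q (fun a ha h₀ => h (.inl ⟨a, ha, h₀⟩)) (fun a ha => h (.inr ⟨a, ha⟩))

end

/-! ### Gluing the multiplication of the pushout -/

section

variable {P : ObjectProperty TopCat.{w}} [ContainsConvex P]
  [CartesianMonoidalCategory P.FullSubcategory] [BraidedCategory P.FullSubcategory]
  {C : Type u} [Category.{v} C] [MonoidalCategory C] [SymmetricCategory C]
  {L : P.FullSubcategory ⥤ C} [L.Braided] [HasCountableColimits C] (A : Alg L)
  {V : Type} [NormedAddCommGroup V] [NormedSpace ℝ V] [FiniteDimensional ℝ V]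
  (Q : LengthMonoid V)

/-- The maps that the multiplication of `A.pad Q` is made of. -/
def padMulFF : (L.obj (Q.full P) ⊗ 𝟙_ C) ⊗ (L.obj (Q.full P) ⊗ 𝟙_ C) ⟶ A.pad Q :=
  tensorμ _ _ _ _ ≫
    ((Functor.LaxMonoidal.μ L _ _ ≫ L.map (Q.mulFF P)) ⊗ₘ (λ_ (𝟙_ C)).hom) ≫ A.padInl Q

def padMulFP : (L.obj (Q.full P) ⊗ 𝟙_ C) ⊗ (L.obj (Q.pos P) ⊗ A.X) ⟶ A.pad Q :=
  A.mulCut Q (Q.mulFP P) (Q.cutFP P) (𝟙 (𝟙_ C ⊗ A.X)) ≫ A.padInr Q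

def padMulPF : (L.obj (Q.pos P) ⊗ A.X) ⊗ (L.obj (Q.full P) ⊗ 𝟙_ C) ⟶ A.pad Q :=
  A.mulCut Q (Q.mulPF P) (Q.cutPF P) ((ρ_ A.X).hom ≫ (λ_ A.X).inv) ≫ A.padInr Q

def padMulPP : (L.obj (Q.pos P) ⊗ A.X) ⊗ (L.obj (Q.pos P) ⊗ A.X) ⟶ A.pad Q :=
  A.mulCut Q (Q.mulPP P) (Q.cutPP P) ((λ_ A.X).inv ▷ A.X) ≫ A.padInr Q

variable {Q} {a b : V}

theorem padMulFF_pt (ha : a ∈ Q.carrier) (hb : b ∈ Q.carrier) :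
    (ins (lpt L (Q.fullPt P ha)) (𝟙_ C) ⊗ₘ ins (lpt L (Q.fullPt P hb)) (𝟙_ C)) ≫ A.padMulFF Q =
      (λ_ (𝟙_ C)).hom ≫ A.padOne Q (Q.mul_mem ha hb) := by
  have h := lpt_μ L (Q.fullPt P ha) (Q.fullPt P hb) =≫ L.map (Q.mulFF P)
  rw [lpt_map, LengthMonoid.mulFF_pair] at h
  simp only [Category.assoc] at h
  rw [padMulFF, ← Category.assoc, ins_tensorμ, ← Category.assoc, ins_tensorHom, Category.assoc,
    Category.assoc, h, padOne]

theorem padMulFP_pt (ha : a ∈ Q.carrier) (hb : b ∈ Q.posCarrier) :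
    (ins (lpt L (Q.fullPt P ha)) (𝟙_ C) ⊗ₘ ins (lpt L (Q.posPt P hb)) A.X) ≫ A.padMulFP Q =
      (λ_ A.X).hom ≫ A.opAt₁ (LengthMonoid.cut_right_mem ha hb) ≫
        A.padAt Q (LengthMonoid.mul_mem_pos_right ha hb) := by
  rw [padMulFP, ← Category.assoc, A.ins_mulCut Q _ _ _ _ _ _
    (LengthMonoid.mulFP_pair ha hb (LengthMonoid.mul_mem_pos_right ha hb))
    (LengthMonoid.cut_right_mem ha hb) (LengthMonoid.cutFP_pair ha hb _), opAt_single, padAt]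
  simp only [Category.assoc, Category.id_comp]

theorem padMulPF_pt (ha : a ∈ Q.posCarrier) (hb : b ∈ Q.carrier) :
    (ins (lpt L (Q.posPt P ha)) A.X ⊗ₘ ins (lpt L (Q.fullPt P hb)) (𝟙_ C)) ≫ A.padMulPF Q =
      (ρ_ A.X).hom ≫ A.opAt₁ (LengthMonoid.cut_left_mem ha hb) ≫
        A.padAt Q (LengthMonoid.mul_mem_pos_left ha hb) := by
  rw [padMulPF, ← Category.assoc, A.ins_mulCut Q _ _ _ _ _ _
    (LengthMonoid.mulPF_pair ha hb (LengthMonoid.mul_mem_pos_left ha hb))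
    (LengthMonoid.cut_left_mem ha hb) (LengthMonoid.cutPF_pair ha hb _), opAt_single, padAt]
  simp only [Category.assoc, Iso.inv_hom_id_assoc]

theorem padMulPP_pt (ha : a ∈ Q.posCarrier) (hb : b ∈ Q.posCarrier) :
    (ins (lpt L (Q.posPt P ha)) A.X ⊗ₘ ins (lpt L (Q.posPt P hb)) A.X) ≫ A.padMulPP Q =
      A.opAt₂ (LengthMonoid.cut_mem ha hb) ≫
        A.padAt Q (LengthMonoid.mul_mem_pos_left ha hb.1) := by
  rw [padMulPP, ← Category.assoc, A.ins_mulCut Q _ _ _ _ _ _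
    (LengthMonoid.mulPP_pair ha hb (LengthMonoid.mul_mem_pos_left ha hb.1))
    (LengthMonoid.cut_mem ha hb) (LengthMonoid.cutPP_pair ha hb _), padAt, opAt₂]
  simp only [Category.assoc]

variable (Q)

/-- The multiplication of `A.pad Q` is given by the operations that cut `[0,1]` into two pieces. -/
structure IsPadMul (m : A.pad Q ⊗ A.pad Q ⟶ A.pad Q) : Prop where
  FF : (A.padInl Q ⊗ₘ A.padInl Q) ≫ m = A.padMulFF Q
  FP : (A.padInl Q ⊗ₘ A.padInr Q) ≫ m = A.padMulFP Q
  PF : (A.padInr Q ⊗ₘ A.padInl Q) ≫ m = A.padMulPF Q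
  PP : (A.padInr Q ⊗ₘ A.padInr Q) ≫ m = A.padMulPP Q

variable [MonoidalClosed C] [L.IsLeftAdjoint]

/-- First of the four compatibilities needed for gluing. When the other factor is in the unit part,
as here, `1_A` absorbs a unary operation; otherwise inserting `1_A` removes one interval from a
binary operation. -/
theorem incl_padMulFF_left : (L.map (Q.incl P) ▷ 𝟙_ C) ▷ (L.obj (Q.full P) ⊗ 𝟙_ C) ≫ A.padMulFF Q =
    (L.obj (Q.pos P) ◁ A.one) ▷ (L.obj (Q.full P) ⊗ 𝟙_ C) ≫ A.padMulPF Q := by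
  refine (jointlyEpi_ins L (Q.pos P) (𝟙_ C)).tensor (jointlyEpi_ins L (Q.full P) (𝟙_ C))
    fun x y => ?_
  have hx := val_mem x
  have hy := val_mem y
  rw [tensorHom_comp_whiskerRight_assoc, tensorHom_comp_whiskerRight_assoc, ins_whiskerRight,
    ins_whiskerLeft, lpt_map]
  refine (A.padMulFF_pt hx.1 hy).trans ?_
  have h : (A.one ⊗ₘ 𝟙 (𝟙_ C)) ≫ _ = (A.one ⊗ₘ 𝟙 (𝟙_ C)) ≫ _ := congrArg _ (A.padMulPF_pt hx hy)
  rw [tensorHom_comp_tensorHom_assoc, Category.id_comp] at h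
  refine Eq.trans ?_ h.symm
  rw [tensorHom_id, rightUnitor_naturality_assoc, unitors_equal, ← Category.assoc A.one,
    one_opAt₁, ← padOne_eq]

theorem incl_padMulFP_left : (L.map (Q.incl P) ▷ 𝟙_ C) ▷ (L.obj (Q.pos P) ⊗ A.X) ≫ A.padMulFP Q =
    (L.obj (Q.pos P) ◁ A.one) ▷ (L.obj (Q.pos P) ⊗ A.X) ≫ A.padMulPP Q := by
  refine (jointlyEpi_ins L (Q.pos P) (𝟙_ C)).tensor (jointlyEpi_ins L (Q.pos P) A.X)
    fun x y => ?_
  have hx := val_mem x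
  have hy := val_mem y
  rw [tensorHom_comp_whiskerRight_assoc, tensorHom_comp_whiskerRight_assoc, ins_whiskerRight,
    ins_whiskerLeft, lpt_map]
  refine (A.padMulFP_pt hx.1 hy).trans ?_
  have h : (A.one ⊗ₘ 𝟙 A.X) ≫ _ = (A.one ⊗ₘ 𝟙 A.X) ≫ _ := congrArg _ (A.padMulPP_pt hx hy)
  rw [tensorHom_comp_tensorHom_assoc, Category.id_comp] at h
  refine Eq.trans ?_ h.symm
  rw [tensorHom_id, ← Category.assoc (A.one ▷ A.X),
    A.one_opAt₂ _ (LengthMonoid.cut_right_mem hx.1 hy) rfl, Category.assoc]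

theorem incl_padMulFF_right :
    (L.obj (Q.full P) ⊗ 𝟙_ C) ◁ (L.map (Q.incl P) ▷ 𝟙_ C) ≫ A.padMulFF Q =
      (L.obj (Q.full P) ⊗ 𝟙_ C) ◁ (L.obj (Q.pos P) ◁ A.one) ≫ A.padMulFP Q := by
  refine (jointlyEpi_ins L (Q.full P) (𝟙_ C)).tensor (jointlyEpi_ins L (Q.pos P) (𝟙_ C))
    fun x y => ?_
  have hx := val_mem x
  have hy := val_mem y
  rw [tensorHom_comp_whiskerLeft_assoc, tensorHom_comp_whiskerLeft_assoc, ins_whiskerRight,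
    ins_whiskerLeft, lpt_map]
  refine (A.padMulFF_pt hx hy.1).trans ?_
  have h : (𝟙 (𝟙_ C) ⊗ₘ A.one) ≫ _ = (𝟙 (𝟙_ C) ⊗ₘ A.one) ≫ _ := congrArg _ (A.padMulFP_pt hx hy)
  rw [tensorHom_comp_tensorHom_assoc, Category.id_comp] at h
  refine Eq.trans ?_ h.symm
  rw [id_tensorHom, leftUnitor_naturality_assoc, ← Category.assoc A.one,
    one_opAt₁, ← padOne_eq]

theorem incl_padMulPF_right :
    (L.obj (Q.pos P) ⊗ A.X) ◁ (L.map (Q.incl P) ▷ 𝟙_ C) ≫ A.padMulPF Q =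
      (L.obj (Q.pos P) ⊗ A.X) ◁ (L.obj (Q.pos P) ◁ A.one) ≫ A.padMulPP Q := by
  refine (jointlyEpi_ins L (Q.pos P) A.X).tensor (jointlyEpi_ins L (Q.pos P) (𝟙_ C))
    fun x y => ?_
  have hx := val_mem x
  have hy := val_mem y
  rw [tensorHom_comp_whiskerLeft_assoc, tensorHom_comp_whiskerLeft_assoc, ins_whiskerRight,
    ins_whiskerLeft, lpt_map]
  refine (A.padMulPF_pt hx hy.1).trans ?_
  have h : (𝟙 A.X ⊗ₘ A.one) ≫ _ = (𝟙 A.X ⊗ₘ A.one) ≫ _ := congrArg _ (A.padMulPP_pt hx hy)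
  rw [tensorHom_comp_tensorHom_assoc, Category.id_comp] at h
  refine Eq.trans ?_ h.symm
  rw [id_tensorHom, ← Category.assoc (A.X ◁ A.one),
    A.opAt₂_one _ (LengthMonoid.cut_left_mem hx hy.1) rfl, Category.assoc]

/-- Tensoring preserves pushouts in each variable. The product is glued in the left variable for
each of the two pieces on the right, and the results are then glued in the right variable. -/
theorem exists_isPadMul : ∃ m, A.IsPadMul Q m := by
  have hp := A.isPushout_pad Q
  have hl := isPushout_whiskerRight hp (L.obj (Q.full P) ⊗ 𝟙_ C)
  have hr := isPushout_whiskerRight hp (L.obj (Q.pos P) ⊗ A.X)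
  have hm := isPushout_whiskerLeft hp (A.pad Q)
  let mF := hl.desc _ _ (A.incl_padMulFF_left Q)
  let mP := hr.desc _ _ (A.incl_padMulFP_left Q)
  have hF₁ : A.padInl Q ▷ _ ≫ mF = _ := hl.inl_desc _ _ _
  have hF₂ : A.padInr Q ▷ _ ≫ mF = _ := hl.inr_desc _ _ _
  have hP₁ : A.padInl Q ▷ _ ≫ mP = _ := hr.inl_desc _ _ _
  have hP₂ : A.padInr Q ▷ _ ≫ mP = _ := hr.inr_desc _ _ _
  -- Agreement on the overlap in the right variable is checked on the two pieces of the left one.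
  have h : A.pad Q ◁ L.map (Q.incl P) ▷ 𝟙_ C ≫ mF = A.pad Q ◁ L.obj (Q.pos P) ◁ A.one ≫ mP := by
    refine (isPushout_whiskerRight hp (L.obj (Q.pos P) ⊗ 𝟙_ C)).hom_ext ?_ ?_
    · rw [← whisker_exchange_assoc, ← whisker_exchange_assoc, hF₁, hP₁, incl_padMulFF_right]
    · rw [← whisker_exchange_assoc, ← whisker_exchange_assoc, hF₂, hP₂, incl_padMulPF_right]
  have h₁ := hm.inl_desc mF mP h
  have h₂ := hm.inr_desc mF mP h
  refine ⟨hm.desc mF mP h, ?_, ?_, ?_, ?_⟩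
  · rw [MonoidalCategory.tensorHom_def, Category.assoc, h₁, hF₁]
  · rw [MonoidalCategory.tensorHom_def, Category.assoc, h₂, hP₁]
  · rw [MonoidalCategory.tensorHom_def, Category.assoc, h₁, hF₂]
  · rw [MonoidalCategory.tensorHom_def, Category.assoc, h₂, hP₂]

end

end Alg

/-! ### Arithmetic of cut points -/

namespace LengthMonoid

variable {V : Type} [NormedAddCommGroup V] [NormedSpace ℝ V] [FiniteDimensional ℝ V]
  (Q : LengthMonoid V) {a b c : V}

/-- The length formula for `1 * 1` gives `scale 1 * len 1 = 0`, and the scale is positive. -/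
theorem len_one : Q.len Q.one = 0 := by
  have h := Q.len_mul Q.one Q.one
  rw [Q.one_mul, left_eq_add] at h
  exact (mul_eq_zero.1 h).resolve_left (Q.scale_pos Q.one_mem).ne'

theorem len_mul_eq_zero (ha : Q.len a = 0) (hb : Q.len b = 0) : Q.len (Q.mul a b) = 0 := by
  rw [Q.len_mul, ha, hb, mul_zero, add_zero]

theorem cutPoint_mul_of_left (h : Q.len b = 0) :
    Q.cutPoint (Q.mul a b) c = Q.cutPoint a (Q.mul b c) := by
  rw [cutPoint, cutPoint, Q.mul_assoc, Q.len_mul a b, h, mul_zero, add_zero]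

theorem cutPoint_mul_right (h : Q.len c = 0) :
    Q.cutPoint a (Q.mul b c) = Q.cutPoint a b := by
  rw [cutPoint, cutPoint, ← Q.mul_assoc, Q.len_mul (Q.mul a b), h, mul_zero, add_zero]

/-- A left factor of length zero multiplies both lengths by `scale a`, which cancels in the
quotient. -/
theorem cutPoint_mul_left (ha : a ∈ Q.carrier) (h : Q.len a = 0) :
    Q.cutPoint (Q.mul a b) c = Q.cutPoint b c := by
  rw [cutPoint, cutPoint, Q.mul_assoc, Q.len_mul a b, Q.len_mul a, h, zero_add, zero_add,
    mul_div_mul_left _ _ (Q.scale_pos ha).ne']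

/-- The length of `a b` cancels. This locates the first of the two cuts for `a b c`;
`cutPoint_add_mul_cutPoint` locates the second. -/
theorem cutPoint_mul_cutPoint (ha : a ∈ Q.posCarrier) (hb : b ∈ Q.posCarrier) :
    Q.cutPoint (Q.mul a b) c * Q.cutPoint a b = Q.cutPoint a (Q.mul b c) := by
  have h := Q.len_mul_pos ha.1 hb.1 (.inl ha.2)
  rw [cutPoint, cutPoint, cutPoint, Q.mul_assoc]
  field_simp

theorem cutPoint_add_mul_cutPoint (ha : a ∈ Q.posCarrier) (hb : b ∈ Q.posCarrier)
    (hc : c ∈ Q.posCarrier) :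
    Q.cutPoint a (Q.mul b c) + (1 - Q.cutPoint a (Q.mul b c)) * Q.cutPoint b c =
      Q.cutPoint (Q.mul a b) c := by
  have h₁ := Q.len_mul_pos hb.1 hc.1 (.inl hb.2)
  have h₂ := Q.len_mul_pos ha.1 (Q.mul_mem hb.1 hc.1) (.inl ha.2)
  rw [cutPoint, cutPoint, cutPoint, Q.mul_assoc]
  have h₃ := Q.len_mul a b
  have h₄ := Q.len_mul a (Q.mul b c)
  field_simp
  rw [h₃, h₄]
  ring

end LengthMonoid

section MulAux

variable {C : Type u} [Category.{v} C] [MonoidalCategory C] {X Y Z M : C}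

/-- With `mul_assoc_right`, reduces each case of associativity to evaluating `m` twice on either
side. -/
theorem mul_assoc_left (m : M ⊗ M ⟶ M) (f : X ⟶ M) (g : Y ⟶ M) (h : Z ⟶ M) {W : C} {p : X ⊗ Y ⟶ W}
    {k : W ⟶ M} (hk : (f ⊗ₘ g) ≫ m = p ≫ k) :
    ((f ⊗ₘ g) ⊗ₘ h) ≫ m ▷ M ≫ m = p ▷ Z ≫ (k ⊗ₘ h) ≫ m := by
  rw [tensorHom_comp_whiskerRight_assoc, hk, whiskerRight_comp_tensorHom_assoc]

theorem mul_assoc_right (m : M ⊗ M ⟶ M) (f : X ⟶ M) (g : Y ⟶ M) (h : Z ⟶ M) {W : C}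
    {p : Y ⊗ Z ⟶ W} {k : W ⟶ M} (hk : (g ⊗ₘ h) ≫ m = p ≫ k) :
    ((f ⊗ₘ g) ⊗ₘ h) ≫ (α_ M M M).hom ≫ M ◁ m ≫ m =
      (α_ X Y Z).hom ≫ X ◁ p ≫ (f ⊗ₘ k) ≫ m := by
  rw [associator_naturality_assoc, tensorHom_comp_whiskerLeft_assoc, hk,
    whiskerLeft_comp_tensorHom_assoc]

end MulAux

theorem JointlyEpi.prod {C : Type u} [Category.{v} C] [MonoidalCategory C] [SymmetricCategory C]
    [MonoidalClosed C] {ι κ : Type*} {W : ι → C} {T : C} {f : ∀ i, W i ⟶ T}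
    (hf : JointlyEpi f) {V : κ → C} {T' : C} {g : ∀ k, V k ⟶ T'} (hg : JointlyEpi g) :
    JointlyEpi fun i : ι × κ => f i.1 ⊗ₘ g i.2 :=
  fun _ _ _ h => hf.tensor hg fun i k => h (i, k)

/-! ### The monoid laws, checked at points -/

namespace Alg

variable {P : ObjectProperty TopCat.{w}} [ContainsConvex P]
  [CartesianMonoidalCategory P.FullSubcategory] [BraidedCategory P.FullSubcategory]
  {C : Type u} [Category.{v} C] [MonoidalCategory C] [SymmetricCategory C]
  {L : P.FullSubcategory ⥤ C} [L.Braided] [HasCountableColimits C] (A : Alg L)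
  {V : Type} [NormedAddCommGroup V] [NormedSpace ℝ V] [FiniteDimensional ℝ V]
  {Q : LengthMonoid V}

theorem opAt₂_congr {c d : Fin 2 → ℝ × ℝ} (hc : c ∈ littleSet 2) (hd : d ∈ littleSet 2)
    (h : c = d) : A.opAt₂ hc = A.opAt₂ hd := by
  subst h; rfl

section

variable {a b : V} {m : A.pad Q ⊗ A.pad Q ⟶ A.pad Q} (hm : A.IsPadMul Q m)
include hm

theorem IsPadMul.one_one (ha : a ∈ Q.carrier) (hb : b ∈ Q.carrier) :
    (A.padOne Q ha ⊗ₘ A.padOne Q hb) ≫ m = (λ_ (𝟙_ C)).hom ≫ A.padOne Q (Q.mul_mem ha hb) := by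
  rw [padOne, padOne, ← tensorHom_comp_tensorHom, Category.assoc, hm.FF, padMulFF_pt]

theorem IsPadMul.one_at (ha : a ∈ Q.carrier) (h : Q.len a = 0) (hb : b ∈ Q.posCarrier) :
    (A.padOne Q ha ⊗ₘ A.padAt Q hb) ≫ m =
      (λ_ A.X).hom ≫ A.padAt Q (LengthMonoid.mul_mem_pos_right ha hb) := by
  rw [padOne, padAt, ← tensorHom_comp_tensorHom, Category.assoc, hm.FP, padMulFP_pt,
    A.opAt₁_eq_id _ (by rw [LengthMonoid.cutPoint_eq_zero h]), Category.id_comp]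

theorem IsPadMul.at_one (ha : a ∈ Q.posCarrier) (hb : b ∈ Q.carrier) (h : Q.len b = 0) :
    (A.padAt Q ha ⊗ₘ A.padOne Q hb) ≫ m =
      (ρ_ A.X).hom ≫ A.padAt Q (LengthMonoid.mul_mem_pos_left ha hb) := by
  rw [padOne, padAt, ← tensorHom_comp_tensorHom, Category.assoc, hm.PF, padMulPF_pt,
    A.opAt₁_eq_id _ (by rw [LengthMonoid.cutPoint_eq_one ha.2 h]), Category.id_comp]

theorem IsPadMul.at_at (ha : a ∈ Q.posCarrier) (hb : b ∈ Q.posCarrier) :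
    (A.padAt Q ha ⊗ₘ A.padAt Q hb) ≫ m = A.opAt₂ (LengthMonoid.cut_mem ha hb) ≫
      A.padAt Q (LengthMonoid.mul_mem_pos_left ha hb.1) := by
  rw [padAt, padAt, ← tensorHom_comp_tensorHom, Category.assoc, hm.PP, padMulPP_pt]

variable [MonoidalClosed C] [L.IsLeftAdjoint]

theorem IsPadMul.one_mul : A.padOne Q Q.one_mem ▷ A.pad Q ≫ m = (λ_ (A.pad Q)).hom := by
  refine ((A.jointlyEpi_padPt Q).whiskerLeft (𝟙_ C)) _ _ ?_
  have h : ∀ {X : C} (f : X ⟶ A.pad Q),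
      (A.padOne Q Q.one_mem ⊗ₘ f) ≫ m = 𝟙_ C ◁ f ≫ (λ_ (A.pad Q)).hom →
      𝟙_ C ◁ f ≫ A.padOne Q Q.one_mem ▷ A.pad Q ≫ m = 𝟙_ C ◁ f ≫ (λ_ (A.pad Q)).hom := by
    intro X f hf
    rw [← hf, MonoidalCategory.tensorHom_def', Category.assoc]
  rintro (⟨b, hb, h₀⟩ | ⟨b, hb⟩)
  · refine h (A.padOne Q hb) ?_
    rw [hm.one_one, leftUnitor_naturality, A.padOne_congr Q _ hb (Q.one_mul b)]
  · refine h (A.padAt Q hb) ?_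
    rw [hm.one_at _ _ Q.len_one, leftUnitor_naturality, A.padAt_congr Q _ hb (Q.one_mul b)]

theorem IsPadMul.mul_one : A.pad Q ◁ A.padOne Q Q.one_mem ≫ m = (ρ_ (A.pad Q)).hom := by
  refine ((A.jointlyEpi_padPt Q).whiskerRight (𝟙_ C)) _ _ ?_
  have h : ∀ {X : C} (f : X ⟶ A.pad Q),
      (f ⊗ₘ A.padOne Q Q.one_mem) ≫ m = f ▷ 𝟙_ C ≫ (ρ_ (A.pad Q)).hom →
      f ▷ 𝟙_ C ≫ A.pad Q ◁ A.padOne Q Q.one_mem ≫ m = f ▷ 𝟙_ C ≫ (ρ_ (A.pad Q)).hom := by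
    intro X f hf
    rw [← hf, MonoidalCategory.tensorHom_def, Category.assoc]
  rintro (⟨b, hb, h₀⟩ | ⟨b, hb⟩)
  · refine h (A.padOne Q hb) ?_
    rw [hm.one_one, rightUnitor_naturality, A.padOne_congr Q _ hb (Q.mul_one b), unitors_equal]
  · refine h (A.padAt Q hb) ?_
    rw [hm.at_one _ _ _ Q.len_one, rightUnitor_naturality, A.padAt_congr Q _ hb (Q.mul_one b)]

/-- There are eight cases, according to which factors have positive length. If some factor has
length zero, at most one binary cut occurs on each side, the cut points agree, and the rest is
coherence. Only three factors of positive length require associativity of operations. -/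
theorem IsPadMul.mul_assoc :
    m ▷ A.pad Q ≫ m = (α_ (A.pad Q) (A.pad Q) (A.pad Q)).hom ≫ A.pad Q ◁ m ≫ m := by
  have hj := A.jointlyEpi_padPt Q
  refine (hj.prod hj).tensor hj ?_
  rintro ⟨⟨a, ha, ha₀⟩ | ⟨a, ha⟩, ⟨b, hb, hb₀⟩ | ⟨b, hb⟩⟩ (⟨c, hc, hc₀⟩ | ⟨c, hc⟩)
  all_goals dsimp only [padPt, padDom]
  · refine (mul_assoc_left m _ _ _ (hm.one_one A ha hb)).trans
      (Eq.trans ?_ (mul_assoc_right m _ _ _ (hm.one_one A hb hc)).symm)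
    refine (congrArg _ (hm.one_one A _ hc)).trans
      (Eq.trans ?_ (congrArg (_ ≫ _ ≫ ·) (hm.one_one A ha _)).symm)
    rw [A.padOne_congr Q _
      (Q.mul_mem ha (Q.mul_mem hb hc))
      (Q.mul_assoc a b c)]
    monoidal
  · refine (mul_assoc_left m _ _ _ (hm.one_one A ha hb)).trans
      (Eq.trans ?_ (mul_assoc_right m _ _ _ (hm.one_at A hb hb₀ hc)).symm)
    refine (congrArg _ (hm.one_at A _ (Q.len_mul_eq_zero ha₀ hb₀) hc)).trans
      (Eq.trans ?_ (congrArg (_ ≫ _ ≫ ·) (hm.one_at A ha ha₀ _)).symm)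
    rw [A.padAt_congr Q _
      (LengthMonoid.mul_mem_pos_right ha (LengthMonoid.mul_mem_pos_right hb hc))
      (Q.mul_assoc a b c)]
    monoidal
  · refine (mul_assoc_left m _ _ _ (hm.one_at A ha ha₀ hb)).trans
      (Eq.trans ?_ (mul_assoc_right m _ _ _ (hm.at_one A hb hc hc₀)).symm)
    refine (congrArg _ (hm.at_one A _ hc hc₀)).trans
      (Eq.trans ?_ (congrArg (_ ≫ _ ≫ ·) (hm.one_at A ha ha₀ _)).symm)
    rw [A.padAt_congr Q _
      (LengthMonoid.mul_mem_pos_right ha (LengthMonoid.mul_mem_pos_left hb hc))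
      (Q.mul_assoc a b c)]
    monoidal
  · refine (mul_assoc_left m _ _ _ (hm.one_at A ha ha₀ hb)).trans
      (Eq.trans ?_ (mul_assoc_right m _ _ _ (hm.at_at A hb hc)).symm)
    refine (congrArg _ (hm.at_at A _ hc)).trans
      (Eq.trans ?_ (congrArg (_ ≫ _ ≫ ·) (hm.one_at A ha ha₀ _)).symm)
    rw [A.padAt_congr Q _
      (LengthMonoid.mul_mem_pos_right ha (LengthMonoid.mul_mem_pos_left hb hc.1))
      (Q.mul_assoc a b c), A.opAt₂_congr _
      (LengthMonoid.cut_mem hb hc) (by rw [Q.cutPoint_mul_left ha ha₀])]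
    monoidal
  · refine (mul_assoc_left m _ _ _ (hm.at_one A ha hb hb₀)).trans
      (Eq.trans ?_ (mul_assoc_right m _ _ _ (hm.one_one A hb hc)).symm)
    refine (congrArg _ (hm.at_one A _ hc hc₀)).trans
      (Eq.trans ?_ (congrArg (_ ≫ _ ≫ ·) (hm.at_one A ha _ (Q.len_mul_eq_zero hb₀ hc₀))).symm)
    rw [A.padAt_congr Q _
      (LengthMonoid.mul_mem_pos_left ha (Q.mul_mem hb hc))
      (Q.mul_assoc a b c)]
    monoidal
  · refine (mul_assoc_left m _ _ _ (hm.at_one A ha hb hb₀)).trans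
      (Eq.trans ?_ (mul_assoc_right m _ _ _ (hm.one_at A hb hb₀ hc)).symm)
    refine (congrArg _ (hm.at_at A _ hc)).trans
      (Eq.trans ?_ (congrArg (_ ≫ _ ≫ ·) (hm.at_at A ha _)).symm)
    rw [A.padAt_congr Q _
      (LengthMonoid.mul_mem_pos_left ha (Q.mul_mem hb hc.1))
      (Q.mul_assoc a b c), A.opAt₂_congr _
      (LengthMonoid.cut_mem ha (LengthMonoid.mul_mem_pos_right hb hc))
      (by rw [Q.cutPoint_mul_of_left hb₀])]
    monoidal
  · refine (mul_assoc_left m _ _ _ (hm.at_at A ha hb)).trans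
      (Eq.trans ?_ (mul_assoc_right m _ _ _ (hm.at_one A hb hc hc₀)).symm)
    refine (congrArg _ (hm.at_one A _ hc hc₀)).trans
      (Eq.trans ?_ (congrArg (_ ≫ _ ≫ ·) (hm.at_at A ha _)).symm)
    rw [A.padAt_congr Q _
      (LengthMonoid.mul_mem_pos_left ha (Q.mul_mem hb.1 hc)) (Q.mul_assoc a b c), A.opAt₂_congr
      (LengthMonoid.cut_mem ha (LengthMonoid.mul_mem_pos_left hb hc))
      (LengthMonoid.cut_mem ha hb) (by rw [Q.cutPoint_mul_right hc₀])]
    monoidal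
  · refine (mul_assoc_left m _ _ _ (hm.at_at A ha hb)).trans
      (Eq.trans ?_ (mul_assoc_right m _ _ _ (hm.at_at A hb hc)).symm)
    refine (congrArg _ (hm.at_at A _ hc)).trans
      (Eq.trans ?_ (congrArg (_ ≫ _ ≫ ·) (hm.at_at A ha _)).symm)
    rw [A.padAt_congr Q _
      (LengthMonoid.mul_mem_pos_left ha (Q.mul_mem hb.1 hc.1))
      (Q.mul_assoc a b c)]
    -- Bracketed either way, `[0,1]` is cut at `cutPoint a (b c)` and at `cutPoint (a b) c`.
    have h₁ := Q.cutPoint_mul_cutPoint (c := c) ha hb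
    have h₂ := Q.cutPoint_add_mul_cutPoint ha hb hc
    have h := A.opAt₂_assoc
      (LengthMonoid.cut_mem (LengthMonoid.mul_mem_pos_left ha hb.1) hc) (LengthMonoid.cut_mem ha hb)
      (LengthMonoid.cut_mem ha (LengthMonoid.mul_mem_pos_left hb hc.1)) (LengthMonoid.cut_mem hb hc)
      (by simp [rescale, h₁]) (by simp [rescale, h₁, h₂]) (by simp [rescale, h₂])
    have h' := h =≫ A.padAt Q (LengthMonoid.mul_mem_pos_left ha (Q.mul_mem hb.1 hc.1))
    simp only [Category.assoc] at h'
    exact h'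

end

end Alg

/-! ### Naturality of `pad` -/

section LengthMap

variable {V W : Type} [NormedAddCommGroup V] [NormedSpace ℝ V] [FiniteDimensional ℝ V]
  [NormedAddCommGroup W] [NormedSpace ℝ W] [FiniteDimensional ℝ W]

/-- A continuous map that preserves the elements of positive length. -/
structure PosMap (Q : LengthMonoid V) (Q' : LengthMonoid W) where
  toFun : V → W
  continuousOn : ContinuousOn toFun Q.carrier
  mem : ∀ a ∈ Q.carrier, toFun a ∈ Q'.carrier
  mem_pos : ∀ a ∈ Q.posCarrier, toFun a ∈ Q'.posCarrier

/-- A map is a homomorphism if it preserves products, the unit and the length. -/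
structure PosMap.IsHom {Q : LengthMonoid V} {Q' : LengthMonoid W} (h : PosMap Q Q') : Prop where
  one : h.toFun Q.one = Q'.one
  mul : ∀ a ∈ Q.carrier, ∀ b ∈ Q.carrier, h.toFun (Q.mul a b) = Q'.mul (h.toFun a) (h.toFun b)
  len : ∀ a ∈ Q.carrier, Q'.len (h.toFun a) = Q.len a

theorem PosMap.IsHom.cutPoint {Q : LengthMonoid V} {Q' : LengthMonoid W} {h : PosMap Q Q'}
    (hh : h.IsHom) {a b : V} (ha : a ∈ Q.carrier) (hb : b ∈ Q.carrier) :
    Q'.cutPoint (h.toFun a) (h.toFun b) = Q.cutPoint a b := by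
  rw [LengthMonoid.cutPoint, LengthMonoid.cutPoint, ← hh.mul a ha b hb, hh.len a ha,
    hh.len _ (Q.mul_mem ha hb)]

/-- The identity map. -/
def PosMap.id (Q : LengthMonoid V) : PosMap Q Q :=
  ⟨fun a => a, continuousOn_id, fun _ h => h, fun _ h => h⟩

/-- The composition of two maps. -/
def PosMap.comp {Q : LengthMonoid V} {Q' : LengthMonoid W} {U : Type} [NormedAddCommGroup U]
    [NormedSpace ℝ U] [FiniteDimensional ℝ U] {Q'' : LengthMonoid U} (h : PosMap Q Q')
    (k : PosMap Q' Q'') : PosMap Q Q'' :=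
  ⟨fun a => k.toFun (h.toFun a), k.continuousOn.comp h.continuousOn h.mem,
    fun _ ha => k.mem _ (h.mem _ ha), fun _ ha => k.mem_pos _ (h.mem_pos _ ha)⟩

/-- A constant map. -/
def PosMap.const (Q : LengthMonoid V) {Q' : LengthMonoid W} {b : W} (hb : b ∈ Q'.posCarrier) :
    PosMap Q Q' :=
  ⟨fun _ => b, continuousOn_const, fun _ _ => hb.1, fun _ _ => hb⟩

variable (P : ObjectProperty TopCat.{w}) [ContainsConvex P] {Q : LengthMonoid V}
  {Q' : LengthMonoid W} (h : PosMap Q Q')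

def PosMap.full : Q.full P ⟶ Q'.full P := map₁ Q.convex Q'.convex h.toFun h.continuousOn h.mem

def PosMap.pos : Q.pos P ⟶ Q'.pos P :=
  map₁ Q.convex_posCarrier Q'.convex_posCarrier h.toFun (h.continuousOn.mono fun _ h => h.1)
    h.mem_pos

end LengthMap

namespace Alg

variable {P : ObjectProperty TopCat.{w}} [ContainsConvex P]
  [CartesianMonoidalCategory P.FullSubcategory] [BraidedCategory P.FullSubcategory]
  {C : Type u} [Category.{v} C] [MonoidalCategory C] [SymmetricCategory C]
  {L : P.FullSubcategory ⥤ C} [L.Braided] [HasCountableColimits C] (A : Alg L)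
  {V W : Type} [NormedAddCommGroup V] [NormedSpace ℝ V] [FiniteDimensional ℝ V]
  [NormedAddCommGroup W] [NormedSpace ℝ W] [FiniteDimensional ℝ W]

/-- The map of pushouts induced by a map that preserves the elements of positive length. -/
def padChange {Q : LengthMonoid V} {Q' : LengthMonoid W} (h : PosMap Q Q') : A.pad Q ⟶ A.pad Q' :=
  pushout.desc (L.map (h.full P) ▷ 𝟙_ C ≫ A.padInl Q') (L.map (h.pos P) ▷ A.X ≫ A.padInr Q') (by
    have e : Q.incl P ≫ h.full P = h.pos P ≫ Q'.incl P := rfl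
    rw [whisker_exchange_assoc, ← pad_condition, ← Category.assoc, ← Category.assoc,
      ← comp_whiskerRight, ← comp_whiskerRight, ← L.map_comp, ← L.map_comp, e])

section

variable {Q : LengthMonoid V} {Q' : LengthMonoid W} (h : PosMap Q Q')

theorem padInl_change : A.padInl Q ≫ A.padChange h = L.map (h.full P) ▷ 𝟙_ C ≫ A.padInl Q' :=
  pushout.inl_desc _ _ _

theorem padInr_change : A.padInr Q ≫ A.padChange h = L.map (h.pos P) ▷ A.X ≫ A.padInr Q' :=
  pushout.inr_desc _ _ _

theorem padOne_change {a : V} (ha : a ∈ Q.carrier) :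
    A.padOne Q ha ≫ A.padChange h = A.padOne Q' (h.mem a ha) := by
  rw [padOne, Category.assoc, padInl_change, ← Category.assoc, ins_whiskerRight, lpt_map]
  rfl

theorem padAt_change {a : V} (ha : a ∈ Q.posCarrier) :
    A.padAt Q ha ≫ A.padChange h = A.padAt Q' (h.mem_pos a ha) := by
  rw [padAt, Category.assoc, padInr_change, ← Category.assoc, ins_whiskerRight, lpt_map]
  rfl

end

theorem padOne_map {A B : Alg L} (φ : A ⟶ B) {Q : LengthMonoid V} {a : V} (ha : a ∈ Q.carrier) :
    A.padOne Q ha ≫ padMap Q φ = B.padOne Q ha := by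
  rw [padOne, Category.assoc, padInl_map, padOne]

theorem padAt_map {A B : Alg L} (φ : A ⟶ B) {Q : LengthMonoid V} {a : V} (ha : a ∈ Q.posCarrier) :
    A.padAt Q ha ≫ padMap Q φ = φ.hom ≫ B.padAt Q ha := by
  rw [padAt, Category.assoc, padInr_map, ← Category.assoc, ins_whiskerLeft, padAt, Category.assoc]

variable [MonoidalClosed C] [L.IsLeftAdjoint]

theorem padChange_naturality {A B : Alg L} (φ : A ⟶ B) {Q : LengthMonoid V} {Q' : LengthMonoid W}
    (h : PosMap Q Q') : padMap Q φ ≫ B.padChange h = A.padChange h ≫ padMap Q' φ := by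
  refine A.pad_hom_ext_pt Q (fun a ha _ => ?_) fun a ha => ?_
  · rw [← Category.assoc, ← Category.assoc, padOne_map, padOne_change, padOne_change, padOne_map]
  · rw [← Category.assoc, ← Category.assoc, padAt_map, padAt_change, Category.assoc,
      padAt_change, padAt_map]

variable {Q : LengthMonoid V} {Q' : LengthMonoid W}

/-- Covers both naturality in `A` (with `h` the identity) and change of the length monoid (with `φ`
the identity). Preservation of lengths by `h` matches the elements of length zero and the cut
points. -/
theorem padMul_hom_ext {m : A.pad Q ⊗ A.pad Q ⟶ A.pad Q} (hm : A.IsPadMul Q m)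
    {B : Alg L} {m' : B.pad Q' ⊗ B.pad Q' ⟶ B.pad Q'} (hm' : B.IsPadMul Q' m')
    {h : PosMap Q Q'} (hh : h.IsHom) (φ : A ⟶ B) (f : A.pad Q ⟶ B.pad Q')
    (hone : ∀ a (ha : a ∈ Q.carrier), A.padOne Q ha ≫ f = B.padOne Q' (h.mem a ha))
    (hat : ∀ a (ha : a ∈ Q.posCarrier),
      A.padAt Q ha ≫ f = φ.hom ≫ B.padAt Q' (h.mem_pos a ha)) :
    m ≫ f = (f ⊗ₘ f) ≫ m' := by
  have hj := A.jointlyEpi_padPt Q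
  refine hj.tensor hj ?_
  rintro (⟨a, ha, ha₀⟩ | ⟨a, ha⟩) (⟨b, hb, hb₀⟩ | ⟨b, hb⟩)
  all_goals
    dsimp only [padPt, padDom]
    rw [tensorHom_comp_tensorHom_assoc, ← Category.assoc]
  · rw [hm.one_one A, hone, hone, Category.assoc, hone, hm'.one_one,
      B.padOne_congr Q' _ _ (hh.mul a ha b hb)]
  · rw [hm.one_at A ha ha₀ hb, hone, hat, Category.assoc, hat,
      ← whiskerLeft_comp_tensorHom_assoc, hm'.one_at B _ ((hh.len a ha).trans ha₀),
      leftUnitor_naturality_assoc, B.padAt_congr Q' _ _ (hh.mul a ha b hb.1)]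
  · rw [hm.at_one A ha hb hb₀, hone, hat, Category.assoc, hat,
      ← whiskerRight_comp_tensorHom_assoc, hm'.at_one B _ _ ((hh.len b hb).trans hb₀),
      rightUnitor_naturality_assoc, B.padAt_congr Q' _ _ (hh.mul a ha.1 b hb)]
  · rw [hm.at_at A ha hb, hat, hat, Category.assoc, hat, ← Category.assoc, opAt₂_hom,
      ← tensorHom_comp_tensorHom, Category.assoc, Category.assoc, hm'.at_at,
      B.padAt_congr Q' _ _ (hh.mul a ha.1 b hb.1),
      B.opAt₂_congr (LengthMonoid.cut_mem (h.mem_pos a ha) (h.mem_pos b hb))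
        (LengthMonoid.cut_mem ha hb) (by rw [hh.cutPoint ha.1 hb.1])]

variable (Q)

/-- The monoid structure on `A.pad Q`. -/
@[reducible] def padMon : MonObj (A.pad Q) where
  one := A.padOne Q Q.one_mem
  mul := (A.exists_isPadMul Q).choose
  one_mul := (A.exists_isPadMul Q).choose_spec.one_mul
  mul_one := (A.exists_isPadMul Q).choose_spec.mul_one
  mul_assoc := (A.exists_isPadMul Q).choose_spec.mul_assoc

theorem isPadMul_padMon : A.IsPadMul Q (A.padMon Q).mul := (A.exists_isPadMul Q).choose_spec

theorem padOne_one_eq : A.padOne Q Q.one_mem =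
    Functor.LaxMonoidal.ε L ≫ L.map (Q.onePt P) ≫ (ρ_ _).inv ≫ A.padInl Q := by
  rw [padOne, ins_unit, eq_pt (Q.onePt P), lpt, Category.assoc, Category.assoc]
  rfl

theorem isPadMonoid_padMon : A.IsPadMonoid Q (A.padMon Q) where
  one_eq := A.padOne_one_eq Q
  mul_FF := (A.isPadMul_padMon Q).FF
  mul_FP := (A.isPadMul_padMon Q).FP
  mul_PF := (A.isPadMul_padMon Q).PF
  mul_PP := (A.isPadMul_padMon Q).PP

variable {Q}

theorem isMonHom_of_pt {B : Alg L} {h : PosMap Q Q'} (hh : h.IsHom) (φ : A ⟶ B)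
    (f : A.pad Q ⟶ B.pad Q')
    (hone : ∀ a (ha : a ∈ Q.carrier), A.padOne Q ha ≫ f = B.padOne Q' (h.mem a ha))
    (hat : ∀ a (ha : a ∈ Q.posCarrier),
      A.padAt Q ha ≫ f = φ.hom ≫ B.padAt Q' (h.mem_pos a ha)) :
    letI := A.padMon Q; letI := B.padMon Q'; IsMonHom f :=
  letI := A.padMon Q
  letI := B.padMon Q'
  { one_hom := (hone _ Q.one_mem).trans (B.padOne_congr Q' _ _ hh.one)
    mul_hom := A.padMul_hom_ext (A.isPadMul_padMon Q) (B.isPadMul_padMon Q') hh φ f hone hat }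

theorem isMonHom_padChange {h : PosMap Q Q'} (hh : h.IsHom) :
    letI := A.padMon Q; letI := A.padMon Q'; IsMonHom (A.padChange h) :=
  A.isMonHom_of_pt hh (𝟙 A) _ (fun _ ha => A.padOne_change h ha) fun _ ha =>
    (A.padAt_change h ha).trans (Category.id_comp _).symm

theorem isMonHom_padMap {A B : Alg L} (φ : A ⟶ B) :
    letI := A.padMon Q; letI := B.padMon Q; IsMonHom (padMap Q φ) :=
  A.isMonHom_of_pt (h := PosMap.id Q) ⟨rfl, fun _ _ _ _ => rfl, fun _ _ => rfl⟩ φ _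
    (fun _ ha => padOne_map φ ha) fun _ ha => padAt_map φ ha

end Alg

section

variable {P : ObjectProperty TopCat.{w}} [ContainsConvex P]
  [CartesianMonoidalCategory P.FullSubcategory] [BraidedCategory P.FullSubcategory]
  {C : Type u} [Category.{v} C] [MonoidalCategory C] [SymmetricCategory C]
  (L : P.FullSubcategory ⥤ C) [L.Braided] [HasCountableColimits C]
  {V : Type} [NormedAddCommGroup V] [NormedSpace ℝ V] [FiniteDimensional ℝ V]
  (Q : LengthMonoid V) [MonoidalClosed C] [L.IsLeftAdjoint]

/-- The monoid structures on `A.pad Q` for all algebras `A`. -/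
def padLift : MonoidLift (Alg.padFunctor Q L) where
  mon A := A.padMon Q
  map_hom φ := Alg.isMonHom_padMap φ

end

/-! ### Homotopies -/

section Cylinder

variable {P : ObjectProperty TopCat.{w}} [ContainsConvex P]
  [CartesianMonoidalCategory P.FullSubcategory]

/-- The point of the unit interval given by a number. -/
def intervalPt (P : ObjectProperty TopCat.{w}) [ContainsConvex P] {t : ℝ}
    (ht : t ∈ Set.Icc (0 : ℝ) 1) : (interval P).obj := ofMem (convex_Icc 0 1) ht

section

variable {V U : Type} [NormedAddCommGroup V] [NormedSpace ℝ V] [FiniteDimensional ℝ V]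
  [NormedAddCommGroup U] [NormedSpace ℝ U] [FiniteDimensional ℝ U] {s : Set V} {u : Set U}

theorem ofMem_congr (hs : Convex ℝ s) {x y : V} (hx : x ∈ s) (hy : y ∈ s) (h : x = y) :
    ofMem (P := P) hs hx = ofMem hs hy := by
  subst h; rfl

theorem segment_mem (hu : Convex ℝ u) {x y : U} (hx : x ∈ u) (hy : y ∈ u) {t : ℝ}
    (ht : t ∈ Set.Icc (0 : ℝ) 1) : (1 - t) • x + t • y ∈ u :=
  hu hx hy (sub_nonneg.2 ht.2) ht.1 (sub_add_cancel 1 t)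

/-- The linear homotopy between two maps into a convex set. -/
def linearHomotopy (hs : Convex ℝ s) (hu : Convex ℝ u) {f g : V → U} (hf : ContinuousOn f s)
    (hg : ContinuousOn g s) (hfu : ∀ x ∈ s, f x ∈ u) (hgu : ∀ x ∈ s, g x ∈ u) :
    space P s hs ⊗ interval P ⟶ space P u hu :=
  map₂ hs (convex_Icc 0 1) hu (fun x t => (1 - t) • f x + t • g x)
    (((continuous_const.sub continuous_snd).continuousOn.smul
      (hf.comp continuousOn_fst fun _ h => h.1)).add
      (continuousOn_snd.smul (hg.comp continuousOn_fst fun _ h => h.1)))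
    fun x hx _ ht => segment_mem hu (hfu x hx) (hgu x hx) ht

theorem linearHomotopy_pair (hs : Convex ℝ s) (hu : Convex ℝ u) {f g : V → U}
    (hf : ContinuousOn f s) (hg : ContinuousOn g s) (hfu : ∀ x ∈ s, f x ∈ u)
    (hgu : ∀ x ∈ s, g x ∈ u) {x : V} (hx : x ∈ s) {t : ℝ} (ht : t ∈ Set.Icc (0 : ℝ) 1) :
    (linearHomotopy (P := P) hs hu hf hg hfu hgu).hom (pair (ofMem hs hx) (intervalPt P ht)) =
      ofMem hu (segment_mem hu (hfu x hx) (hgu x hx) ht) :=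
  map₂_pair _ _ _ _ _ _ hx ht

end

variable {C : Type u} [Category.{v} C] [MonoidalCategory C] [SymmetricCategory C]
  (L : P.FullSubcategory ⥤ C)

section

variable [L.Monoidal]

/-- The homotopy `(L X ⊗ W) ⊗ L[0,1] ⟶ L Y ⊗ W` induced by a homotopy `X × [0,1] ⟶ Y`. -/
def mapHomotopy {X Y : P.FullSubcategory} (F : X ⊗ interval P ⟶ Y) (W : C) :
    (L.obj X ⊗ W) ⊗ L.obj (interval P) ⟶ L.obj Y ⊗ W :=
  (α_ _ _ _).hom ≫ L.obj X ◁ (β_ W (L.obj (interval P))).hom ≫ (α_ _ _ _).inv ≫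
    (Functor.LaxMonoidal.μ L _ _ ≫ L.map F) ▷ W

theorem ins_mapHomotopy {X Y : P.FullSubcategory} (F : X ⊗ interval P ⟶ Y) (W : C) (x : X.obj)
    (t : (interval P).obj) :
    (ins (lpt L x) W ⊗ₘ lpt L t) ≫ mapHomotopy L F W =
      (ρ_ W).hom ≫ ins (lpt L (F.hom (pair x t))) W := by
  have h₁ : (ins (lpt L x) W ⊗ₘ lpt L t) ≫ (α_ (L.obj X) W (L.obj (interval P))).hom =
      (W ◁ lpt L t) ≫ ins (lpt L x) (W ⊗ L.obj (interval P)) := by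
    rw [ins, ins, MonoidalCategory.tensorHom_def', Category.assoc, comp_whiskerRight,
      Category.assoc, associator_naturality_left, leftUnitor_inv_whiskerRight, Category.assoc,
      Iso.inv_hom_id_assoc]
  have h₂ : W ◁ lpt L t ≫ (β_ W (L.obj (interval P))).hom = (ρ_ W).hom ≫ ins (lpt L t) W := by
    rw [BraidedCategory.braiding_naturality_right, ins, ← Category.assoc (ρ_ W).hom,
      ← braiding_leftUnitor]
    simp
  have h₃ := lpt_μ L x t =≫ L.map F
  rw [lpt_map] at h₃
  simp only [Category.assoc] at h₃
  rw [mapHomotopy, ← Category.assoc, h₁, Category.assoc, ← Category.assoc (ins _ _),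
    ins_whiskerLeft, Category.assoc, ← Category.assoc, h₂, Category.assoc,
    ← Category.assoc (ins _ _) (α_ _ _ _).inv, ← Category.assoc (ins (lpt L t) W),
    ins_associator_inv, ins_whiskerRight, Category.assoc, h₃]

end

variable [BraidedCategory P.FullSubcategory] [L.Braided]

theorem lpt_collapse {X : P.FullSubcategory} (x : X.obj) : lpt L x ≫ collapse L X = 𝟙 (𝟙_ C) :=
  lpt_toUnit L x

theorem cylinderAt_eq (X : C) {t : ℝ} (ht : t ∈ Set.Icc (0 : ℝ) 1) :
    cylinderAt L X t ht = (ρ_ X).inv ≫ X ◁ lpt L (intervalPt P ht) := by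
  rw [cylinderAt, eq_pt (intervalPoint t ht), lpt]
  rfl

theorem comp_cylinderAt {X Y : C} (f : X ⟶ Y) {t : ℝ} (ht : t ∈ Set.Icc (0 : ℝ) 1) :
    f ≫ cylinderAt L Y t ht = (ρ_ X).inv ≫ (f ⊗ₘ lpt L (intervalPt P ht)) := by
  rw [cylinderAt_eq, MonoidalCategory.tensorHom_def, rightUnitor_inv_naturality_assoc]

theorem Homotopic.refl {X Y : C} (f : X ⟶ Y) : Homotopic L f f := by
  have h : ∀ t (ht : t ∈ Set.Icc (0 : ℝ) 1),
      cylinderAt L X t ht ≫ X ◁ collapse L (interval P) ≫ (ρ_ X).hom ≫ f = f := by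
    intro t ht
    rw [cylinderAt_eq, Category.assoc, ← MonoidalCategory.whiskerLeft_comp_assoc, lpt_collapse,
      MonoidalCategory.whiskerLeft_id, Category.id_comp, Iso.inv_hom_id_assoc]
  exact ⟨_, h _ _, h _ _⟩

variable {L} in
theorem Homotopic.of_eq {X Y : C} {f g : X ⟶ Y} (h : f = g) : Homotopic L f g :=
  h ▸ Homotopic.refl L f

end Cylinder

namespace Alg

variable {P : ObjectProperty TopCat.{w}} [ContainsConvex P]
  [CartesianMonoidalCategory P.FullSubcategory] [BraidedCategory P.FullSubcategory]
  {C : Type u} [Category.{v} C] [MonoidalCategory C] [SymmetricCategory C]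
  {L : P.FullSubcategory ⥤ C} [L.Braided] [HasCountableColimits C] (A : Alg L)
  {V W : Type} [NormedAddCommGroup V] [NormedSpace ℝ V] [FiniteDimensional ℝ V]
  [NormedAddCommGroup W] [NormedSpace ℝ W] [FiniteDimensional ℝ W]
  [MonoidalClosed C] [L.IsLeftAdjoint]

/-- Straight-line homotopies on the two parts, glued by means of `hk`. They run in auxiliary convex
sets `u₁` and `u₂`, followed by `k₁` and `k₂`, because the homotopy for `UA ⟶ A` passes through
pairs of intervals that are not of the form `([0, x], [x, y])`. -/
theorem pad_homotopic (Q : LengthMonoid V) {Z : C} {f g : A.pad Q ⟶ Z}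
    {U₁ U₂ : Type} [NormedAddCommGroup U₁] [NormedSpace ℝ U₁] [FiniteDimensional ℝ U₁]
    [NormedAddCommGroup U₂] [NormedSpace ℝ U₂] [FiniteDimensional ℝ U₂]
    {u₁ : Set U₁} (hu₁ : Convex ℝ u₁) {f₁ g₁ : V → U₁} (hf₁ : ContinuousOn f₁ Q.carrier)
    (hg₁ : ContinuousOn g₁ Q.carrier) (hfu₁ : ∀ a ∈ Q.carrier, f₁ a ∈ u₁)
    (hgu₁ : ∀ a ∈ Q.carrier, g₁ a ∈ u₁) (k₁ : L.obj (space P u₁ hu₁) ⊗ 𝟙_ C ⟶ Z)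
    {u₂ : Set U₂} (hu₂ : Convex ℝ u₂) {f₂ g₂ : V → U₂} (hf₂ : ContinuousOn f₂ Q.posCarrier)
    (hg₂ : ContinuousOn g₂ Q.posCarrier) (hfu₂ : ∀ a ∈ Q.posCarrier, f₂ a ∈ u₂)
    (hgu₂ : ∀ a ∈ Q.posCarrier, g₂ a ∈ u₂) (k₂ : L.obj (space P u₂ hu₂) ⊗ A.X ⟶ Z)
    (hk : ∀ a (_ : a ∈ Q.posCarrier) t (_ : t ∈ Set.Icc (0 : ℝ) 1)
      (h₁ : (1 - t) • f₁ a + t • g₁ a ∈ u₁) (h₂ : (1 - t) • f₂ a + t • g₂ a ∈ u₂),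
      ins (lpt L (ofMem hu₁ h₁)) (𝟙_ C) ≫ k₁ = A.one ≫ ins (lpt L (ofMem hu₂ h₂)) A.X ≫ k₂)
    (hf : ∀ a (ha : a ∈ Q.carrier),
      A.padOne Q ha ≫ f = ins (lpt L (ofMem hu₁ (hfu₁ a ha))) (𝟙_ C) ≫ k₁)
    (hf' : ∀ a (ha : a ∈ Q.posCarrier),
      A.padAt Q ha ≫ f = ins (lpt L (ofMem hu₂ (hfu₂ a ha))) A.X ≫ k₂)
    (hg : ∀ a (ha : a ∈ Q.carrier),
      A.padOne Q ha ≫ g = ins (lpt L (ofMem hu₁ (hgu₁ a ha))) (𝟙_ C) ≫ k₁)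
    (hg' : ∀ a (ha : a ∈ Q.posCarrier),
      A.padAt Q ha ≫ g = ins (lpt L (ofMem hu₂ (hgu₂ a ha))) A.X ≫ k₂) :
    Homotopic L f g := by
  let F₁ : Q.full P ⊗ interval P ⟶ space P u₁ hu₁ :=
    linearHomotopy Q.convex hu₁ hf₁ hg₁ hfu₁ hgu₁
  let F₂ : Q.pos P ⊗ interval P ⟶ space P u₂ hu₂ :=
    linearHomotopy Q.convex_posCarrier hu₂ hf₂ hg₂ hfu₂ hgu₂
  have e₁ : ∀ {a} (ha : a ∈ Q.carrier) {t} (ht : t ∈ Set.Icc (0 : ℝ) 1),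
      (ins (lpt L (Q.fullPt P ha)) (𝟙_ C) ⊗ₘ lpt L (intervalPt P ht)) ≫
        mapHomotopy L F₁ (𝟙_ C) ≫ k₁ = (ρ_ _).hom ≫ ins (lpt L (ofMem hu₁
          (segment_mem hu₁ (hfu₁ a ha) (hgu₁ a ha) ht))) (𝟙_ C) ≫ k₁ := by
    intro a ha t ht
    have h : F₁.hom (pair (Q.fullPt P ha) (intervalPt P ht)) = _ :=
      linearHomotopy_pair Q.convex hu₁ hf₁ hg₁ hfu₁ hgu₁ ha ht
    rw [← Category.assoc, ins_mapHomotopy, h, Category.assoc]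
  have e₂ : ∀ {a} (ha : a ∈ Q.posCarrier) {t} (ht : t ∈ Set.Icc (0 : ℝ) 1),
      (ins (lpt L (Q.posPt P ha)) A.X ⊗ₘ lpt L (intervalPt P ht)) ≫
        mapHomotopy L F₂ A.X ≫ k₂ = (ρ_ _).hom ≫ ins (lpt L (ofMem hu₂
          (segment_mem hu₂ (hfu₂ a ha) (hgu₂ a ha) ht))) A.X ≫ k₂ := by
    intro a ha t ht
    have h : F₂.hom (pair (Q.posPt P ha) (intervalPt P ht)) = _ :=
      linearHomotopy_pair Q.convex_posCarrier hu₂ hf₂ hg₂ hfu₂ hgu₂ ha ht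
    rw [← Category.assoc, ins_mapHomotopy, h, Category.assoc]
  -- The two homotopies agree on the overlap at every time `t`, not only at the end points.
  have hc : (L.map (Q.incl P) ▷ 𝟙_ C) ▷ L.obj (interval P) ≫ mapHomotopy L F₁ (𝟙_ C) ≫ k₁ =
      (L.obj (Q.pos P) ◁ A.one) ▷ L.obj (interval P) ≫ mapHomotopy L F₂ A.X ≫ k₂ := by
    refine (jointlyEpi_ins L (Q.pos P) (𝟙_ C)).tensor (jointlyEpi_lpt L (interval P)) fun x t => ?_
    have hx := val_mem x
    have ht := val_mem t
    rw [tensorHom_comp_whiskerRight_assoc, tensorHom_comp_whiskerRight_assoc, ins_whiskerRight,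
      ins_whiskerLeft, lpt_map, ← whiskerRight_comp_tensorHom_assoc]
    refine (e₁ hx.1 ht).trans (Eq.trans ?_ (congrArg (_ ≫ ·) (e₂ hx ht)).symm)
    rw [rightUnitor_naturality_assoc, hk _ hx _ ht]
  -- The cylinder of a pushout is the pushout of the cylinders, so the glued map is a homotopy.
  have hp := isPushout_whiskerRight (A.isPushout_pad Q) (L.obj (interval P))
  have hl := hp.inl_desc _ _ hc
  have hr := hp.inr_desc _ _ hc
  have d₁ : ∀ {a} (ha : a ∈ Q.carrier) {t} (ht : t ∈ Set.Icc (0 : ℝ) 1),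
      A.padOne Q ha ≫ cylinderAt L (A.pad Q) t ht ≫ hp.desc _ _ hc = ins (lpt L (ofMem hu₁
          (segment_mem hu₁ (hfu₁ a ha) (hgu₁ a ha) ht))) (𝟙_ C) ≫ k₁ := by
    intro a ha t ht
    rw [← Category.assoc, comp_cylinderAt, padOne, ← tensorHom_comp_whiskerRight, Category.assoc,
      Category.assoc, hl, e₁ ha ht, Iso.inv_hom_id_assoc]
  have d₂ : ∀ {a} (ha : a ∈ Q.posCarrier) {t} (ht : t ∈ Set.Icc (0 : ℝ) 1),
      A.padAt Q ha ≫ cylinderAt L (A.pad Q) t ht ≫ hp.desc _ _ hc = ins (lpt L (ofMem hu₂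
          (segment_mem hu₂ (hfu₂ a ha) (hgu₂ a ha) ht))) A.X ≫ k₂ := by
    intro a ha t ht
    rw [← Category.assoc, comp_cylinderAt, padAt, ← tensorHom_comp_whiskerRight, Category.assoc,
      Category.assoc, hr, e₂ ha ht, Iso.inv_hom_id_assoc]
  refine ⟨hp.desc _ _ hc, ?_, ?_⟩
  · refine A.pad_hom_ext_pt Q (fun a ha _ => ?_) fun a ha => ?_
    · rw [d₁, hf, ofMem_congr _ _ (hfu₁ a ha) (by simp)]
    · rw [d₂, hf', ofMem_congr _ _ (hfu₂ a ha) (by simp)]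
  · refine A.pad_hom_ext_pt Q (fun a ha _ => ?_) fun a ha => ?_
    · rw [d₁, hg, ofMem_congr _ _ (hgu₁ a ha) (by simp)]
    · rw [d₂, hg', ofMem_congr _ _ (hgu₂ a ha) (by simp)]

/-- Convexity of the target and of its subset of positive length is all that is used; neither
products nor lengths need be preserved. -/
theorem padChange_homotopic {Q : LengthMonoid V} {Q' : LengthMonoid W} (h h' : PosMap Q Q') :
    Homotopic L (A.padChange h) (A.padChange h') :=
  A.pad_homotopic Q Q'.convex h.continuousOn h'.continuousOn h.mem h'.mem (A.padInl Q')
    Q'.convex_posCarrier (h.continuousOn.mono fun _ h => h.1) (h'.continuousOn.mono fun _ h => h.1)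
    h.mem_pos h'.mem_pos (A.padInr Q') (fun _ _ _ _ _ h₂ => A.padOne_eq Q' h₂)
    (fun _ ha => A.padOne_change h ha) (fun _ ha => A.padAt_change h ha)
    (fun _ ha => A.padOne_change h' ha) (fun _ ha => A.padAt_change h' ha)

theorem padChange_id {Q : LengthMonoid V} (h : PosMap Q Q) (hh : ∀ a ∈ Q.carrier, h.toFun a = a) :
    A.padChange h = 𝟙 (A.pad Q) := by
  refine A.pad_hom_ext_pt Q (fun a ha _ => ?_) fun a ha => ?_
  · rw [padOne_change, Category.comp_id, A.padOne_congr Q _ ha (hh a ha)]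
  · rw [padAt_change, Category.comp_id, A.padAt_congr Q _ ha (hh a ha.1)]

theorem padChange_comp {Q : LengthMonoid V} {Q' : LengthMonoid W} {U : Type}
    [NormedAddCommGroup U] [NormedSpace ℝ U] [FiniteDimensional ℝ U] {Q'' : LengthMonoid U}
    (h : PosMap Q Q') (k : PosMap Q' Q'') :
    A.padChange h ≫ A.padChange k = A.padChange (h.comp k) := by
  refine A.pad_hom_ext_pt Q (fun a ha _ => ?_) fun a ha => ?_
  · rw [← Category.assoc, padOne_change, padOne_change, padOne_change]
    rfl
  · rw [← Category.assoc, padAt_change, padAt_change, padAt_change]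
    rfl

theorem padChange_homotopic_id {Q : LengthMonoid V} (h : PosMap Q Q) :
    Homotopic L (A.padChange h) (𝟙 (A.pad Q)) := by
  rw [← A.padChange_id (PosMap.id Q) fun _ _ => rfl]
  exact A.padChange_homotopic h _

/-- The map `k` need not be related to `h`: every self-map in the sense of `PosMap` induces a map
homotopic to the identity. -/
theorem padChange_homotopyEquivalence {Q : LengthMonoid V} {Q' : LengthMonoid W} (h : PosMap Q Q')
    (k : PosMap Q' Q) : IsHomotopyEquivalence L (A.padChange h) := by
  refine ⟨A.padChange k, ?_, ?_⟩
  · rw [padChange_comp]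
    exact A.padChange_homotopic_id _
  · rw [padChange_comp]
    exact A.padChange_homotopic_id _

omit [MonoidalClosed C] [L.IsLeftAdjoint] in
theorem padOne_toAlg {Q : LengthMonoid V} {a : V} (ha : a ∈ Q.carrier) :
    A.padOne Q ha ≫ A.padToAlg Q = A.one := by
  rw [padOne, Category.assoc, padInl, padToAlg, pushout.inl_desc, ← Category.assoc, ins_tensorHom,
    lpt_collapse, ins_id, Category.assoc, Iso.inv_hom_id, Category.comp_id]

omit [MonoidalClosed C] [L.IsLeftAdjoint] in
theorem padAt_toAlg {Q : LengthMonoid V} {a : V} (ha : a ∈ Q.posCarrier) :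
    A.padAt Q ha ≫ A.padToAlg Q = 𝟙 A.X := by
  rw [padAt, Category.assoc, padInr, padToAlg, pushout.inr_desc, ← Category.assoc,
    ins_whiskerRight, lpt_collapse, ins_id, Iso.inv_hom_id]

/-- Going to `A` and back at the element `a` is the map induced by the constant map with value `a`.
-/
theorem padToAlg_homotopyEquivalence {Q : LengthMonoid V} {a : V} (ha : a ∈ Q.posCarrier) :
    IsHomotopyEquivalence L (A.padToAlg Q) := by
  refine ⟨A.padAt Q ha, ?_, Homotopic.of_eq (A.padAt_toAlg ha)⟩
  have h : A.padToAlg Q ≫ A.padAt Q ha = A.padChange (PosMap.const Q ha) := by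
    refine A.pad_hom_ext_pt Q (fun b hb _ => ?_) fun b hb => ?_
    · rw [← Category.assoc, padOne_toAlg, padOne_change, ← padOne_eq]
      rfl
    · rw [← Category.assoc, padAt_toAlg, padAt_change, Category.id_comp]
      rfl
  rw [h]
  exact A.padChange_homotopic_id _

end Alg

/-! ### The enveloping algebra as a pushout -/

/-- The monoid of little intervals, with composition as multiplication and with length `x` for
`[x, y]`. -/
def intervals : LengthMonoid (ℝ × ℝ) where
  carrier := {p | 0 ≤ p.1 ∧ p.1 < p.2 ∧ p.2 ≤ 1}
  convex := by
    intro p hp q hq a b ha hb hab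
    refine ⟨?_, ?_, ?_⟩
    · simpa using convex_le_aux ha hb hp.1 hq.1
    · simpa using convex_lt_aux ha hb hab hp.2.1 hq.2.1
    · simpa [hab] using convex_le_aux ha hb hp.2.2 hq.2.2
  one := (0, 1)
  one_mem := by norm_num
  mul := rescale
  continuous_mul := by unfold rescale; fun_prop
  mul_mem ha hb := by
    obtain ⟨h₁, h₂, h₃⟩ := rescale_mem ha.2.1 hb
    exact ⟨ha.1.trans h₁, h₂, h₃.trans ha.2.2⟩
  mul_assoc a b c := by ext <;> simp only [rescale] <;> ring
  one_mul a := by ext <;> simp [rescale]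
  mul_one a := by ext <;> simp [rescale]
  len := LinearMap.fst ℝ ℝ ℝ
  len_nonneg ha := ha.1
  -- The composite of `[x, y]` with `[x', y']` starts at `x + (y - x) x'`, so the stretching factor
  -- is the width.
  scale a := a.2 - a.1
  scale_pos ha := sub_pos.2 ha.2.1
  len_mul a b := rfl

theorem rescale_one_right (p : ℝ × ℝ) : rescale p (0, 1) = p := by simp [rescale]

/-- The image of an interval under division by `x`. -/
def shrink (x : ℝ) (q : ℝ × ℝ) : ℝ × ℝ := (q.1 / x, q.2 / x)

theorem rescale_shrink {x : ℝ} (hx : x ≠ 0) (q : ℝ × ℝ) : rescale (0, x) (shrink x q) = q := by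
  ext <;> simp [rescale, shrink] <;> field_simp

theorem shrink_rescale (x : ℝ) (p q : ℝ × ℝ) :
    shrink x (rescale p q) = rescale (shrink x p) q := by
  ext <;> simp only [rescale, shrink] <;> ring

section Little

variable {m : ℕ} {c : Fin (m + 1) → ℝ × ℝ}

theorem last_mem (hc : c ∈ littleSet (m + 1)) : c (Fin.last m) ∈ intervals.carrier :=
  hc.1 (Fin.last m)

/-- Some interval of positive length lies to the left of the last one. Hence a last interval that
starts at `0` is the only one. -/
theorem last_pos {c : Fin (m + 1 + 1) → ℝ × ℝ} (hc : c ∈ littleSet (m + 1 + 1)) :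
    0 < (c (Fin.last (m + 1))).1 :=
  ((hc.1 0).1.trans_lt (hc.1 0).2.1).trans_le (hc.2 0 _ (Fin.last_pos))

theorem shrink_mem (hc : c ∈ littleSet (m + 1)) (h : 0 < (c (Fin.last m)).1) :
    (fun i : Fin m => shrink (c (Fin.last m)).1 (c i.castSucc)) ∈ littleSet m := by
  refine ⟨fun i => ⟨div_nonneg (hc.1 _).1 h.le, ?_, ?_⟩, fun i k hik => ?_⟩
  · exact div_lt_div_of_pos_right (hc.1 _).2.1 h
  · exact (div_le_one h).2 (hc.2 _ _ (Fin.castSucc_lt_last i))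
  · exact div_le_div_of_nonneg_right (hc.2 _ _ (Fin.castSucc_lt_castSucc_iff.2 hik)) h.le

theorem append_last_mem {n : ℕ} {d : Fin n → ℝ × ℝ} (hc : c ∈ littleSet (m + 1))
    (hd : d ∈ littleSet n) (h : ∀ k, (d k).2 ≤ (c (Fin.last m)).1) :
    Fin.append d (fun _ : Fin 1 => c (Fin.last m)) ∈ littleSet (n + 1) :=
  append_mem hd (single_mem (hc.1 (Fin.last m)).1 (hc.1 (Fin.last m)).2.1 (hc.1 (Fin.last m)).2.2)
    fun i _ => h i

end Little

section CompFun

variable {P : ObjectProperty TopCat.{w}} [ContainsConvex P]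
  [CartesianMonoidalCategory P.FullSubcategory]

theorem compFun_last_mem (js : Arities) {c : Fin (js.len + 1) → ℝ × ℝ}
    (hc : c ∈ littleSet (js.len + 1)) (d : (tensorOver (little P) js).obj) :
    Fin.append (compFun P js (fun i => c i.castSucc) d) (fun _ : Fin 1 => c (Fin.last js.len)) ∈
      littleSet (js.total + 1) := by
  have h := compFun_mem P js (fun i => c i.castSucc)
    ⟨fun i => hc.1 i.castSucc, fun i k h => hc.2 _ _ (Fin.castSucc_lt_castSucc_iff.2 h)⟩ d
  exact append_last_mem hc h.1 (h.2 _ fun i => hc.2 _ _ (Fin.castSucc_lt_last i))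

/-- Division by `x` acts on the outer intervals only, and rescaling is linear in the outer interval.
This makes `envToPad` respect the coequalizer relation. -/
theorem compFun_shrink (x : ℝ) (js : Arities) (c : Fin js.len → ℝ × ℝ)
    (d : (tensorOver (little P) js).obj) (i : Fin js.total) :
    compFun P js (fun i => shrink x (c i)) d i = shrink x (compFun P js c d i) := by
  induction js with
  | nil => exact i.elim0
  | snoc js j ih =>
    rw [← pair_pr (X := tensorOver (little P) js) (Y := little P j) d]
    rw [compFun_pair, compFun_pair]
    refine Fin.addCases (fun i => ?_) (fun i => ?_) i
    · rw [Fin.append_left, Fin.append_left, ih]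
    · rw [Fin.append_right, Fin.append_right, shrink_rescale]

end CompFun

namespace Alg

section

variable {P : ObjectProperty TopCat.{w}} [ContainsConvex P]
  [CartesianMonoidalCategory P.FullSubcategory] [BraidedCategory P.FullSubcategory]
  {C : Type u} [Category.{v} C] [MonoidalCategory C] [SymmetricCategory C]
  {L : P.FullSubcategory ⥤ C} [L.Braided] (A : Alg L)

theorem lptAll_snoc (js : Arities) {j : ℕ} (d : (tensorOver (little P) js).obj)
    {c : Fin j → ℝ × ℝ} (hc : c ∈ littleSet j) :
    lptAll L (little P) (js.snoc j) (pair d (littlePt P hc)) =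
      (λ_ (𝟙_ C)).inv ≫ (lptAll L (little P) js d ⊗ₘ opPt L hc) :=
  congrArg₂ (fun (a : (tensorOver (little P) js).obj) (b : (little P j).obj) =>
    (λ_ (𝟙_ C)).inv ≫ (lptAll L (little P) js a ⊗ₘ lpt L b)) (pr₁_pair d (littlePt P hc))
      (pr₂_pair d (littlePt P hc))

/-- The last slot receives the operad unit, so the last interval of `c` survives unchanged. -/
theorem ins_envMulSummand (js : Arities) {c : Fin (js.len + 1) → ℝ × ℝ}
    (hc : c ∈ littleSet (js.len + 1)) (d : (tensorOver (little P) js).obj) :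
    insAll L (little P) (tpow A.X) js d ≫ ins (opPt L hc) _ ≫ A.envMulSummand js =
      tpowTotal A.X js ≫ ins (opPt L (compFun_last_mem js hc d)) _ := by
  have h₁ : lptAll L (little P) js d ≫ (ρ_ (tensorOver (op L) js)).inv ≫
      tensorOver (op L) js ◁ opOne L = lptAll L (little P) (js.snoc 1)
        (pair d (littlePt P (single_mem le_rfl one_pos le_rfl))) := by
    rw [lptAll_snoc, opOne_eq, MonoidalCategory.tensorHom_def, unitors_inv_equal,
      rightUnitor_inv_naturality_assoc]
  have h₂ := opPt_opComp (L := L) (js.snoc 1) hc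
    (pair d (littlePt P (single_mem le_rfl one_pos le_rfl))) (compFun_last_mem js hc d) (by
      intro i
      rw [compFun_pair]
      refine congrFun (congrArg (Fin.append _) (funext fun i => ?_)) i
      rw [val_littlePt, rescale_one_right])
  rw [← h₁] at h₂
  rw [envMulSummand, ← Category.assoc (ins _ _), ins_whiskerLeft, Category.assoc, ← Category.assoc,
    insAll_opShuffle, Category.assoc, ← h₂, ← Category.assoc (ins (opPt L hc) _),
    ← Category.assoc (ins _ _), ins_associator_inv, ins_whiskerRight, Category.assoc,
    ← id_tensorHom, tensorHom_comp_tensorHom_assoc, Category.comp_id]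

variable [MonoidalClosed C] [L.IsLeftAdjoint]

/-- The condition on maps out of the enveloping algebra can be checked at points. -/
theorem env_condition_of_pt {Y : C} (f : ∀ m, op L (m + 1) ⊗ tpow A.X m ⟶ Y)
    (hf : ∀ (js : Arities) (c : Fin (js.len + 1) → ℝ × ℝ) (hc : c ∈ littleSet (js.len + 1))
      (d : (tensorOver (little P) js).obj),
      A.opAtAll js d ≫ ins (opPt L hc) _ ≫ f js.len =
        tpowTotal A.X js ≫ ins (opPt L (compFun_last_mem js hc d)) _ ≫ f js.total)
    (js : Arities) : op L (js.len + 1) ◁ tensorOverTo A.act js ≫ f js.len =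
      A.envMulSummand js ≫ f js.total := by
  refine jointlyEpi_ins L (little P (js.len + 1)) _ _ _ fun x =>
    jointlyEpi_insAll L (little P) (tpow A.X) js _ _ fun d => ?_
  have h := hf js _ (val_mem x) d
  have h₁ := A.ins_envMulSummand js (val_mem x) d =≫ f js.total
  rw [← insAll_act, Category.assoc, ← Category.assoc (tensorOverTo _ _), ← ins_whiskerLeft,
    Category.assoc] at h
  simp only [Category.assoc] at h₁
  refine h.trans (h₁.symm.trans rfl)

end

variable {P : ObjectProperty TopCat.{w}} [ContainsConvex P]
  [CartesianMonoidalCategory P.FullSubcategory] [BraidedCategory P.FullSubcategory]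
  {C : Type u} [Category.{v} C] [MonoidalCategory C] [SymmetricCategory C]
  {L : P.FullSubcategory ⥤ C} [L.Braided] [HasCountableColimits C] (A : Alg L)

/-- The map to the enveloping algebra at a point of the operad. -/
def envAt {m : ℕ} {c : Fin (m + 1) → ℝ × ℝ} (hc : c ∈ littleSet (m + 1)) : tpow A.X m ⟶ A.env :=
  ins (opPt L hc) (tpow A.X m) ≫ A.envι m

theorem envAt_congr {m : ℕ} {c d : Fin (m + 1) → ℝ × ℝ} (hc : c ∈ littleSet (m + 1))
    (hd : d ∈ littleSet (m + 1)) (h : ∀ i, c i = d i) : A.envAt hc = A.envAt hd := by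
  rw [envAt, envAt, opPt_congr hc hd h]

theorem eqToHom_envAt {m n : ℕ} (h : m = n) {c : Fin (m + 1) → ℝ × ℝ} (hc : c ∈ littleSet (m + 1))
    {d : Fin (n + 1) → ℝ × ℝ} (hd : d ∈ littleSet (n + 1))
    (h' : ∀ i, c i = d (Fin.cast (congrArg (· + 1) h) i)) :
    eqToHom (congrArg (tpow A.X) h) ≫ A.envAt hd = A.envAt hc := by
  subst h
  rw [eqToHom_refl, Category.id_comp]
  exact (A.envAt_congr _ _ h').symm

/-- The map from `A` to the enveloping algebra given by two little intervals. -/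
def envAt₁ {c : Fin 2 → ℝ × ℝ} (hc : c ∈ littleSet 2) : A.X ⟶ A.env :=
  (λ_ A.X).inv ≫ A.envAt (m := 1) hc

/-- The coequalizer relation at points: operations on `A` move into all slots but the last. -/
theorem opAtAll_envAt (js : Arities) {c : Fin (js.len + 1) → ℝ × ℝ}
    (hc : c ∈ littleSet (js.len + 1)) (d : (tensorOver (little P) js).obj) :
    A.opAtAll js d ≫ A.envAt hc = tpowTotal A.X js ≫ A.envAt (compFun_last_mem js hc d) := by
  rw [envAt, ← insAll_act, Category.assoc, ← Category.assoc (tensorOverTo _ _), ← ins_whiskerLeft,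
    Category.assoc, envι_rel, envAt, ← Category.assoc (tpowTotal _ _),
    ← ins_envMulSummand A js hc d]
  simp only [Category.assoc]

/-- Read from right to left, this expresses a generator whose last interval starts at `x > 0` by the
pair `([0, x], [x, y])` and an operation on `A`. -/
theorem opAt_envAt₁ {m : ℕ} {d : Fin m → ℝ × ℝ} (hd : d ∈ littleSet m) {c : Fin 2 → ℝ × ℝ}
    (hc : c ∈ littleSet 2) {e : Fin (m + 1) → ℝ × ℝ} (he : e ∈ littleSet (m + 1))
    (h : ∀ i : Fin m, e i.castSucc = rescale (c 0) (d i)) (hl : e (Fin.last m) = c 1) :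
    A.opAt hd ≫ A.envAt₁ hc = A.envAt he := by
  let x : (tensorOver (little P) (Arities.nil.snoc m)).obj := pair (star P) (littlePt P hd)
  have hx : compFun P (Arities.nil.snoc m) (fun i => c i.castSucc) x =
      Fin.append (Fin.elim0 : Fin 0 → ℝ × ℝ) (fun i => rescale (c 0) (d i)) :=
    compFun_pair Arities.nil m _ (star P) (littlePt P hd)
  have h₁ := A.opAtAll_envAt (Arities.nil.snoc m) hc x
  rw [opAtAll_snoc, tpowTotal_one, Category.assoc, A.eqToHom_envAt (Nat.zero_add m).symm he] at h₁
  · rw [envAt₁, leftUnitor_inv_naturality_assoc, ← id_tensorHom]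
    exact ((λ_ _).inv ≫= h₁).trans (Iso.inv_hom_id_assoc _ _)
  · rw [hx, Fin.elim0_append]
    intro i
    refine Fin.lastCases ?_ (fun i => ?_) i
    · rw [hl]
      have hi : Fin.cast (congrArg (· + 1) (Nat.zero_add m).symm) (Fin.last m) =
        Fin.natAdd (0 + m) (0 : Fin 1) := by ext; simp
      rw [hi, Fin.append_right]
      rfl
    · rw [h]
      have hi : Fin.cast (congrArg (· + 1) (Nat.zero_add m).symm) i.castSucc =
        Fin.castAdd 1 (Fin.cast (Nat.zero_add m).symm i) := rfl
      rw [hi, Fin.append_left]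
      rfl

/-- Filling the first interval with `1_A` deletes it; this becomes the gluing relation of the
pushout. -/
theorem one_envAt₁ {c : Fin 2 → ℝ × ℝ} (hc : c ∈ littleSet 2) {e : Fin 1 → ℝ × ℝ}
    (he : e ∈ littleSet 1) (h : e 0 = c 1) : A.one ≫ A.envAt₁ hc = A.envAt he := by
  have h₀ : (Fin.elim0 : Fin 0 → ℝ × ℝ) ∈ littleSet 0 := ⟨fun i => i.elim0, fun i => i.elim0⟩
  rw [A.one_eq_opAt h₀]
  exact A.opAt_envAt₁ h₀ hc he (fun i => i.elim0) h

theorem env_hom_ext_pt [MonoidalClosed C] [L.IsLeftAdjoint] {Y : C} {f g : A.env ⟶ Y}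
    (h : ∀ m (c : Fin (m + 1) → ℝ × ℝ) (hc : c ∈ littleSet (m + 1)),
      A.envAt hc ≫ f = A.envAt hc ≫ g) : f = g := by
  refine A.env_hom_ext fun m => jointlyEpi_ins L (little P (m + 1)) _ _ _ fun x => ?_
  have h' := h m _ (val_mem x)
  rw [envAt, Category.assoc, Category.assoc] at h'
  exact h'

end Alg

theorem head_mem {c : Fin 1 → ℝ × ℝ} (hc : c ∈ littleSet 1) : c 0 ∈ intervals.carrier := hc.1 0

theorem last_mem_pos {m : ℕ} {c : Fin (m + 1) → ℝ × ℝ} (hc : c ∈ littleSet (m + 1))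
    (h : 0 < (c (Fin.last m)).1) : c (Fin.last m) ∈ intervals.posCarrier := ⟨last_mem hc, h⟩

theorem interval_single_mem {p : ℝ × ℝ} (hp : p ∈ intervals.carrier) :
    (fun _ : Fin 1 => p) ∈ littleSet 1 := single_mem hp.1 hp.2.1 hp.2.2

theorem interval_pair_mem {p : ℝ × ℝ} (hp : p ∈ intervals.posCarrier) :
    ![(0, p.1), (p.1, p.2)] ∈ littleSet 2 := pair_mem hp.2 hp.1.2.1 hp.1.2.2

/-! ### Spaces of lists and the monoid of intervals -/

section IntervalMaps

variable (P : ObjectProperty TopCat.{w}) [ContainsConvex P]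

/-- The last interval of a sequence of at least two intervals. -/
def lastInterval (m : ℕ) : little P (m + 1 + 1) ⟶ intervals.pos P :=
  map₁ (convex_littleSet _) intervals.convex_posCarrier (fun c => c (Fin.last (m + 1)))
    (continuous_apply _).continuousOn fun _ hc => last_mem_pos hc (last_pos hc)

/-- The intervals before the last one, rescaled to the interval in front of the last one. -/
def initIntervals (m : ℕ) : little P (m + 1 + 1) ⟶ little P (m + 1) :=
  map₁ (convex_littleSet _) (convex_littleSet _)
    (fun c i => shrink (c (Fin.last (m + 1))).1 (c i.castSucc))
    (continuousOn_pi.2 fun i =>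
      (ContinuousOn.div (by fun_prop) (by fun_prop) fun _ hc => (last_pos hc).ne').prodMk
        (ContinuousOn.div (by fun_prop) (by fun_prop) fun _ hc => (last_pos hc).ne'))
    fun _ hc => shrink_mem hc (last_pos hc)

/-- The only interval of a sequence of length one. -/
def toInterval : little P 1 ⟶ intervals.full P :=
  map₁ (convex_littleSet _) intervals.convex (fun c => c 0)
    (continuous_apply _).continuousOn fun _ hc => head_mem hc

/-- The sequence that consists of one interval. -/
def ofInterval : intervals.full P ⟶ little P 1 :=
  map₁ intervals.convex (convex_littleSet _) (fun p _ => p)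
    (continuous_pi fun _ => continuous_id).continuousOn fun _ hp => interval_single_mem hp

/-- The sequence `([0, x], [x, y])`. -/
def pairOfInterval : intervals.pos P ⟶ little P 2 :=
  map₁ intervals.convex_posCarrier (convex_littleSet 2) (fun p => ![(0, p.1), (p.1, p.2)])
    continuous_pair.continuousOn fun _ hp => interval_pair_mem hp

end IntervalMaps

namespace Alg

variable {P : ObjectProperty TopCat.{w}} [ContainsConvex P]
  [CartesianMonoidalCategory P.FullSubcategory] [BraidedCategory P.FullSubcategory]
  {C : Type u} [Category.{v} C] [MonoidalCategory C] [SymmetricCategory C]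
  {L : P.FullSubcategory ⥤ C} [L.Braided] [HasCountableColimits C] (A : Alg L)

/-- The summands of the isomorphism from the enveloping algebra to a pushout. -/
def envToPadSummand : ∀ m, op L (m + 1) ⊗ tpow A.X m ⟶ A.pad intervals
  | 0 => L.map (toInterval P) ▷ 𝟙_ C ≫ A.padInl intervals
  -- With at least two intervals the last one starts at a positive `x`, so it lies in the part of
  -- positive length and division by `x` is continuous.
  | m + 1 => (L.map (lift (lastInterval P m) (initIntervals P m)) ≫
      Functor.OplaxMonoidal.δ L _ _) ▷ tpow A.X (m + 1) ≫ (α_ _ _ _).hom ≫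
      L.obj (intervals.pos P) ◁ A.act (m + 1) ≫ A.padInr intervals

theorem ins_envToPad_zero {c : Fin 1 → ℝ × ℝ} (hc : c ∈ littleSet 1) :
    ins (opPt L hc) (𝟙_ C) ≫ A.envToPadSummand 0 = A.padOne intervals (head_mem hc) := by
  change _ ≫ L.map (toInterval P) ▷ 𝟙_ C ≫ A.padInl intervals = _
  rw [← Category.assoc, ins_whiskerRight, opPt, lpt_map, padOne]
  rfl

/-- For `m = 0` the summand lands in the unit part, but the formula of the case `m > 0` still holds
there by `padOne_eq`. -/
theorem ins_envToPad {m : ℕ} {c : Fin (m + 1) → ℝ × ℝ} (hc : c ∈ littleSet (m + 1))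
    (h : 0 < (c (Fin.last m)).1) :
    ins (opPt L hc) (tpow A.X m) ≫ A.envToPadSummand m =
      A.opAt (shrink_mem hc h) ≫ A.padAt intervals (last_mem_pos hc h) := by
  cases m with
  | zero =>
    refine (A.ins_envToPad_zero hc).trans ?_
    rw [← one_eq_opAt]
    exact A.padOne_eq intervals (last_mem_pos hc h)
  | succ m =>
    have e : opPt L hc ≫ L.map (lift (lastInterval P m) (initIntervals P m)) ≫
        Functor.OplaxMonoidal.δ L _ _ = (λ_ (𝟙_ C)).inv ≫
          (lpt L (intervals.posPt P (last_mem_pos hc h)) ⊗ₘ opPt L (shrink_mem hc h)) := by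
      rw [opPt, ← Category.assoc, lpt_map, lift_apply, lpt_pair_δ]
      rfl
    change _ ≫ (L.map (lift (lastInterval P m) (initIntervals P m)) ≫
      Functor.OplaxMonoidal.δ L _ _) ▷ tpow A.X (m + 1) ≫ (α_ _ _ _).hom ≫
      L.obj (intervals.pos P) ◁ A.act (m + 1) ≫ A.padInr intervals = _
    rw [← Category.assoc, ins_whiskerRight, e, ← Category.assoc, ins_associator, Category.assoc,
      ← Category.assoc (ins _ _) (_ ◁ _), ins_whiskerLeft, opAt, padAt]
    simp only [Category.assoc]

theorem eq_zero_of_last {m : ℕ} {c : Fin (m + 1) → ℝ × ℝ} (hc : c ∈ littleSet (m + 1))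
    (h : ¬ 0 < (c (Fin.last m)).1) : m = 0 := by
  cases m with
  | zero => rfl
  | succ m => exact absurd (last_pos hc) h

theorem append_last {n : ℕ} {X : Type*} (d : Fin n → X) (e : Fin 1 → X) :
    Fin.append d e (Fin.last n) = e 0 := Fin.append_right d e 0

theorem append_castSucc {n : ℕ} {X : Type*} (d : Fin n → X) (e : Fin 1 → X) (i : Fin n) :
    Fin.append d e i.castSucc = d i := Fin.append_left d e i

variable [MonoidalClosed C] [L.IsLeftAdjoint]

-- If the last interval starts at `x > 0`, composing the others commutes with dividing them by `x`.
-- If it starts at `0`, then `js` is empty and both sides agree.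
omit [MonoidalClosed C] [L.IsLeftAdjoint] in
theorem opAtAll_envToPad (js : Arities) (c : Fin (js.len + 1) → ℝ × ℝ)
    (hc : c ∈ littleSet (js.len + 1)) (d : (tensorOver (little P) js).obj) :
    A.opAtAll js d ≫ ins (opPt L hc) _ ≫ A.envToPadSummand js.len =
      tpowTotal A.X js ≫ ins (opPt L (compFun_last_mem js hc d)) _ ≫
        A.envToPadSummand js.total := by
  by_cases h : 0 < (c (Fin.last js.len)).1
  · have h' : 0 < (Fin.append (compFun P js (fun i => c i.castSucc) d)
        (fun _ : Fin 1 => c (Fin.last js.len)) (Fin.last js.total)).1 := by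
      rwa [append_last]
    rw [A.ins_envToPad hc h, A.ins_envToPad _ h', ← Category.assoc, ← Category.assoc,
      A.opAtAll_opAt js (shrink_mem hc h) d (shrink_mem (compFun_last_mem js hc d) h'),
      A.padAt_congr intervals (last_mem_pos (compFun_last_mem js hc d) h') (last_mem_pos hc h)
        (append_last _ _)]
    intro i
    rw [append_last, append_castSucc, ← compFun_shrink]
  · cases js with
    | nil =>
      change 𝟙 _ ≫ _ = 𝟙 _ ≫ _
      refine congrArg (fun t => 𝟙 _ ≫ ins t _ ≫ _) (opPt_congr _ _ fun i => ?_)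
      rw [show i = 0 from Fin.fin_one_eq_zero i]
      rfl
    | snoc js j => exact absurd (last_pos hc) h

/-- The isomorphism from the enveloping algebra to a pushout. -/
def envToPad : A.env ⟶ A.pad intervals :=
  A.envDesc A.envToPadSummand (A.env_condition_of_pt _ A.opAtAll_envToPad)

theorem envAt_toPad_zero {c : Fin 1 → ℝ × ℝ} (hc : c ∈ littleSet 1) :
    A.envAt (m := 0) hc ≫ A.envToPad = A.padOne intervals (head_mem hc) := by
  rw [← ins_envToPad_zero, envAt, Category.assoc, envToPad, envι_desc]

theorem envAt_toPad {m : ℕ} {c : Fin (m + 1) → ℝ × ℝ} (hc : c ∈ littleSet (m + 1))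
    (h : 0 < (c (Fin.last m)).1) : A.envAt hc ≫ A.envToPad =
      A.opAt (shrink_mem hc h) ≫ A.padAt intervals (last_mem_pos hc h) := by
  rw [← A.ins_envToPad hc h, envAt, Category.assoc, envToPad, envι_desc]

theorem padToEnv_condition : L.map (intervals.incl P) ▷ 𝟙_ C ≫
      L.map (ofInterval P) ▷ 𝟙_ C ≫ A.envι 0 =
    L.obj (intervals.pos P) ◁ A.one ≫
      (L.map (pairOfInterval P) ⊗ₘ (λ_ A.X).inv) ≫ A.envι 1 := by
  refine jointlyEpi_ins L (intervals.pos P) _ _ _ fun x => ?_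
  have hx := val_mem x
  have h := A.one_envAt₁ (interval_pair_mem hx) (interval_single_mem hx.1) rfl
  rw [← Category.assoc, ins_whiskerRight, lpt_map, ← Category.assoc, ins_whiskerRight, lpt_map,
    ← Category.assoc, ins_whiskerLeft, Category.assoc, ← Category.assoc (ins _ _), ins_tensorHom,
    lpt_map]
  rw [envAt₁, envAt, envAt] at h
  simp only [Category.assoc] at h ⊢
  exact h.symm

/-- The inverse of the isomorphism from the enveloping algebra to a pushout. -/
def padToEnv : A.pad intervals ⟶ A.env :=
  pushout.desc _ _ A.padToEnv_condition

theorem padOne_toEnv {p : ℝ × ℝ} (hp : p ∈ intervals.carrier) :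
    A.padOne intervals hp ≫ A.padToEnv =
      A.envAt (m := 0) (interval_single_mem hp) := by
  rw [padOne, Category.assoc, padInl, padToEnv, pushout.inl_desc, ← Category.assoc,
    ins_whiskerRight, lpt_map, envAt]
  rfl

theorem padAt_toEnv {p : ℝ × ℝ} (hp : p ∈ intervals.posCarrier) :
    A.padAt intervals hp ≫ A.padToEnv = A.envAt₁ (interval_pair_mem hp) := by
  rw [padAt, Category.assoc, padInr, padToEnv, pushout.inr_desc, ← Category.assoc,
    ins_tensorHom, lpt_map, envAt₁, envAt, Category.assoc]
  rfl

theorem padToEnv_toPad : A.padToEnv ≫ A.envToPad = 𝟙 (A.pad intervals) := by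
  refine A.pad_hom_ext_pt intervals (fun p hp _ => ?_) fun p hp => ?_
  · rw [← Category.assoc, padOne_toEnv, envAt_toPad_zero, Category.comp_id]
  -- Division by `x` takes `[0, x]` to `[0,1]`, which acts as the identity.
  · have h : A.opAt₁ (shrink_mem (interval_pair_mem hp) hp.2) = 𝟙 A.X := by
      refine A.opAt₁_eq_id _ ?_
      ext
      · exact zero_div _
      · exact div_self hp.2.ne'
    rw [← Category.assoc, padAt_toEnv, Category.comp_id, envAt₁, Category.assoc,
      A.envAt_toPad (interval_pair_mem hp) hp.2, ← Category.assoc]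
    exact (congrArg (· ≫ _) h).trans (Category.id_comp _)

theorem envToPad_toEnv : A.envToPad ≫ A.padToEnv = 𝟙 A.env := by
  refine A.env_hom_ext_pt fun m c hc => ?_
  by_cases h : 0 < (c (Fin.last m)).1
  · rw [← Category.assoc, envAt_toPad A hc h, Category.assoc, padAt_toEnv, Category.comp_id]
    -- Rescaling into `[0, x]` undoes the division by `x`.
    exact A.opAt_envAt₁ _ _ _ (fun i => (rescale_shrink h.ne' _).symm) rfl
  · obtain rfl := eq_zero_of_last hc h
    rw [← Category.assoc, envAt_toPad_zero, padOne_toEnv, Category.comp_id]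
    refine A.envAt_congr _ _ fun i => ?_
    rw [show i = 0 from Fin.fin_one_eq_zero i]

/-- The enveloping algebra is a pushout. -/
def padIsoEnv : A.pad intervals ≅ A.env :=
  ⟨A.padToEnv, A.envToPad, A.padToEnv_toPad, A.envToPad_toEnv⟩

theorem padToEnv_naturality {A B : Alg L} (φ : A ⟶ B) :
    padMap intervals φ ≫ B.padToEnv = A.padToEnv ≫ envMap φ := by
  have h : ∀ m {c : Fin (m + 1) → ℝ × ℝ} (hc : c ∈ littleSet (m + 1)),
      A.envAt hc ≫ envMap φ = tpowMap φ.hom m ≫ B.envAt hc := by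
    intro m c hc
    rw [envAt, Category.assoc, envMap, envι_desc, ← Category.assoc, ins_whiskerLeft, envAt,
      Category.assoc]
  refine A.pad_hom_ext_pt intervals (fun p hp _ => ?_) fun p hp => ?_
  · rw [← Category.assoc, ← Category.assoc, padOne_map, padOne_toEnv, padOne_toEnv, h]
    exact (Category.id_comp _).symm
  · have e : tpowMap φ.hom 1 = 𝟙_ C ◁ φ.hom := id_tensorHom _ _
    rw [← Category.assoc, ← Category.assoc, padAt_map, padAt_toEnv, Category.assoc, padAt_toEnv,
      envAt₁, envAt₁, Category.assoc, h, e, ← leftUnitor_inv_naturality_assoc]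

/-- The monoid structure on the enveloping algebra. -/
@[reducible] def envMon : MonObj A.env :=
  -- The structure is transported from the pushout; `isEnvelopingMonoid_envMon` shows that it is
  -- composition in the last slot.
  letI := A.padMon intervals
  MonObj.ofIso A.padIsoEnv

theorem isMonHom_padToEnv :
    letI := A.padMon intervals; letI := A.envMon; IsMonHom A.padToEnv :=
  letI := A.padMon intervals
  isMonHom_ofIso A.padIsoEnv

theorem isMonHom_envToPad :
    let := A.padMon intervals; letI := A.envMon; IsMonHom A.envToPad := by
  let := A.padMon intervals
  let := A.envMon
  have : IsMonHom A.padIsoEnv.hom := A.isMonHom_padToEnv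
  exact inferInstanceAs (IsMonHom A.padIsoEnv.inv)

theorem isMonHom_envMap {A B : Alg L} (φ : A ⟶ B) :
    letI := A.envMon; letI := B.envMon; IsMonHom (envMap φ) := by
  let := A.padMon intervals
  let := B.padMon intervals
  let := A.envMon
  let := B.envMon
  have := A.isMonHom_envToPad
  have := B.isMonHom_padToEnv
  have := isMonHom_padMap (Q := intervals) φ
  have h : envMap φ = A.envToPad ≫ padMap intervals φ ≫ B.padToEnv := by
    rw [padToEnv_naturality, ← Category.assoc, envToPad_toEnv, Category.id_comp]
  rw [h]
  infer_instance

end Alg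

/-! ### The multiplication of the enveloping algebra -/

section CompLast

variable {m n : ℕ} {c : Fin (m + 1) → ℝ × ℝ} {d : Fin (n + 1) → ℝ × ℝ}

/-- The composition in the last slot. -/
def compLast (c : Fin (m + 1) → ℝ × ℝ) (d : Fin (n + 1) → ℝ × ℝ) : Fin (m + n + 1) → ℝ × ℝ :=
  Fin.append (n := n + 1) (fun i : Fin m => c i.castSucc) fun i => rescale (c (Fin.last m)) (d i)

theorem compLast_mem (hc : c ∈ littleSet (m + 1)) (hd : d ∈ littleSet (n + 1)) :
    compLast c d ∈ littleSet (m + n + 1) := by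
  have hl := hc.1 (Fin.last m)
  exact append_mem (n := n + 1) ⟨fun i => hc.1 i.castSucc,
    fun i k h => hc.2 _ _ (Fin.castSucc_lt_castSucc_iff.2 h)⟩ (rescale_comp_mem hl hd)
    fun i k => (hc.2 i.castSucc (Fin.last m) (Fin.castSucc_lt_last i)).trans
      (rescale_mem hl.2.1 (hd.1 k)).1

theorem compLast_last (c : Fin (m + 1) → ℝ × ℝ) (d : Fin (n + 1) → ℝ × ℝ) :
    compLast c d (Fin.last (m + n)) = rescale (c (Fin.last m)) (d (Fin.last n)) :=
  Fin.append_right _ _ (Fin.last n)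

theorem compLast_left (c : Fin (m + 1) → ℝ × ℝ) (d : Fin (n + 1) → ℝ × ℝ) (i : Fin m) :
    compLast c d (Fin.castAdd n i).castSucc = c i.castSucc :=
  Fin.append_left (n := n + 1) _ _ i

theorem compLast_right (c : Fin (m + 1) → ℝ × ℝ) (d : Fin (n + 1) → ℝ × ℝ) (i : Fin n) :
    compLast c d (Fin.natAdd m i).castSucc = rescale (c (Fin.last m)) (d i.castSucc) :=
  Fin.append_right (n := n + 1) _ _ i.castSucc

/-- Let `[x, y]` be the last interval of `c`, let `z` be the start of the last interval of `d`, and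
put `T = x + (y - x) z`. Division by `T` after division by `x` is undone is scaling by `x / T`, and
`1 - x / T = (y - x) z / T`. So the pieces are cut exactly at the cut point `x / T`. -/
theorem shrink_compLast (hc : c ∈ littleSet (m + 1)) (hd : d ∈ littleSet (n + 1))
    (hx : 0 < (c (Fin.last m)).1) (hz : 0 < (d (Fin.last n)).1) :
    (fun i : Fin (m + n) => shrink (compLast c d (Fin.last (m + n))).1
        (compLast c d i.castSucc)) =
      Fin.append
        (fun i => rescale (0, (c (Fin.last m)).1 / (rescale (c (Fin.last m)) (d (Fin.last n))).1)
          (shrink (c (Fin.last m)).1 (c i.castSucc)))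
        (fun i => rescale ((c (Fin.last m)).1 / (rescale (c (Fin.last m)) (d (Fin.last n))).1, 1)
          (shrink (d (Fin.last n)).1 (d i.castSucc))) := by
  have hT : 0 < (rescale (c (Fin.last m)) (d (Fin.last n))).1 :=
    hx.trans_le (rescale_mem (hc.1 _).2.1 (hd.1 _)).1
  funext i
  rw [compLast_last]
  refine Fin.addCases (fun i => ?_) (fun i => ?_) i
  · rw [compLast_left, Fin.append_left]
    ext <;> simp only [rescale, shrink] at hT ⊢ <;> field_simp <;> ring
  · rw [compLast_right, Fin.append_right]
    ext <;> simp only [rescale, shrink] at hT ⊢ <;> field_simp <;> ring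

end CompLast

theorem last_eq_zero {m : ℕ} {c : Fin (m + 1) → ℝ × ℝ} (hc : c ∈ littleSet (m + 1))
    (h : ¬ 0 < (c (Fin.last m)).1) : (c (Fin.last m)).1 = 0 :=
  le_antisymm (not_lt.1 h) (hc.1 _).1

namespace Alg

variable {P : ObjectProperty TopCat.{w}} [ContainsConvex P]
  [CartesianMonoidalCategory P.FullSubcategory] [BraidedCategory P.FullSubcategory]
  {C : Type u} [Category.{v} C] [MonoidalCategory C] [SymmetricCategory C]
  {L : P.FullSubcategory ⥤ C} [L.Braided]

theorem opPt_opCompLast {m n : ℕ} {c : Fin (m + 1) → ℝ × ℝ} {d : Fin (n + 1) → ℝ × ℝ}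
    (hc : c ∈ littleSet (m + 1)) (hd : d ∈ littleSet (n + 1)) :
    ((λ_ (𝟙_ C)).inv ≫ (opPt L hc ⊗ₘ opPt L hd)) ≫ opCompLast L m n =
      opPt L (compLast_mem hc hd) := by
  have h := lpt_μ L (littlePt P hc) (littlePt P hd) =≫ L.map (littleCompLast P m n)
  rw [lpt_map] at h
  simp only [Category.assoc] at h
  rw [Category.assoc]
  refine h.trans (lpt_eq_opPt _ _ fun i => ?_)
  exact congrFun (congrArg₂ (fun (a : (little P (m + 1)).obj) (b : (little P (n + 1)).obj) =>
    compLast (val a) (val b)) (pr₁_pair (littlePt P hc) (littlePt P hd))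
      (pr₂_pair (littlePt P hc) (littlePt P hd))) i

variable [HasCountableColimits C] (A : Alg L) [MonoidalClosed C] [L.IsLeftAdjoint]

/-- The cases are whether the last intervals of `c` and `d` start at a positive number. Where one
starts at `0`, its list has no other entries and the corresponding factor is in the unit part. -/
theorem envAt_toPad_mul {μ : A.pad intervals ⊗ A.pad intervals ⟶ A.pad intervals}
    (hμ : A.IsPadMul intervals μ) {m n : ℕ} {c : Fin (m + 1) → ℝ × ℝ} {d : Fin (n + 1) → ℝ × ℝ}
    (hc : c ∈ littleSet (m + 1)) (hd : d ∈ littleSet (n + 1)) :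
    ((A.envAt hc ≫ A.envToPad) ⊗ₘ (A.envAt hd ≫ A.envToPad)) ≫ μ =
      tpowAdd A.X m n ≫ A.envAt (compLast_mem hc hd) ≫ A.envToPad := by
  have hT : (c (Fin.last m)).1 ≤ (compLast c d (Fin.last (m + n))).1 := by
    rw [compLast_last]
    exact (rescale_mem (hc.1 _).2.1 (hd.1 _)).1
  by_cases hx : 0 < (c (Fin.last m)).1 <;> by_cases hz : 0 < (d (Fin.last n)).1
  · have h := hμ.at_at A (last_mem_pos hc hx) (last_mem_pos hd hz)
    have h' := A.opAt_opAt₂ (shrink_mem hc hx) (shrink_mem hd hz)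
      (LengthMonoid.cut_mem (last_mem_pos hc hx) (last_mem_pos hd hz))
      (shrink_mem (compLast_mem hc hd) (hx.trans_le hT)) (shrink_compLast hc hd hx hz)
    rw [A.envAt_toPad hc hx, A.envAt_toPad hd hz,
      A.envAt_toPad (compLast_mem hc hd) (hx.trans_le hT), ← tensorHom_comp_tensorHom,
      Category.assoc, h, ← Category.assoc, h', Category.assoc]
    exact congrArg (fun t => _ ≫ _ ≫ t) (A.padAt_congr intervals _ _ (compLast_last c d).symm)
  -- Here `d` is one interval starting at `0`, so the last interval of the composite starts where
  -- that of `c` does.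
  · obtain rfl := eq_zero_of_last hd hz
    have h := hμ.at_one A (last_mem_pos hc hx) (head_mem hd) (last_eq_zero hd hz)
    have hl : (compLast c d (Fin.last m)).1 = (c (Fin.last m)).1 := by
      have := last_eq_zero hd hz
      refine (congrArg Prod.fst (compLast_last c d)).trans ?_
      rw [rescale, this, mul_zero, add_zero]
    rw [A.envAt_toPad hc hx, A.envAt_toPad_zero hd,
      A.envAt_toPad (compLast_mem hc hd) (hx.trans_le hT), ← Category.id_comp (A.padOne _ _),
      ← tensorHom_comp_tensorHom, Category.assoc, h, tensorHom_id,
      rightUnitor_naturality_assoc]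
    refine congrArg ((ρ_ (tpow A.X m)).hom ≫ ·) (congrArg₂ (· ≫ ·) ?_ ?_)
    · refine A.opAt_congr _ _ fun i => ?_
      exact congrArg₂ shrink hl.symm (compLast_left c d i).symm
    · exact A.padAt_congr intervals _ _ (compLast_last c d).symm
  -- Here `c` is one interval `[0, y]`. Composition multiplies `d` by `y`, and this factor cancels
  -- on division by the new start `y z`.
  · obtain rfl := eq_zero_of_last hc hx
    have h := hμ.one_at A (head_mem hc) (last_eq_zero hc hx) (last_mem_pos hd hz)
    have h₀ : (c 0).1 = 0 := last_eq_zero hc hx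
    have hy : 0 < (c 0).2 := h₀ ▸ (hc.1 0).2.1
    have hl : (compLast c d (Fin.last (0 + n))).1 = (c 0).2 * (d (Fin.last n)).1 := by
      rw [compLast_last]
      change (c 0).1 + ((c 0).2 - (c 0).1) * _ = _
      rw [h₀, zero_add, sub_zero]
    have hp : 0 < (compLast c d (Fin.last (0 + n))).1 := by
      rw [hl]; exact mul_pos hy hz
    rw [A.envAt_toPad hd hz, A.envAt_toPad_zero hc, A.envAt_toPad (compLast_mem hc hd) hp,
      ← Category.id_comp (A.padOne _ _), ← tensorHom_comp_tensorHom, Category.assoc, h,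
      id_tensorHom, leftUnitor_naturality_assoc, tpowAdd_zero_left, Category.assoc]
    refine congrArg ((λ_ (tpow A.X n)).hom ≫ ·) ?_
    rw [← Category.assoc (eqToHom _), A.eqToHom_opAt (Nat.zero_add n).symm
      (shrink_mem hd hz) (shrink_mem (compLast_mem hc hd) hp)]
    · exact congrArg (_ ≫ ·) (A.padAt_congr intervals _ _ (compLast_last c d).symm)
    · intro i
      have hi : (Fin.cast (Nat.zero_add n).symm i) = Fin.natAdd 0 i := by ext; simp
      rw [hl, hi, compLast_right]
      change _ = shrink _ ((c 0).1 + ((c 0).2 - (c 0).1) * _, (c 0).1 + ((c 0).2 - (c 0).1) * _)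
      rw [h₀, sub_zero, zero_add ((c 0).2 * _), zero_add ((c 0).2 * _)]
      ext
      · exact (mul_div_mul_left _ _ hy.ne').symm
      · exact (mul_div_mul_left _ _ hy.ne').symm
  · obtain rfl := eq_zero_of_last hc hx
    obtain rfl := eq_zero_of_last hd hz
    have h := hμ.one_one A (head_mem hc) (head_mem hd)
    rw [A.envAt_toPad_zero hc, A.envAt_toPad_zero hd, h]
    refine congrArg₂ (· ≫ ·) unitors_equal ?_
    refine Eq.trans ?_ (A.envAt_toPad_zero (compLast_mem hc hd)).symm
    exact A.padOne_congr intervals _ _ (compLast_last c d).symm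

theorem envAt_mul {m n : ℕ} {c : Fin (m + 1) → ℝ × ℝ} {d : Fin (n + 1) → ℝ × ℝ}
    (hc : c ∈ littleSet (m + 1)) (hd : d ∈ littleSet (n + 1)) :
    (A.envAt hc ⊗ₘ A.envAt hd) ≫ A.envMon.mul =
      tpowAdd A.X m n ≫ A.envAt (compLast_mem hc hd) := by
  have h := A.envAt_toPad_mul (A.isPadMul_padMon intervals) hc hd =≫ A.padToEnv
  have e : A.envMon.mul = (A.envToPad ⊗ₘ A.envToPad) ≫ (A.padMon intervals).mul ≫ A.padToEnv := rfl
  rw [e, tensorHom_comp_tensorHom_assoc]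
  simp only [Category.assoc, envToPad_toEnv, Category.comp_id] at h ⊢
  exact h

theorem isEnvelopingMonoid_envMon : A.IsEnvelopingMonoid A.envMon where
  one_eq := by
    change A.padOne intervals intervals.one_mem ≫ A.padToEnv = _
    rw [padOne_toEnv, envAt, ins_unit, opOne_eq, Category.assoc]
    rfl
  mul_eq m n := by
    refine (jointlyEpi_ins L (little P (m + 1)) _).tensor (jointlyEpi_ins L (little P (n + 1)) _)
      fun x y => ?_
    have h := A.envAt_mul (val_mem x) (val_mem y)
    have h' := opPt_opCompLast (L := L) (val_mem x) (val_mem y)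
    rw [envAt, envAt, ← tensorHom_comp_tensorHom, Category.assoc] at h
    refine h.trans ?_
    rw [← Category.assoc, ins_tensorμ, ← Category.assoc (ins _ _), ins_tensorHom, envAt,
      Category.assoc]
    exact congrArg (fun t => _ ≫ ins t _ ≫ _) h'.symm

end Alg

section

variable {P : ObjectProperty TopCat.{w}} [ContainsConvex P]
  [CartesianMonoidalCategory P.FullSubcategory] [BraidedCategory P.FullSubcategory]
  {C : Type u} [Category.{v} C] [MonoidalCategory C] [SymmetricCategory C]
  (L : P.FullSubcategory ⥤ C) [L.Braided] [HasCountableColimits C] [MonoidalClosed C]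
  [L.IsLeftAdjoint]

/-- The monoid structures on the enveloping algebras of all algebras. -/
def envLift : MonoidLift (Alg.envFunctor L) where
  mon A := A.envMon
  map_hom φ := Alg.isMonHom_envMap φ

end

/-! ### The comparison maps -/

section Maps

/-- The map that takes `[x, y]` to `(x, y - x, 1 - y)`. -/
def intervalsToNN : PosMap intervals nn where
  toFun p := (p.1, p.2 - p.1, 1 - p.2)
  continuousOn := by fun_prop
  mem _ hp := ⟨hp.1, sub_pos.2 hp.2.1, sub_nonneg.2 hp.2.2⟩
  mem_pos _ hp := ⟨⟨hp.1.1, sub_pos.2 hp.1.2.1, sub_nonneg.2 hp.1.2.2⟩, hp.2⟩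

/-- The coordinates are the left gap, the width and the right gap. Under composition widths
multiply, and each gap of the inner interval is scaled by the outer width and added to the outer
gap. -/
theorem isHom_intervalsToNN : intervalsToNN.IsHom where
  one := by simp [intervalsToNN, intervals, nn]
  mul a _ b _ := by
    ext <;> simp only [intervalsToNN, intervals, nn, rescale] <;> ring
  len _ _ := rfl

/-- The map that takes `(r, s, t)` to the interval `[r, r + s]`, after rescaling `[0, r + s + t]` to
length one. -/
def nnToIntervals : PosMap nn intervals where
  toFun a := (a.1 / (a.1 + a.2.1 + a.2.2), (a.1 + a.2.1) / (a.1 + a.2.1 + a.2.2))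
  continuousOn := by
    have h : ∀ a ∈ nn.carrier, a.1 + a.2.1 + a.2.2 ≠ 0 := fun a ha =>
      (add_pos_of_pos_of_nonneg (add_pos_of_nonneg_of_pos ha.1 ha.2.1) ha.2.2).ne'
    exact (ContinuousOn.div (by fun_prop) (by fun_prop) h).prodMk
      (ContinuousOn.div (by fun_prop) (by fun_prop) h)
  mem a ha := by
    have h := add_pos_of_pos_of_nonneg (add_pos_of_nonneg_of_pos ha.1 ha.2.1) ha.2.2
    exact ⟨div_nonneg ha.1 h.le, div_lt_div_of_pos_right (lt_add_of_pos_right _ ha.2.1) h,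
      (div_le_one h).2 (le_add_of_nonneg_right ha.2.2)⟩
  mem_pos a ha := by
    have h := add_pos_of_pos_of_nonneg (add_pos_of_nonneg_of_pos ha.1.1 ha.1.2.1) ha.1.2.2
    exact ⟨⟨div_nonneg ha.1.1 h.le, div_lt_div_of_pos_right (lt_add_of_pos_right _ ha.1.2.1) h,
      (div_le_one h).2 (le_add_of_nonneg_right ha.1.2.2)⟩, div_pos ha.2 h⟩

/-- The two gaps and the width of an interval in `[0,1]` add up to `1`, so the division changes
nothing. -/
theorem nnToIntervals_intervalsToNN (p : ℝ × ℝ) :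
    nnToIntervals.toFun (intervalsToNN.toFun p) = p := by
  ext <;> simp [intervalsToNN, nnToIntervals]

/-- The map that takes `r` to `(r, 1, 0)`. -/
def mooreToNN : PosMap moore nn where
  toFun r := (r, 1, 0)
  continuousOn := by fun_prop
  mem _ hr := ⟨hr, one_pos, le_rfl⟩
  mem_pos _ hr := ⟨⟨hr.1, one_pos, le_rfl⟩, hr.2⟩

theorem isHom_mooreToNN : mooreToNN.IsHom where
  one := rfl
  mul a _ b _ := by simp [mooreToNN, moore, nn]
  len _ _ := rfl

/-- The map that takes `(r, s, t)` to `r`. -/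
def nnToMoore : PosMap nn moore where
  toFun a := a.1
  continuousOn := by fun_prop
  mem _ ha := ha.1
  mem_pos _ ha := ⟨ha.1.1, ha.2⟩

theorem one_mem_pos_moore : (1 : ℝ) ∈ moore.posCarrier := ⟨(zero_le_one : (0 : ℝ) ≤ 1), one_pos⟩

theorem two_mem {x y : ℝ} (hx : 0 < x) (hxy : x ≤ y) (hy : y < 1) :
    ![(0, x), (y, 1)] ∈ littleSet 2 := by
  refine ⟨fun i => ?_, fun i k hik => ?_⟩
  · fin_cases i
    · exact ⟨le_rfl, hx, hxy.trans hy.le⟩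
    · exact ⟨hx.le.trans hxy, hy, le_rfl⟩
  · fin_cases i <;> fin_cases k
    · exact absurd hik (by decide)
    · exact hxy
    · exact absurd hik (by decide)
    · exact absurd hik (by decide)

/-- The initial pair of the homotopy for `UA ⟶ A`; the intervals are disjoint in the interior
because `x ≤ 1`. -/
theorem half_mem {p : ℝ × ℝ} (hp : p ∈ intervals.posCarrier) :
    ![(0, p.1 / 2), (1 / 2, 1)] ∈ littleSet 2 :=
  two_mem (half_pos hp.2) (div_le_div_of_nonneg_right (hp.1.2.1.le.trans hp.1.2.2) two_pos.le)
    one_half_lt_one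

theorem upper_half_mem : (fun _ => (1 / 2, 1)) ∈ littleSet 1 :=
  single_mem one_half_pos.le one_half_lt_one le_rfl

theorem lower_half_mem : (fun _ => (0, 1 / 2)) ∈ littleSet 1 :=
  single_mem le_rfl one_half_pos one_half_lt_one.le

theorem halves_mem : ![(0, 1 / 2), (1 / 2, 1)] ∈ littleSet 2 :=
  two_mem one_half_pos le_rfl one_half_lt_one

end Maps

/-! ### The canonical map from the enveloping algebra to `A` -/

section Homotopies

variable {P : ObjectProperty TopCat.{w}} [ContainsConvex P]
  [CartesianMonoidalCategory P.FullSubcategory] [BraidedCategory P.FullSubcategory]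
  {C : Type u} [Category.{v} C] [MonoidalCategory C] [SymmetricCategory C]
  {L : P.FullSubcategory ⥤ C} [L.Braided]

theorem Homotopic.comp_left {X Y Z : C} (h : X ⟶ Y) {f g : Y ⟶ Z} (hfg : Homotopic L f g) :
    Homotopic L (h ≫ f) (h ≫ g) := by
  obtain ⟨H, hf, hg⟩ := hfg
  have e : ∀ {t} (ht : t ∈ Set.Icc (0 : ℝ) 1),
      cylinderAt L X t ht ≫ h ▷ L.obj (interval P) = h ≫ cylinderAt L Y t ht := by
    intro t ht
    rw [cylinderAt_eq, cylinderAt_eq, Category.assoc, whisker_exchange,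
      rightUnitor_inv_naturality_assoc]
  refine ⟨h ▷ L.obj (interval P) ≫ H, ?_, ?_⟩
  · rw [← Category.assoc, e, Category.assoc, hf]
  · rw [← Category.assoc, e, Category.assoc, hg]

theorem cylinderAt_braiding (X : C) {t : ℝ} (ht : t ∈ Set.Icc (0 : ℝ) 1) :
    cylinderAt L X t ht ≫ (β_ X (L.obj (interval P))).hom = ins (lpt L (intervalPt P ht)) X := by
  rw [cylinderAt_eq, Category.assoc, BraidedCategory.braiding_naturality_right, ins,
    rightUnitor_inv_braiding_assoc]

/-- The space of single little intervals is convex, so any two are joined by a segment. -/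
theorem Alg.opAt₁_homotopic (A : Alg L) {c d : Fin 1 → ℝ × ℝ} (hc : c ∈ littleSet 1)
    (hd : d ∈ littleSet 1) : Homotopic L (A.opAt₁ hc) (A.opAt₁ hd) := by
  let γ : interval P ⟶ little P 1 := map₁ (convex_Icc 0 1) (convex_littleSet 1)
    (fun t : ℝ => (1 - t) • c + t • d) (by fun_prop)
    fun _ ht => segment_mem (convex_littleSet 1) hc hd ht
  have e : ∀ {t} (ht : t ∈ Set.Icc (0 : ℝ) 1), cylinderAt L A.X t ht ≫
      (β_ A.X (L.obj (interval P))).hom ≫ (L.map γ ⊗ₘ (λ_ A.X).inv) ≫ A.act 1 =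
        A.opAt₁ (segment_mem (convex_littleSet 1) hc hd ht) := by
    intro t ht
    rw [← Category.assoc, cylinderAt_braiding, ← Category.assoc, ins_tensorHom, lpt_map, opAt₁,
      opAt, Category.assoc]
    rfl
  refine ⟨_, (e _).trans ?_, (e _).trans ?_⟩
  · exact congrArg ((λ_ A.X).inv ≫ ·) (A.opAt_congr _ _ fun i => by simp)
  · exact congrArg ((λ_ A.X).inv ≫ ·) (A.opAt_congr _ _ fun i => by simp)

end Homotopies

namespace Alg

variable {P : ObjectProperty TopCat.{w}} [ContainsConvex P]
  [CartesianMonoidalCategory P.FullSubcategory] [BraidedCategory P.FullSubcategory]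
  {C : Type u} [Category.{v} C] [MonoidalCategory C] [SymmetricCategory C]
  {L : P.FullSubcategory ⥤ C} [L.Braided] [HasCountableColimits C] (A : Alg L)

theorem envAt_toAlg {m : ℕ} {c : Fin (m + 1) → ℝ × ℝ} (hc : c ∈ littleSet (m + 1)) :
    A.envAt hc ≫ A.envToAlg = (ρ_ (tpow A.X m)).inv ≫ tpow A.X m ◁ A.one ≫ A.opAt hc := by
  rw [envAt, Category.assoc, envToAlg, envι_desc, envToAlgSummand, ← Category.assoc,
    ins_whiskerLeft, opAt]
  simp only [Category.assoc]

theorem envAt_toAlg_zero {c : Fin 1 → ℝ × ℝ} (hc : c ∈ littleSet 1) :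
    A.envAt (m := 0) hc ≫ A.envToAlg = A.one := by
  refine (A.envAt_toAlg (m := 0) hc).trans (Eq.trans ?_ (A.one_opAt₁ hc))
  rw [opAt₁, leftUnitor_inv_naturality_assoc, unitors_inv_equal]

/-- The last interval is filled with `1_A` and disappears. At `([0, x], [x, y])` the operation `[0,
x]` remains, so this map does not correspond to `padToAlg`. -/
theorem envAt₁_toAlg {c : Fin 2 → ℝ × ℝ} (hc : c ∈ littleSet 2) {d : Fin 1 → ℝ × ℝ}
    (hd : d ∈ littleSet 1) (h : d 0 = c 0) : A.envAt₁ hc ≫ A.envToAlg = A.opAt₁ hd := by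
  have h₁ := A.opAt₂_one hc hd h
  rw [opAt₂, whisker_exchange_assoc] at h₁
  rw [envAt₁, Category.assoc, A.envAt_toAlg (m := 1) hc, ← cancel_epi (ρ_ A.X).hom, ← h₁,
    ← rightUnitor_naturality_assoc, Iso.hom_inv_id_assoc]

variable [MonoidalClosed C] [L.IsLeftAdjoint]

/-- Going to `A` and back by `([0, 1/2], [1/2, 1])` replaces `([0, x], [x, y])` by `([0, x/2], [1/2,
1])`, and on the unit part it replaces `[x, y]` by `[1/2, 1]`. Linear interpolation leads back to
the original intervals. -/
theorem padToEnv_homotopic :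
    Homotopic L (A.padToEnv ≫ A.envToAlg ≫ A.envAt₁ halves_mem) A.padToEnv := by
  have k₁ : ∀ {c : Fin 1 → ℝ × ℝ} (hc : c ∈ littleSet 1),
      A.envAt (m := 0) hc = ins (lpt L (ofMem (convex_littleSet 1) hc)) (𝟙_ C) ≫ A.envι 0 :=
    fun _ => rfl
  have k₂ : ∀ {c : Fin 2 → ℝ × ℝ} (hc : c ∈ littleSet 2),
      A.envAt₁ hc = ins (lpt L (ofMem (convex_littleSet 2) hc)) A.X ≫
        L.obj (space P _ (convex_littleSet 2)) ◁ (λ_ A.X).inv ≫ A.envι 1 := by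
    intro c hc
    have h := ins_whiskerLeft (opPt L hc) (λ_ A.X).inv =≫ A.envι 1
    simp only [Category.assoc] at h
    exact h.symm
  refine A.pad_homotopic intervals (convex_littleSet 1) (f₁ := fun _ _ => (1 / 2, 1))
    (g₁ := fun p _ => p) continuousOn_const
    (continuous_pi fun _ => continuous_id).continuousOn (fun _ _ => upper_half_mem)
    (fun _ hp => interval_single_mem hp) (A.envι 0) (convex_littleSet 2)
    (f₂ := fun p => ![(0, p.1 / 2), (1 / 2, 1)]) (g₂ := fun p => ![(0, p.1), (p.1, p.2)])
    (continuous_pi fun i => ?_).continuousOn continuous_pair.continuousOn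
    (fun _ hp => half_mem hp) (fun _ hp => interval_pair_mem hp)
    (L.obj (space P _ (convex_littleSet 2)) ◁ (λ_ A.X).inv ≫ A.envι 1) ?_ ?_ ?_ ?_ ?_
  · fin_cases i
    · exact continuous_const.prodMk (continuous_fst.div_const 2)
    · exact continuous_const
  -- At each time the second interval of the pair is the interval used on the unit part, so
  -- inserting `1_A` into the first gives agreement.
  · intro a _ t _ h₁ h₂
    rw [← k₁, ← k₂]
    refine (A.one_envAt₁ h₂ h₁ ?_).symm
    simp
  · intro a ha
    rw [← Category.assoc, padOne_toEnv, ← Category.assoc, envAt_toAlg_zero, ← k₁]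
    exact A.one_envAt₁ _ _ rfl
  · intro a ha
    have h : (fun _ => (0, a.1)) ∈ littleSet 1 :=
      single_mem le_rfl ha.2 (ha.1.2.1.le.trans ha.1.2.2)
    rw [← Category.assoc, padAt_toEnv, ← Category.assoc, A.envAt₁_toAlg _ h rfl, ← k₂, opAt₁,
      Category.assoc]
    refine congrArg ((λ_ A.X).inv ≫ ·) (A.opAt_envAt₁ h halves_mem _ (fun i => ?_) rfl)
    rw [Subsingleton.elim i 0]
    simp [rescale]
    ring
  · intro a ha
    rw [padOne_toEnv, ← k₁]
  · intro a ha
    rw [padAt_toEnv, ← k₂]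

theorem envToAlg_homotopyEquivalence : IsHomotopyEquivalence L A.envToAlg := by
  refine ⟨A.envAt₁ halves_mem, ?_, ?_⟩
  · have h := A.padToEnv_homotopic.comp_left A.envToPad
    rwa [← Category.assoc, envToPad_toEnv, Category.id_comp] at h
  -- The composite on `A` is the operation `[0, 1/2]`, which is deformed to the identity operation
  -- `[0,1]`.
  · have h₁ : (fun _ => (0, 1)) ∈ littleSet 1 := single_mem le_rfl one_pos le_rfl
    rw [A.envAt₁_toAlg halves_mem lower_half_mem rfl, ← A.opAt₁_eq_id h₁ rfl]
    exact A.opAt₁_homotopic _ _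

/-- The map from the enveloping algebra to `N A`. -/
def envToNN : A.env ⟶ A.pad nn := A.envToPad ≫ A.padChange intervalsToNN

theorem isMonHom_envToNN :
    letI := A.envMon; letI := A.padMon nn; IsMonHom A.envToNN := by
  let := A.padMon intervals
  let := A.padMon nn
  let := A.envMon
  have := A.isMonHom_envToPad
  have := A.isMonHom_padChange isHom_intervalsToNN
  exact inferInstanceAs (IsMonHom (A.envToPad ≫ A.padChange intervalsToNN))

theorem envToNN_naturality {A B : Alg L} (φ : A ⟶ B) :
    envMap φ ≫ B.envToNN = A.envToNN ≫ padMap nn φ := by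
  have h : envMap φ ≫ B.envToPad = A.envToPad ≫ padMap intervals φ := by
    have h₁ := A.envToPad ≫= padToEnv_naturality φ =≫ B.envToPad
    rw [Category.assoc, padToEnv_toPad, Category.comp_id, Category.assoc,
      ← Category.assoc A.envToPad, envToPad_toEnv, Category.id_comp] at h₁
    exact h₁.symm
  rw [envToNN, envToNN, ← Category.assoc, h, Category.assoc, padChange_naturality, Category.assoc]

theorem envInl_toNN :
    A.envInl ≫ A.envToNN = L.map (littleToN P) ▷ 𝟙_ C ≫ A.padInl nn := by
  rw [envInl, envToNN, envToPad, ← Category.assoc, envι_desc]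
  change (L.map (toInterval P) ▷ 𝟙_ C ≫ A.padInl intervals) ≫ _ = _
  rw [Category.assoc, padInl_change, ← Category.assoc, ← comp_whiskerRight, ← L.map_comp]
  rfl

theorem envInr_toNN :
    A.envInr ≫ A.envToNN = L.map (innerToN P) ▷ A.X ≫ A.padInr nn := by
  refine jointlyEpi_ins L (innerSpace P) _ _ _ fun x => ?_
  have hx : val x ∈ innerSet := val_mem x
  have hp : val x ∈ intervals.posCarrier := ⟨⟨hx.1.le, hx.2⟩, hx.1⟩
  have h₁ : ins (lpt L x) A.X ≫ A.envInr = A.padAt intervals hp ≫ A.padToEnv := by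
    rw [padAt_toEnv, envInr, ← Category.assoc, ins_tensorHom, lpt_map, Category.assoc, envAt₁,
      envAt]
    rfl
  rw [← Category.assoc, h₁, envToNN, Category.assoc, ← Category.assoc A.padToEnv, padToEnv_toPad,
    Category.id_comp, padAt_change, ← Category.assoc, ins_whiskerRight, lpt_map, padAt]
  rfl

/-- Normalizing `r + s + t` to `1` gives a strict left inverse; only the other composite needs a
homotopy. -/
theorem envToNN_homotopyEquivalence : IsHomotopyEquivalence L A.envToNN := by
  refine ⟨A.padChange nnToIntervals ≫ A.padToEnv, Homotopic.of_eq ?_, ?_⟩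
  · rw [envToNN, Category.assoc, ← Category.assoc (A.padChange _), padChange_comp,
      A.padChange_id _ fun p _ => nnToIntervals_intervalsToNN p, Category.id_comp, envToPad_toEnv]
  · rw [envToNN, Category.assoc, ← Category.assoc A.padToEnv, padToEnv_toPad, Category.id_comp,
      padChange_comp]
    exact A.padChange_homotopic_id _

end Alg

/-! ### The zigzag as natural transformations of functors to monoids -/

section

variable {P : ObjectProperty TopCat.{w}} [ContainsConvex P]
  [CartesianMonoidalCategory P.FullSubcategory] [BraidedCategory P.FullSubcategory]
  {C : Type u} [Category.{v} C] [MonoidalCategory C] [SymmetricCategory C]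
  {L : P.FullSubcategory ⥤ C} [L.Braided] [HasCountableColimits C]

/-- A natural transformation whose components are homomorphisms, as a transformation of functors
to monoids. -/
def MonoidLift.natTrans {F G : Alg L ⥤ C} (N : MonoidLift F) (N' : MonoidLift G) (τ : F ⟶ G)
    (h : ∀ A, letI := N.mon A; letI := N'.mon A; IsMonHom (τ.app A)) :
    N.functor ⟶ N'.functor where
  app A := @Mon.Hom.mk _ _ _ (N.functor.obj A) (N'.functor.obj A) (τ.app A) (h A)
  naturality A B φ := by ext; exact τ.naturality φ

variable (L) [MonoidalClosed C] [L.IsLeftAdjoint]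

/-- The maps from enveloping algebras to the algebras `N A`. -/
def envToNNTrans : (envLift L).functor ⟶ (padLift L nn).functor :=
  MonoidLift.natTrans _ _ ⟨fun A => A.envToNN, fun _ _ φ => Alg.envToNN_naturality φ⟩
    fun A => A.isMonHom_envToNN

/-- The maps from the algebras `M A` to the algebras `N A`. -/
def mooreToNNTrans : (padLift L moore).functor ⟶ (padLift L nn).functor :=
  MonoidLift.natTrans _ _
    ⟨fun A => A.padChange mooreToNN, fun _ _ φ => Alg.padChange_naturality φ mooreToNN⟩
    fun A => A.isMonHom_padChange isHom_mooreToNN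

end

end

end LittleIntervals

theorem mainTheorem5
    {P : ObjectProperty TopCat.{w}} [LittleIntervals.ContainsConvex P]
    [CartesianMonoidalCategory P.FullSubcategory] [BraidedCategory P.FullSubcategory]
    {C : Type u} [Category.{v} C] [MonoidalCategory C] [SymmetricCategory C] [MonoidalClosed C]
    [HasCountableColimits C]
    (L : P.FullSubcategory ⥤ C) [L.Braided] [L.IsLeftAdjoint] :
    ∃ (U : LittleIntervals.MonoidLift (LittleIntervals.Alg.envFunctor L))
      (N : LittleIntervals.MonoidLift
        (LittleIntervals.Alg.padFunctor LittleIntervals.nn L))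
      (M : LittleIntervals.MonoidLift
        (LittleIntervals.Alg.padFunctor LittleIntervals.moore L)),
      (∀ A : LittleIntervals.Alg L, A.IsEnvelopingMonoid (U.mon A)) ∧
      (∀ A : LittleIntervals.Alg L, A.IsPadMonoid LittleIntervals.nn (N.mon A)) ∧
      (∀ A : LittleIntervals.Alg L, A.IsPadMonoid LittleIntervals.moore (M.mon A)) ∧
      (∃ (f : U.functor ⟶ N.functor) (g : M.functor ⟶ N.functor),
        (∀ A : LittleIntervals.Alg L,
          A.envInl ≫ (f.app A).hom =
              L.map (LittleIntervals.littleToN P) ▷ 𝟙_ C ≫ A.padInl LittleIntervals.nn ∧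
            A.envInr ≫ (f.app A).hom =
              L.map (LittleIntervals.innerToN P) ▷ A.X ≫ A.padInr LittleIntervals.nn ∧
            A.padInl LittleIntervals.moore ≫ (g.app A).hom =
              L.map (LittleIntervals.mooreToN P) ▷ 𝟙_ C ≫ A.padInl LittleIntervals.nn ∧
            A.padInr LittleIntervals.moore ≫ (g.app A).hom =
              L.map (LittleIntervals.mooreToNPos P) ▷ A.X ≫ A.padInr LittleIntervals.nn) ∧
        ∀ A : LittleIntervals.Alg L,
          LittleIntervals.IsHomotopyEquivalence L (f.app A).hom ∧
            LittleIntervals.IsHomotopyEquivalence L (g.app A).hom) ∧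
      (∀ A : LittleIntervals.Alg L, LittleIntervals.IsHomotopyEquivalence L A.envToAlg) ∧
      ∀ A : LittleIntervals.Alg L,
        LittleIntervals.IsHomotopyEquivalence L (A.padToAlg LittleIntervals.moore) :=
  open LittleIntervals in
  ⟨envLift L, padLift L nn, padLift L moore, fun A => A.isEnvelopingMonoid_envMon,
    fun A => A.isPadMonoid_padMon nn, fun A => A.isPadMonoid_padMon moore,
    ⟨envToNNTrans L, mooreToNNTrans L,
      fun A => ⟨A.envInl_toNN, A.envInr_toNN, A.padInl_change mooreToNN,
        A.padInr_change mooreToNN⟩,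
      fun A => ⟨A.envToNN_homotopyEquivalence,
        -- The map back, `(r, s, t) ↦ r`, is not multiplicative, which does not matter for the
        -- homotopy equivalence.
        A.padChange_homotopyEquivalence mooreToNN nnToMoore⟩⟩,
    fun A => A.envToAlg_homotopyEquivalence,
    -- Any positive Moore length would serve in place of `1`.
    fun A => A.padToAlg_homotopyEquivalence one_mem_pos_moore⟩
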